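/- **Setting.** Let $V:\mathbb R\to\mathbb R$ be $1$-periodic and locally square integrable. For $\mathcal E\in\mathbb C$ consider the equation $$-\psi''(u)+V(u)\psi(u)=\mathcal E\,\psi(u),\qquad u\in\mathbb R. \tag{1}$$ A *Bloch solution* with *Floquet multiplier* $\lambda$ is a nontrivial solution with $\psi(u+1)=\lambda\psi(u)$ for all $u$. The *Bloch quasi-momentum* is the multi-valued function $k(\mathcal E)$ such that $e^{ik(\mathcal E)}$ is a Floquet multiplier of (1); a *branching point* of $k$ is a point near which $k$ has no analytic branch. Let $c(u,\mathcal E)$ and $s(u,\mathcal E)$ be the solutions of (1) with $c=1,\ c'=0$ and $s=0,\ s'=1$ at $u=0$. For an analytic branch $k$ on an open set, let $$\psi_\pm(u,\mathcal E)=c(u,\mathcal E)+\frac{e^{\pm ik(\mathcal E)}-c(1,\mathcal E)}{s(1,\mathcal E)}\,s(u,\mathcal E)$$ be the Bloch solutions with multipliers $e^{\pm ik(\mathcal E)}$ and $\psi_\pm(0,\mathcal E)=1$ (meromorphic in $\mathcal E$, with poles among the zeros of $s(1,\cdot)$), and put $p_\pm(u,\mathcal E)=e^{\mp ik(\mathcal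 E)u}\psi_\pm(u,\mathcal E)$ and $$g_\pm(\mathcal E)=-\frac{\int_0^1 p_\mp\,\partial_{\mathcal E}p_\pm\,dx}{\int_0^1 p_+p_-\,dx}.$$ Let $D\subset\mathbb C$ be a simply connected domain, $E\in\mathbb C$, and let $W$ be analytic and nonconstant on $D$. Assume that $D$ contains no branching point, i.e. for no $\varphi\in D$ is $E-W(\varphi)$ a branching point of $k$. Fix a continuous branch $\kappa$ on $D$ of the complex momentum $\kappa(\varphi)=k(E-W(\varphi))$; near each point it determines a branch of $k$, hence $\psi_\pm$ and $g_\pm$. Call $\varphi_0\in D$ *regular* if $s(1,\mathcal E_0)\ne0$ and $k'(\mathcal E_0)\neq 0$, where $\mathcal E_0=E-W(\varphi_0)$. *Canonical Bloch solutions* associated with $D$ are functions $\Psi_\pm(u,\varphi)$ such that, near every regular $\varphi_0$, $$\Psi_\pm(u,\varphi)=\sqrt{k'(\mathcal E)}\;e^{\int^{\mathcal E}g_\pm(e)\,de}\;\psi_\pm(u,\mathcal E),\qquad \mathcal E=E-W(\varphi),\quad u\in\mathbb R,$$ with some analytic branch of $\sqrt{k'}$ and some primitive of $g_\pm$ near $\mathcal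 E_0$, both independent of $u$. **Lemma 3.1.** The non-regular points are isolated in $D$. For each sign there exists a canonical Bloch solution $\Psi_\pm$ such that, for every $u\in\mathbb R$, $\varphi\mapsto\Psi_\pm(u,\varphi)$ is analytic on all of $D$ (including at the poles of $\psi_\pm(u,E-W(\varphi))$), and such that, for every $\varphi\in D$, $\Psi_\pm(\cdot,\varphi)$ is a Bloch solution of (1) with $\mathcal E=E-W(\varphi)$ and multiplier $e^{\pm i\kappa(\varphi)}$. It is unique up to a constant: every canonical Bloch solution of the same sign coincides at the regular points with $C\,\Psi_\pm$ for a constant $C\neq0$ independent of $u$ and $\varphi$. In particular, every canonical Bloch solution extends analytically to $D$. -/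

import Mathlib

open Filter Topology

noncomputable section

namespace PeriodicSchrodinger

/-- `ψ` is a solution on the real line of `-ψ'' + V ψ = 𝓔 ψ`, in the usual sense for a locally
integrable potential: `ψ` is differentiable, `ψ'` is locally absolutely continuous, and the
equation holds almost everywhere (written as the integrated equation for `ψ'`). -/
def IsSolution (V : ℝ → ℝ) (𝓔 : ℂ) (ψ : ℝ → ℂ) : Prop :=
  Differentiable ℝ ψ ∧
    ∀ x : ℝ, deriv ψ x = deriv ψ 0 + ∫ t in (0 : ℝ)..x, ((V t : ℂ) - 𝓔) * ψ t

/-- `ψ` is a Bloch solution with Floquet multiplier `lam`: a nontrivial solution with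
`ψ (x + 1) = lam * ψ x` for all real `x`. -/
def IsBlochSolution (V : ℝ → ℝ) (𝓔 lam : ℂ) (ψ : ℝ → ℂ) : Prop :=
  IsSolution V 𝓔 ψ ∧ ψ ≠ 0 ∧ ∀ x : ℝ, ψ (x + 1) = lam * ψ x

/-- `lam` is a Floquet multiplier at the energy `𝓔`. -/
def IsFloquetMultiplier (V : ℝ → ℝ) (𝓔 lam : ℂ) : Prop :=
  ∃ ψ : ℝ → ℂ, IsBlochSolution V 𝓔 lam ψ

/-- `𝓔₀` is a branching point of the Bloch quasi-momentum: the multi-valued function `k` with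
`exp (i k(𝓔))` a Floquet multiplier at `𝓔` has no analytic branch in a neighbourhood of `𝓔₀`.
(These are the ends of the spectral zones, apart from those at which a gap is closed.) -/
def IsBranchPoint (V : ℝ → ℝ) (𝓔₀ : ℂ) : Prop :=
  ¬ ∃ k : ℂ → ℂ, AnalyticAt ℂ k 𝓔₀ ∧
      ∀ᶠ 𝓔 in 𝓝 𝓔₀, IsFloquetMultiplier V 𝓔 (Complex.exp (Complex.I * k 𝓔))

/-- The solution with initial data `ψ 0 = a`, `ψ' 0 = b` (it exists and is unique as soon as `V`
is locally integrable). -/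
def cauchySol (V : ℝ → ℝ) (𝓔 a b : ℂ) : ℝ → ℂ :=
  Classical.epsilon fun ψ : ℝ → ℂ => IsSolution V 𝓔 ψ ∧ ψ 0 = a ∧ deriv ψ 0 = b

/-- The solution with data `(1, 0)` at `0`. -/
def cosSol (V : ℝ → ℝ) (𝓔 : ℂ) : ℝ → ℂ := cauchySol V 𝓔 1 0

/-- The solution with data `(0, 1)` at `0`. -/
def sinSol (V : ℝ → ℝ) (𝓔 : ℂ) : ℝ → ℂ := cauchySol V 𝓔 0 1

/-- The Bloch solutions `ψ_±(u, 𝓔)`, for a branch `k` of the quasi-momentum: the solution with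
`ψ_±(0, 𝓔) = 1` and `ψ_±(1, 𝓔) = exp (± i k(𝓔))`. It is meromorphic in `𝓔`, and its poles are
among the zeros of `sinSol V 𝓔 1` (at which the formula below is not used). The sign is `σ`. -/
def blochPsi (V : ℝ → ℝ) (k : ℂ → ℂ) (σ : ℤˣ) (u : ℝ) (𝓔 : ℂ) : ℂ :=
  cosSol V 𝓔 u +
    (Complex.exp (((σ : ℤ) : ℂ) * Complex.I * k 𝓔) - cosSol V 𝓔 1) / sinSol V 𝓔 1 * sinSol V 𝓔 u

/-- The periodic component `p_±(u, 𝓔) = exp (∓ i k(𝓔) u) ψ_±(u, 𝓔)`. -/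
def blochP (V : ℝ → ℝ) (k : ℂ → ℂ) (σ : ℤˣ) (u : ℝ) (𝓔 : ℂ) : ℂ :=
  Complex.exp (-(((σ : ℤ) : ℂ) * Complex.I * k 𝓔 * (u : ℂ))) * blochPsi V k σ u 𝓔

/-- `g_±(𝓔) = - ∫₀¹ p_∓ ∂p_±/∂𝓔 dx / ∫₀¹ p_+ p_- dx`. -/
def blochG (V : ℝ → ℝ) (k : ℂ → ℂ) (σ : ℤˣ) (𝓔 : ℂ) : ℂ :=
  -(∫ x in (0 : ℝ)..1, blochP V k (-σ) x 𝓔 * deriv (fun e : ℂ => blochP V k σ x e) 𝓔) /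
    (∫ x in (0 : ℝ)..1, blochP V k 1 x 𝓔 * blochP V k (-1) x 𝓔)

/-- `κ` is a continuous branch on `D` of the complex momentum `κ(φ) = k(E - W(φ))`. -/
def IsMomentumBranch (V : ℝ → ℝ) (W : ℂ → ℂ) (E : ℂ) (D : Set ℂ) (κ : ℂ → ℂ) : Prop :=
  ContinuousOn κ D ∧
    ∀ φ ∈ D, IsFloquetMultiplier V (E - W φ) (Complex.exp (Complex.I * κ φ))

/-- `k` is the branch of the quasi-momentum near `𝓔₀ = E - W(φ₀)` corresponding to the branch `κ`
of the complex momentum near `φ₀`, that is, `κ(φ) = k(E - W(φ))`. -/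
def IsLocalBranch (W : ℂ → ℂ) (E : ℂ) (κ k : ℂ → ℂ) (φ₀ : ℂ) : Prop :=
  AnalyticAt ℂ k (E - W φ₀) ∧ ∀ᶠ φ in 𝓝 φ₀, κ φ = k (E - W φ)

/-- The points `φ₀` of `D` for which `𝓔₀ = E - W(φ₀)` is neither a point where one of the Bloch
solutions `ψ_±` may have a pole nor a zero of `k'`. -/
def regularSet (V : ℝ → ℝ) (W : ℂ → ℂ) (E : ℂ) (D : Set ℂ) (κ : ℂ → ℂ) : Set ℂ :=
  {φ₀ | φ₀ ∈ D ∧ sinSol V (E - W φ₀) 1 ≠ 0 ∧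
    ∃ k : ℂ → ℂ, IsLocalBranch W E κ k φ₀ ∧ deriv k (E - W φ₀) ≠ 0}

/-- `Ψ` is a canonical Bloch solution (of sign `σ`) associated with `D`, where the formula
`Ψ_±(u, φ) = √(k'(𝓔)) exp (∫^𝓔 g_±) ψ_±(u, 𝓔)`, `𝓔 = E - W(φ)`, has a direct meaning: near every
regular point `φ₀` it holds with an analytic branch `q` of the square root of `k'` and a primitive
`G` of `g_±`, both defined near `E - W(φ₀)` and independent of `u`. -/
def IsCanonicalBloch (V : ℝ → ℝ) (W : ℂ → ℂ) (E : ℂ) (D : Set ℂ) (κ : ℂ → ℂ) (σ : ℤˣ)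
    (Ψ : ℝ → ℂ → ℂ) : Prop :=
  ∀ φ₀ ∈ regularSet V W E D κ, ∃ k q G : ℂ → ℂ,
    IsLocalBranch W E κ k φ₀ ∧
    AnalyticAt ℂ q (E - W φ₀) ∧ (∀ᶠ 𝓔 in 𝓝 (E - W φ₀), q 𝓔 ^ 2 = deriv k 𝓔) ∧
    (∀ᶠ 𝓔 in 𝓝 (E - W φ₀), HasDerivAt G (blochG V k σ 𝓔) 𝓔) ∧
    ∀ᶠ φ in 𝓝 φ₀, ∀ u : ℝ,
      Ψ u φ = q (E - W φ) * Complex.exp (G (E - W φ)) * blochPsi V k σ u (E - W φ)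

end PeriodicSchrodinger

end

/-! Canonical Bloch solutions of a periodic Schrödinger equation continue analytically.

Let `f` be a Bloch solution at the energy `e` with multiplier `exp (i k(e))` and `f'` one at the
energy `E` with multiplier `exp (-i k(E))`. Integrated over a period, the Lagrange identity for
their periodic components reads `(E - e) A = i (k(e) - k(E)) B`, where `A` is the integral of their
product and `B` that of their Wronskian, both weighted by `exp (-i (k(e) - k(E)) x)`
(`lagrange_periodic`). On the diagonal `B` is the Wronskian `w` of the two solutions, so the
expansion to second order at `e = E` gives `A = -i k' w` together with the energy derivative of `A`.
Hence, when the solutions have Cauchy data `(p, q)` and `(p', q')` depending analytically on the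
energy, `g = p_e / p - k'' / (2 k') - ∂B / w` (`BlochFrame.blochG_eq`), where `p_e` is the energy
derivative of `p`. Since `ψ = f / p`, all singular factors cancel in `√k' exp (∫ g) ψ`, which is a
constant times `exp (-∫ ∂B / w) f`. This expression is analytic wherever there is an analytic pair
of linearly independent Bloch solutions.

Such a pair exists near every energy `E₀` that is not a branching point (`exists_eigenvectors`).
This is clear unless the multiplier `λ` is `±1` at `E₀`. Then `E₀` is real and the discriminant is
critical there, which by the positivity of the Gram matrix of `c` and `s` is possible only for a
closed gap: the monodromy matrix `M` is `±1`, and `λ' ≠ 0` (`closed_gap`). Thus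
`(2 M - tr M) / (λ - 1/λ)` has a removable singularity, and its value is an involution whose
eigenspaces are spanned by the required Cauchy data. The underlying analyticity of the fundamental
system in the energy comes from a Volterra equation in a weighted space
(`exists_analytic_family`), after the integrable potential is removed by passing from `ψ'` to
`ψ' - (∫ V) ψ`.

A continuous branch of the complex momentum is locally an analytic branch of the quasi-momentum
because the two multipliers are the roots of a quadratic equation whose discriminant vanishes at
isolated points only (`exists_isLocalBranch`). Two canonical Bloch solutions differ by a locally
constant factor at the regular points, and the regular points of a connected open set have isolated
complement, so the factor is constant (`exists_const_of_canonicalAt`). The local solutions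
therefore differ by constants, and these are the transition functions of a covering of the simply
connected domain, which has a section (`exists_global_section`).
-/

noncomputable section

namespace PeriodicSchrodinger

/-! ### Primitives of integrable functions and solutions of the equation -/

section

open MeasureTheory intervalIntegral

/-- `A` is an indefinite integral of the locally integrable function `a`. This is local absolute
continuity of `A` with `A' = a` almost everywhere. -/
structure IsPrimitive (A a : ℝ → ℂ) : Prop where
  intervalIntegrable : ∀ x y : ℝ, IntervalIntegrable a volume x y
  eq_add : ∀ x : ℝ, A x = A 0 + ∫ t in (0 : ℝ)..x, a t

namespace IsPrimitive

variable {A B a b : ℝ → ℂ}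

lemma continuous (h : IsPrimitive A a) : Continuous A := by
  rw [show A = fun x => A 0 + ∫ t in (0 : ℝ)..x, a t from funext h.eq_add]
  exact continuous_const.add (continuous_primitive h.intervalIntegrable 0)

lemma of_hasDerivAt (h : ∀ x, HasDerivAt A (a x) x) (ha : Continuous a) : IsPrimitive A a :=
  ⟨fun _ _ => ha.intervalIntegrable _ _, fun x => by
    rw [integral_eq_sub_of_hasDerivAt (fun t _ => h t) (ha.intervalIntegrable _ _)]; ring⟩

lemma add (hA : IsPrimitive A a) (hB : IsPrimitive B b) :
    IsPrimitive (fun x => A x + B x) (fun x => a x + b x) :=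
  ⟨fun x y => (hA.1 x y).add (hB.1 x y), fun x => by
    rw [integral_add (hA.1 _ _) (hB.1 _ _), hA.2 x, hB.2 x]; ring⟩

lemma const_mul (hA : IsPrimitive A a) (c : ℂ) :
    IsPrimitive (fun x => c * A x) (fun x => c * a x) :=
  ⟨fun x y => (hA.1 x y).const_mul c, fun x => by
    rw [intervalIntegral.integral_const_mul, hA.2 x]; ring⟩

lemma sub (hA : IsPrimitive A a) (hB : IsPrimitive B b) :
    IsPrimitive (fun x => A x - B x) (fun x => a x - b x) := by
  simpa [sub_eq_add_neg] using hA.add (hB.const_mul (-1))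

lemma congr_right (hA : IsPrimitive A a) (h : ∀ x, a x = b x) : IsPrimitive A b := by
  rwa [← funext h]

lemma absolutelyContinuous (h : IsPrimitive A a) (x y : ℝ) :
    AbsolutelyContinuousOnInterval A x y := by
  -- Mathlib knows the absolute continuity of primitives of real functions only
  have key : ∀ f : ℝ → ℝ, (∀ x y : ℝ, IntervalIntegrable f volume x y) →
      AbsolutelyContinuousOnInterval (fun u => ∫ t in (0 : ℝ)..u, f t) x y := fun f hf =>
    ((hf (min 0 (min x y)) (max 0 (max x y))).absolutelyContinuousOnInterval_intervalIntegral
      (c := 0) (by simp)).mono (by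
        rw [Set.uIcc_of_le (a := min 0 (min x y)) (by simp)]
        exact Set.Icc_subset_Icc (by simp) (by simp))
  have hre := key (fun t => (a t).re) fun u v => ⟨(h.1 u v).1.re, (h.1 u v).2.re⟩
  have him := key (fun t => (a t).im) fun u v => ⟨(h.1 u v).1.im, (h.1 u v).2.im⟩
  have hc : ∀ c : ℂ, AbsolutelyContinuousOnInterval (fun _ : ℝ => c) x y := fun c =>
    (LipschitzWith.const c).lipschitzOnWith.absolutelyContinuousOnInterval
  have := ((hc (A 0)).add ((hre.smul (hc 1)).add (him.smul (hc Complex.I))))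
  refine Eq.mp (congrArg (AbsolutelyContinuousOnInterval · x y) (funext fun u => ?_)) this
  rw [h.2 u]
  simp only [Pi.add_apply, Pi.smul_apply', Complex.real_smul, mul_one]
  congr 1
  have h1 : ∫ t in (0 : ℝ)..u, (a t).re = (∫ t in (0 : ℝ)..u, a t).re :=
    intervalIntegral.intervalIntegral_re (h.1 0 u)
  have h2 : ∫ t in (0 : ℝ)..u, (a t).im = (∫ t in (0 : ℝ)..u, a t).im :=
    intervalIntegral.intervalIntegral_im (h.1 0 u)
  rw [h1, h2, Complex.re_add_im]

lemma ae_hasDerivAt (h : IsPrimitive A a) : ∀ᵐ x, HasDerivAt A (a x) x := by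
  have hl : LocallyIntegrable a volume := by
    rw [locallyIntegrable_iff]
    intro K hK
    obtain ⟨r, hr0, hr⟩ := hK.isBounded.subset_closedBall_lt 0 0
    rw [Real.closedBall_eq_Icc] at hr
    exact ((intervalIntegrable_iff_integrableOn_Icc_of_le (by linarith)).1
      (h.1 (0 - r) (0 + r))).mono_set hr
  filter_upwards [_root_.LocallyIntegrable.ae_hasDerivAt_integral hl] with x hx
  rw [show A = fun x => A 0 + ∫ t in (0 : ℝ)..x, a t from funext h.eq_add]
  exact (hx 0).const_add _

/-- The product rule, that is, integration by parts, for absolutely continuous functions. -/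
lemma mul (hA : IsPrimitive A a) (hB : IsPrimitive B b) :
    IsPrimitive (fun x => A x * B x) (fun x => a x * B x + A x * b x) := by
  have hi : ∀ x y, IntervalIntegrable (fun x => a x * B x + A x * b x) volume x y := fun x y =>
    ((hA.1 x y).mul_continuousOn hB.continuous.continuousOn).add
      ((hB.1 x y).continuousOn_mul hA.continuous.continuousOn)
  have hP : IsPrimitive (fun x => ∫ t in (0 : ℝ)..x, (a t * B t + A t * b t))
      (fun x => a x * B x + A x * b x) := ⟨hi, fun x => by simp⟩
  refine ⟨hi, fun x => ?_⟩
  have hac : AbsolutelyContinuousOnInterval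
      (fun x => A x * B x - ∫ t in (0 : ℝ)..x, (a t * B t + A t * b t)) 0 x :=
    ((hA.absolutelyContinuous 0 x).smul (hB.absolutelyContinuous 0 x)).sub
      (hP.absolutelyContinuous 0 x)
  obtain ⟨C, hC⟩ := hac.const_of_ae_hasDerivAt_zero (by
    filter_upwards [hA.ae_hasDerivAt, hB.ae_hasDerivAt, hP.ae_hasDerivAt] with t h1 h2 h3 _
    simpa [Pi.sub_def, Pi.mul_def] using (h1.mul h2).sub h3)
  have h0 := hC 0 (by simp)
  have h1 := hC x (by simp)
  simp only [intervalIntegral.integral_same, sub_zero] at h0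
  rw [h0, ← h1]; ring

end IsPrimitive

/-- A `1`-periodic potential that is square integrable over a period is locally integrable. -/
lemma intervalIntegrable_of_periodic_of_memLp {V : ℝ → ℝ} (hVper : Function.Periodic V 1)
    (hV : MemLp V 2 (volume.restrict (Set.Ioc (0 : ℝ) 1))) (x y : ℝ) :
    IntervalIntegrable V volume x y := by
  refine hVper.intervalIntegrable₀ one_ne_zero ?_ x y
  rw [intervalIntegrable_iff_integrableOn_Ioc_of_le zero_le_one]
  exact hV.integrable (by norm_num)

section Solutions

variable {V : ℝ → ℝ} {E E' : ℂ} {f g : ℝ → ℂ}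

lemma IsSolution.hasDerivAt (hf : IsSolution V E f) (x : ℝ) : HasDerivAt f (deriv f x) x :=
  (hf.1 x).hasDerivAt

lemma intervalIntegrable_potential_mul (hV : ∀ x y, IntervalIntegrable V volume x y) (E : ℂ)
    (hf : Continuous f) (x y : ℝ) :
    IntervalIntegrable (fun t => ((V t : ℂ) - E) * f t) volume x y :=
  (IntervalIntegrable.sub (f := fun t => (V t : ℂ)) ⟨(hV x y).1.ofReal, (hV x y).2.ofReal⟩
    _root_.intervalIntegrable_const).mul_continuousOn hf.continuousOn

lemma IsSolution.isPrimitive_deriv (hV : ∀ x y, IntervalIntegrable V volume x y)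
    (hf : IsSolution V E f) : IsPrimitive (deriv f) (fun t => ((V t : ℂ) - E) * f t) :=
  ⟨intervalIntegrable_potential_mul hV E hf.1.continuous, hf.2⟩

lemma IsSolution.continuous_deriv (hV : ∀ x y, IntervalIntegrable V volume x y)
    (hf : IsSolution V E f) : Continuous (deriv f) := (hf.isPrimitive_deriv hV).continuous

lemma IsSolution.isPrimitive (hV : ∀ x y, IntervalIntegrable V volume x y)
    (hf : IsSolution V E f) : IsPrimitive f (deriv f) :=
  .of_hasDerivAt hf.hasDerivAt (hf.continuous_deriv hV)

lemma isSolution_of_isPrimitive {f' : ℝ → ℂ} (h : ∀ x, HasDerivAt f (f' x) x)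
    (h' : IsPrimitive f' (fun t => ((V t : ℂ) - E) * f t)) : IsSolution V E f := by
  have : deriv f = f' := funext fun x => (h x).deriv
  exact ⟨fun x => (h x).differentiableAt, by rw [this]; exact h'.2⟩

/-- The Lagrange identity for solutions with two different energies. -/
lemma IsSolution.wronskian (hV : ∀ x y, IntervalIntegrable V volume x y)
    (hf : IsSolution V E f) (hg : IsSolution V E' g) :
    IsPrimitive (fun x => g x * deriv f x - deriv g x * f x)
      (fun x => (E' - E) * (f x * g x)) :=
  (((hg.isPrimitive hV).mul (hf.isPrimitive_deriv hV)).sub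
    ((hg.isPrimitive_deriv hV).mul (hf.isPrimitive hV))).congr_right fun x => by ring

lemma IsSolution.linear_comb (hV : ∀ x y, IntervalIntegrable V volume x y)
    (hf : IsSolution V E f) (hg : IsSolution V E g) (p q : ℂ) :
    IsSolution V E (fun x => p * f x + q * g x) :=
  isSolution_of_isPrimitive
    (fun x => ((hf.hasDerivAt x).const_mul p).add ((hg.hasDerivAt x).const_mul q))
    ((((hf.isPrimitive_deriv hV).const_mul p).add
      ((hg.isPrimitive_deriv hV).const_mul q)).congr_right fun x => by ring)

end Solutions

end

/-! ### Analytic families of solutions of a linear equation -/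

section

open MeasureTheory intervalIntegral Set BoundedContinuousFunction

section LinearODE

variable {Y : Type*} [NormedAddCommGroup Y] [NormedSpace ℂ Y]

/-- The weight `cosh (2 ∫₀ᵘ ρ)`. It is at least `1`, and its integral against `ρ` over any interval
from `0` is at most half its value at the other end, on both sides of `0`. -/
def weight (ρ : ℝ → ℝ) (u : ℝ) : ℝ := Real.cosh (2 * ∫ t in (0 : ℝ)..u, ρ t)

lemma weight_pos (ρ : ℝ → ℝ) (u : ℝ) : 0 < weight ρ u := Real.cosh_pos _

lemma one_le_weight (ρ : ℝ → ℝ) (u : ℝ) : 1 ≤ weight ρ u := Real.one_le_cosh _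

lemma continuous_weight {ρ : ℝ → ℝ} (hρ : Continuous ρ) : Continuous (weight ρ) :=
  Real.continuous_cosh.comp
    (continuous_const.mul (continuous_primitive (fun _ _ => hρ.intervalIntegrable _ _) 0))

lemma abs_integral_mul_weight_le {ρ : ℝ → ℝ} (hρ : Continuous ρ) (u : ℝ) :
    |∫ t in (0 : ℝ)..u, ρ t * weight ρ t| ≤ weight ρ u / 2 := by
  have hd : ∀ t, HasDerivAt (fun u => Real.sinh (2 * ∫ t in (0 : ℝ)..u, ρ t) / 2)
      (ρ t * weight ρ t) t := fun t => by
    have := ((Real.hasDerivAt_sinh _).comp t ((hρ.integral_hasStrictDerivAt 0 t).hasDerivAt.const_mul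
      2)).div_const 2
    exact this.congr_deriv (by simp only [weight]; ring)
  rw [integral_eq_sub_of_hasDerivAt (fun t _ => hd t)
    ((hρ.mul (continuous_weight hρ)).intervalIntegrable _ _)]
  simp only [integral_same, mul_zero, Real.sinh_zero, zero_div, sub_zero, abs_div, Nat.abs_ofNat]
  gcongr
  rw [abs_le, weight]
  constructor
  · linarith [Real.cosh_add_sinh (2 * ∫ t in (0 : ℝ)..u, ρ t),
      Real.exp_pos (2 * ∫ t in (0 : ℝ)..u, ρ t)]
  · exact (Real.sinh_lt_cosh _).le

lemma norm_integral_weight_le {ρ : ℝ → ℝ} (hρ : Continuous ρ) {A : ℝ → Y →L[ℂ] Y}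
    (hb : ∀ t, ‖A t‖ ≤ ρ t) (y : ℝ →ᵇ Y) (u : ℝ) :
    ‖(weight ρ u)⁻¹ • ∫ t in (0 : ℝ)..u, A t (weight ρ t • y t)‖ ≤ 1 / 2 * ‖y‖ := by
  have h1 : ‖∫ t in (0 : ℝ)..u, A t (weight ρ t • y t)‖ ≤
      |∫ t in (0 : ℝ)..u, ‖y‖ * (ρ t * weight ρ t)| := by
    refine norm_integral_le_abs_of_norm_le (Eventually.of_forall fun t => ?_)
      ((continuous_const.mul (hρ.mul (continuous_weight hρ))).intervalIntegrable _ _)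
    calc ‖A t (weight ρ t • y t)‖ ≤ ‖A t‖ * ‖weight ρ t • y t‖ := (A t).le_opNorm _
      _ = ‖A t‖ * (weight ρ t * ‖y t‖) := by
        rw [norm_smul, Real.norm_of_nonneg (weight_pos ρ t).le]
      _ ≤ ρ t * (weight ρ t * ‖y‖) := by
        have := weight_pos ρ t
        gcongr
        · exact (norm_nonneg _).trans (hb t)
        · exact hb t
        · exact y.norm_coe_le_norm t
      _ = _ := by ring
  rw [intervalIntegral.integral_const_mul, abs_mul, abs_of_nonneg (norm_nonneg y)] at h1
  have h2 := abs_integral_mul_weight_le hρ u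
  have hw := weight_pos ρ u
  rw [norm_smul, norm_inv, Real.norm_of_nonneg hw.le]
  calc (weight ρ u)⁻¹ * ‖∫ t in (0 : ℝ)..u, A t (weight ρ t • y t)‖
      ≤ (weight ρ u)⁻¹ * (‖y‖ * (weight ρ u / 2)) := by
        gcongr; exact h1.trans (by gcongr)
    _ = 1 / 2 * ‖y‖ := by field_simp

lemma continuous_weight_integrand {ρ : ℝ → ℝ} (hρ : Continuous ρ) {A : ℝ → Y →L[ℂ] Y}
    (hA : Continuous A) (y : ℝ →ᵇ Y) : Continuous fun t => A t (weight ρ t • y t) :=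
  hA.clm_apply ((continuous_weight hρ).smul y.continuous)

/-- The Volterra operator `y ↦ ∫₀ᵘ A y` conjugated by the weight, on bounded continuous
functions. -/
def volterra {ρ : ℝ → ℝ} (hρ : Continuous ρ) {A : ℝ → Y →L[ℂ] Y} (hA : Continuous A)
    (hb : ∀ t, ‖A t‖ ≤ ρ t) : (ℝ →ᵇ Y) →L[ℂ] (ℝ →ᵇ Y) :=
  LinearMap.mkContinuous
    { toFun := fun y => BoundedContinuousFunction.ofNormedAddCommGroup
        (fun u => (weight ρ u)⁻¹ • ∫ t in (0 : ℝ)..u, A t (weight ρ t • y t))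
        (((continuous_weight hρ).inv₀ fun u => (weight_pos ρ u).ne').smul
          (continuous_primitive
            (fun _ _ => (continuous_weight_integrand hρ hA y).intervalIntegrable _ _) 0))
        (1 / 2 * ‖y‖) (norm_integral_weight_le hρ hb y)
      map_add' := fun y z => by
        ext u
        simp only [BoundedContinuousFunction.coe_ofNormedAddCommGroup,
          BoundedContinuousFunction.coe_add, Pi.add_apply, smul_add, map_add]
        rw [integral_add ((continuous_weight_integrand hρ hA y).intervalIntegrable _ _)
          ((continuous_weight_integrand hρ hA z).intervalIntegrable _ _), smul_add]
      map_smul' := fun c y => by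
        ext u
        simp only [BoundedContinuousFunction.coe_ofNormedAddCommGroup,
          BoundedContinuousFunction.coe_smul, RingHom.id_apply]
        rw [smul_comm c, ← intervalIntegral.integral_smul c]
        simp only [smul_comm _ c, map_smul] }
    (1 / 2) fun y => BoundedContinuousFunction.norm_ofNormedAddCommGroup_le _ (by positivity)
      (norm_integral_weight_le hρ hb y)

lemma volterra_apply {ρ : ℝ → ℝ} (hρ : Continuous ρ) {A : ℝ → Y →L[ℂ] Y} (hA : Continuous A)
    (hb : ∀ t, ‖A t‖ ≤ ρ t) (y : ℝ →ᵇ Y) (u : ℝ) :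
    volterra hρ hA hb y u = (weight ρ u)⁻¹ • ∫ t in (0 : ℝ)..u, A t (weight ρ t • y t) := rfl

lemma norm_volterra_le {ρ : ℝ → ℝ} (hρ : Continuous ρ) {A : ℝ → Y →L[ℂ] Y} (hA : Continuous A)
    (hb : ∀ t, ‖A t‖ ≤ ρ t) : ‖volterra hρ hA hb‖ ≤ 1 / 2 :=
  LinearMap.mkContinuous_norm_le _ (by norm_num) fun y =>
    BoundedContinuousFunction.norm_ofNormedAddCommGroup_le _ (by positivity)
      (norm_integral_weight_le hρ hb y)

variable [CompleteSpace Y]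

/-- The linear equation `y' = (A₀ + E A₁) y` with continuous coefficients has global solutions.
After division by a weight they are bounded, and analytic in the parameter `E` as elements of a
Banach space. -/
theorem exists_analytic_family {A₀ A₁ : ℝ → Y →L[ℂ] Y} (h₀ : Continuous A₀) (h₁ : Continuous A₁)
    (R : ℝ) (y₀ : Y) :
    ∃ (w : ℝ → ℝ) (Z : ℂ → (ℝ →ᵇ Y)), Continuous w ∧
      DifferentiableOn ℂ Z (Metric.ball 0 R) ∧
      ∀ E ∈ Metric.ball (0 : ℂ) R, w 0 • Z E 0 = y₀ ∧
        ∀ t, HasDerivAt (fun t => w t • Z E t) ((A₀ t + E • A₁ t) (w t • Z E t)) t := by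
  set ρ : ℝ → ℝ := fun t => ‖A₀ t‖ + (|R| + 1) * ‖A₁ t‖ with hρdef
  have hρ : Continuous ρ := h₀.norm.add (continuous_const.mul h₁.norm)
  have hb₀ : ∀ t, ‖A₀ t‖ ≤ ρ t := fun t => by
    have := norm_nonneg (A₁ t)
    simp only [hρdef]; nlinarith [abs_nonneg R]
  have hb₁ : ∀ t, ‖A₁ t‖ ≤ ρ t := fun t => by
    have := norm_nonneg (A₁ t)
    have := norm_nonneg (A₀ t)
    simp only [hρdef]; nlinarith [abs_nonneg R]
  have hbE : ∀ E ∈ Metric.ball (0 : ℂ) R, ∀ t, ‖A₀ t + E • A₁ t‖ ≤ ρ t := fun E hE t => by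
    refine (norm_add_le _ _).trans ?_
    rw [norm_smul]
    have : ‖E‖ ≤ |R| + 1 := by
      have := mem_ball_zero_iff.1 hE
      linarith [le_abs_self R]
    simp only [hρdef]; gcongr
  have hcE : ∀ E : ℂ, Continuous fun t => A₀ t + E • A₁ t := fun E => h₀.add (h₁.const_smul E)
  set K₀ := volterra hρ h₀ hb₀
  set K₁ := volterra hρ h₁ hb₁
  have hK : ∀ E (hE : E ∈ Metric.ball (0 : ℂ) R),
      K₀ + E • K₁ = volterra hρ (hcE E) (hbE E hE) := fun E hE => by
    ext y u
    simp only [K₀, K₁, _root_.add_apply, _root_.smul_apply,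
      BoundedContinuousFunction.coe_add, BoundedContinuousFunction.coe_smul, Pi.add_apply,
      volterra_apply]
    rw [← smul_comm _ E, ← smul_add, ← intervalIntegral.integral_smul, ← integral_add
      ((continuous_weight_integrand hρ h₀ y).intervalIntegrable _ _)
      (((continuous_weight_integrand hρ h₁ y).fun_const_smul E).intervalIntegrable _ _)]
  have hunit : ∀ E ∈ Metric.ball (0 : ℂ) R, IsUnit (1 - (K₀ + E • K₁)) := fun E hE => by
    apply isUnit_one_sub_of_norm_lt_one
    rw [hK E hE]
    exact (norm_volterra_le _ _ _).trans_lt (by norm_num)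
  let z₀ : ℝ →ᵇ Y := BoundedContinuousFunction.ofNormedAddCommGroup
    (fun u => (weight ρ u)⁻¹ • y₀)
    (((continuous_weight hρ).inv₀ fun u => (weight_pos ρ u).ne').smul continuous_const) ‖y₀‖
    (fun u => by
      rw [norm_smul, norm_inv, Real.norm_of_nonneg (weight_pos ρ u).le]
      exact mul_le_of_le_one_left (norm_nonneg _) (inv_le_one_of_one_le₀ (one_le_weight ρ u)))
  refine ⟨weight ρ, fun E => Ring.inverse (1 - (K₀ + E • K₁)) z₀, continuous_weight hρ, ?_, ?_⟩
  · intro E hE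
    have h1 : DifferentiableAt ℂ (fun E : ℂ => 1 - (K₀ + E • K₁)) E := by fun_prop
    have h2 : DifferentiableAt ℂ Ring.inverse (1 - (K₀ + E • K₁)) :=
      differentiableAt_inverse (hunit E hE)
    exact ((h2.comp E h1).clm_apply (differentiableAt_const z₀)).differentiableWithinAt
  · intro E hE
    set Z := Ring.inverse (1 - (K₀ + E • K₁)) z₀
    have hZ : Z - (K₀ + E • K₁) Z = z₀ := by
      have := congrArg (fun T : (ℝ →ᵇ Y) →L[ℂ] (ℝ →ᵇ Y) => T z₀)
        (Ring.mul_inverse_cancel _ (hunit E hE))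
      simpa using this
    have hint : ∀ u, weight ρ u • Z u =
        y₀ + ∫ t in (0 : ℝ)..u, (A₀ t + E • A₁ t) (weight ρ t • Z t) := fun u => by
      have := congrArg (fun y : ℝ →ᵇ Y => weight ρ u • y u) hZ
      simp only [hK E hE, BoundedContinuousFunction.coe_sub, Pi.sub_apply, volterra_apply, smul_sub,
        smul_inv_smul₀ (weight_pos ρ u).ne', z₀,
        BoundedContinuousFunction.coe_ofNormedAddCommGroup] at this
      rw [← this]; abel
    refine ⟨by rw [hint]; simp, fun t => ?_⟩
    exact (((continuous_weight_integrand hρ (hcE E) Z).integral_hasStrictDerivAt 0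
      t).hasDerivAt.const_add y₀).congr_of_eventuallyEq (Eventually.of_forall hint)

end LinearODE

/-- The space of continuous functions on the period cell, a commutative Banach algebra. -/
abbrev Cell := C(Icc (0 : ℝ) 1, ℂ)

/-- On a disc of energies there is a family of solutions with prescribed initial data that is
analytic in the energy, both pointwise and uniformly on the period cell. -/
theorem exists_analytic_solution {V : ℝ → ℝ} (hV : ∀ x y, IntervalIntegrable V volume x y)
    (R : ℝ) (a b : ℂ) :
    ∃ (f f' : ℂ → ℝ → ℂ) (F F' : ℂ → Cell),
      (∀ E ∈ Metric.ball (0 : ℂ) R, IsSolution V E (f E) ∧ deriv (f E) = f' E ∧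
        f E 0 = a ∧ f' E 0 = b ∧ (∀ x, F E x = f E x) ∧ ∀ x, F' E x = f' E x) ∧
      DifferentiableOn ℂ F (Metric.ball 0 R) ∧ DifferentiableOn ℂ F' (Metric.ball 0 R) ∧
      ∀ u, DifferentiableOn ℂ (fun E => f E u) (Metric.ball 0 R) := by
  -- With `S' = V`, the pair `(f, f' - S f)` solves a system with continuous coefficients.
  set S : ℝ → ℂ := fun x => ∫ t in (0 : ℝ)..x, (V t : ℂ)
  have hS : IsPrimitive S (fun t => (V t : ℂ)) :=
    ⟨fun x y => ⟨(hV x y).1.ofReal, (hV x y).2.ofReal⟩, fun x => by simp [S]⟩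
  let π₁ := ContinuousLinearMap.fst ℂ ℂ ℂ
  let π₂ := ContinuousLinearMap.snd ℂ ℂ ℂ
  let ι₁ := ContinuousLinearMap.inl ℂ ℂ ℂ
  let ι₂ := ContinuousLinearMap.inr ℂ ℂ ℂ
  let A₀ : ℝ → (ℂ × ℂ) →L[ℂ] (ℂ × ℂ) := fun t =>
    ι₁ ∘L π₂ + S t • (ι₁ ∘L π₁ - ι₂ ∘L π₂) - (S t * S t) • (ι₂ ∘L π₁)
  let A₁ : ℝ → (ℂ × ℂ) →L[ℂ] (ℂ × ℂ) := fun _ => -(ι₂ ∘L π₁)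
  have hSc := hS.continuous
  have hA₀ : Continuous A₀ :=
    (continuous_const.add (hSc.smul continuous_const)).sub ((hSc.mul hSc).smul continuous_const)
  obtain ⟨w, Z, hw, hZ, hsol⟩ := exists_analytic_family hA₀
    (continuous_const : Continuous A₁) R (a, b)
  have hev : Continuous fun p : (ℝ →ᵇ ℂ × ℂ) × Icc (0 : ℝ) 1 => p.1 (p.2 : ℝ) :=
    ContinuousEval.continuous_eval.comp
      (continuous_fst.prodMk (continuous_subtype_val.comp continuous_snd))
  let T₁ : (ℝ →ᵇ ℂ × ℂ) →L[ℂ] Cell :=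
    { toFun := fun y => ⟨fun x => w x • (y x).1, by fun_prop⟩
      map_add' := fun y z => by ext x; simp
      map_smul' := fun c y => by ext x; simp; ring
      cont := ContinuousMap.continuous_of_continuous_uncurry _ (by
        exact (hw.comp (continuous_subtype_val.comp continuous_snd)).smul hev.fst) }
  let T₂ : (ℝ →ᵇ ℂ × ℂ) →L[ℂ] Cell :=
    { toFun := fun y => ⟨fun x => w x • ((y x).2 + S x * (y x).1), by fun_prop⟩
      map_add' := fun y z => by ext x; simp; ring
      map_smul' := fun c y => by ext x; simp; ring
      cont := ContinuousMap.continuous_of_continuous_uncurry _ (by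
        exact (hw.comp (continuous_subtype_val.comp continuous_snd)).smul
          (hev.snd.add ((hSc.comp (continuous_subtype_val.comp continuous_snd)).mul hev.fst))) }
  refine ⟨fun E u => (w u • Z E u).1, fun E u => (w u • Z E u).2 + S u * (w u • Z E u).1,
    fun E => T₁ (Z E), fun E => T₂ (Z E), ?_, ?_, ?_, ?_⟩
  · intro E hE
    obtain ⟨h0, hd⟩ := hsol E hE
    set y : ℝ → ℂ × ℂ := fun t => w t • Z E t
    have hd1 : ∀ t, HasDerivAt (fun t => (y t).1) ((y t).2 + S t * (y t).1) t := fun t =>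
      ((π₁.restrictScalars ℝ).hasFDerivAt.comp_hasDerivAt t (hd t)).congr_deriv (by
        simp [π₁, A₀, ι₁, ι₂, π₂, y])
    have hd2 : ∀ t, HasDerivAt (fun t => (y t).2)
        (-(S t * ((y t).2 + S t * (y t).1)) - E * (y t).1) t := fun t =>
      ((π₂.restrictScalars ℝ).hasFDerivAt.comp_hasDerivAt t (hd t)).congr_deriv (by
        simp [π₁, A₀, ι₁, ι₂, π₂, y]; ring)
    have hy : Continuous y := continuous_iff_continuousAt.2 fun t => (hd t).continuousAt
    have hy1 : Continuous fun t => (y t).1 := hy.fst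
    have hy2 : Continuous fun t => (y t).2 := hy.snd
    have hp1 := IsPrimitive.of_hasDerivAt hd1 (by fun_prop)
    have hp2 := IsPrimitive.of_hasDerivAt hd2 (by fun_prop)
    have hS0 : S 0 = 0 := by simp [S]
    have hy0 : y 0 = (a, b) := h0
    refine ⟨isSolution_of_isPrimitive (f' := fun u => (y u).2 + S u * (y u).1) hd1
      ((hp2.add (hS.mul hp1)).congr_right fun x => by ring), funext fun t => (hd1 t).deriv, ?_, ?_,
      fun x => ?_, fun x => ?_⟩
    · exact congrArg Prod.fst hy0
    · change (y 0).2 + S 0 * (y 0).1 = b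
      rw [hS0, hy0]; simp
    · simp [T₁]
    · simp [T₂]; ring
  · exact T₁.differentiable.comp_differentiableOn hZ
  · exact T₂.differentiable.comp_differentiableOn hZ
  · intro u E hE
    have h1 := (BoundedContinuousFunction.evalCLM ℂ u :
      (ℝ →ᵇ ℂ × ℂ) →L[ℂ] ℂ × ℂ).differentiable.comp_differentiableOn hZ
    have h2 := (π₁.differentiable.comp_differentiableOn h1).const_smul (w u)
    exact h2 E hE

end

/-! ### The fundamental system and the discriminant -/

section

open MeasureTheory intervalIntegral Set BoundedContinuousFunction

section Basic

variable {V : ℝ → ℝ} {E : ℂ} {f g : ℝ → ℂ}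

lemma cauchySol_spec (hV : ∀ x y, IntervalIntegrable V volume x y) (E a b : ℂ) :
    IsSolution V E (cauchySol V E a b) ∧ cauchySol V E a b 0 = a ∧
      deriv (cauchySol V E a b) 0 = b := by
  obtain ⟨f, f', F, F', h, -⟩ := exists_analytic_solution hV (‖E‖ + 1) a b
  obtain ⟨h1, h2, h3, h4, -⟩ := h E (by simp)
  exact Classical.epsilon_spec (p := fun ψ : ℝ → ℂ => IsSolution V E ψ ∧ ψ 0 = a ∧ deriv ψ 0 = b)
    ⟨f E, h1, h3, by rw [h2, h4]⟩

lemma cosSol_isSolution (hV : ∀ x y, IntervalIntegrable V volume x y) (E : ℂ) :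
    IsSolution V E (cosSol V E) := (cauchySol_spec hV E 1 0).1

lemma cosSol_zero (hV : ∀ x y, IntervalIntegrable V volume x y) (E : ℂ) : cosSol V E 0 = 1 :=
  (cauchySol_spec hV E 1 0).2.1

lemma deriv_cosSol_zero (hV : ∀ x y, IntervalIntegrable V volume x y) (E : ℂ) :
    deriv (cosSol V E) 0 = 0 := (cauchySol_spec hV E 1 0).2.2

lemma sinSol_isSolution (hV : ∀ x y, IntervalIntegrable V volume x y) (E : ℂ) :
    IsSolution V E (sinSol V E) := (cauchySol_spec hV E 0 1).1

lemma sinSol_zero (hV : ∀ x y, IntervalIntegrable V volume x y) (E : ℂ) : sinSol V E 0 = 0 :=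
  (cauchySol_spec hV E 0 1).2.1

lemma deriv_sinSol_zero (hV : ∀ x y, IntervalIntegrable V volume x y) (E : ℂ) :
    deriv (sinSol V E) 0 = 1 := (cauchySol_spec hV E 0 1).2.2

/-- The Wronskian of two solutions with the same energy is constant. -/
lemma IsSolution.wronskian_eq (hV : ∀ x y, IntervalIntegrable V volume x y)
    (hf : IsSolution V E f) (hg : IsSolution V E g) (x : ℝ) :
    g x * deriv f x - deriv g x * f x = g 0 * deriv f 0 - deriv g 0 * f 0 := by
  simpa using (hf.wronskian hV hg).2 x

lemma wronskian_cosSol_sinSol (hV : ∀ x y, IntervalIntegrable V volume x y) (E : ℂ) (x : ℝ) :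
    cosSol V E x * deriv (sinSol V E) x - deriv (cosSol V E) x * sinSol V E x = 1 := by
  rw [(sinSol_isSolution hV E).wronskian_eq hV (cosSol_isSolution hV E)]
  simp [cosSol_zero hV, deriv_cosSol_zero hV, sinSol_zero hV, deriv_sinSol_zero hV]

/-- Uniqueness for the Cauchy problem: constancy of the Wronskians with `cosSol` and `sinSol`
determines a solution from its initial data. -/
lemma IsSolution.eq_comb (hV : ∀ x y, IntervalIntegrable V volume x y)
    (hf : IsSolution V E f) :
    f = fun x => f 0 * cosSol V E x + deriv f 0 * sinSol V E x := by
  funext x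
  have h1 := hf.wronskian_eq hV (cosSol_isSolution hV E) x
  have h2 := hf.wronskian_eq hV (sinSol_isSolution hV E) x
  have h3 := wronskian_cosSol_sinSol hV E x
  simp only [cosSol_zero hV, deriv_cosSol_zero hV, sinSol_zero hV, deriv_sinSol_zero hV] at h1 h2
  linear_combination (-f x) * h3 + sinSol V E x * h1 - cosSol V E x * h2

lemma IsSolution.ext (hV : ∀ x y, IntervalIntegrable V volume x y)
    (hf : IsSolution V E f) (hg : IsSolution V E g) (h0 : f 0 = g 0)
    (h1 : deriv f 0 = deriv g 0) : f = g := by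
  rw [hf.eq_comb hV, hg.eq_comb hV, h0, h1]

lemma deriv_comb (hV : ∀ x y, IntervalIntegrable V volume x y) (E p q : ℂ) (x : ℝ) :
    deriv (fun x => p * cosSol V E x + q * sinSol V E x) x =
      p * deriv (cosSol V E) x + q * deriv (sinSol V E) x :=
  ((((cosSol_isSolution hV E).hasDerivAt x).const_mul p).add
    (((sinSol_isSolution hV E).hasDerivAt x).const_mul q)).deriv

lemma comb_isSolution (hV : ∀ x y, IntervalIntegrable V volume x y) (E p q : ℂ) :
    IsSolution V E (fun x => p * cosSol V E x + q * sinSol V E x) :=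
  (cosSol_isSolution hV E).linear_comb hV (sinSol_isSolution hV E) p q

lemma deriv_shift (f : ℝ → ℂ) : deriv (fun x => f (x + 1)) = fun x => deriv f (x + 1) :=
  funext fun x => deriv_comp_add_const f 1 x

lemma IsSolution.shift (hV : ∀ x y, IntervalIntegrable V volume x y)
    (hper : Function.Periodic V 1) (hf : IsSolution V E f) :
    IsSolution V E (fun x => f (x + 1)) := by
  refine ⟨hf.1.comp (differentiable_id.add_const 1), fun x => ?_⟩
  have hi := (hf.isPrimitive_deriv hV).1
  have h1 := integral_comp_add_right (a := 0) (b := x) (fun t => ((V t : ℂ) - E) * f t) 1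
  simp only [hper _] at h1
  simp only [deriv_shift]
  rw [h1, hf.2 (x + 1), hf.2 (0 + 1), add_assoc, integral_add_adjacent_intervals
    (hi _ _) (hi _ _)]

/-- A solution whose Cauchy data at `1` are `lam` times those at `0` is multiplied by `lam` over
every period. -/
lemma IsSolution.floquet (hV : ∀ x y, IntervalIntegrable V volume x y)
    (hper : Function.Periodic V 1) (hf : IsSolution V E f) {lam : ℂ} (h0 : f 1 = lam * f 0)
    (h1 : deriv f 1 = lam * deriv f 0) (x : ℝ) : f (x + 1) = lam * f x := by
  have h2 : IsSolution V E (fun x => lam * f x) := by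
    simpa using hf.linear_comb hV hf lam 0
  refine congrFun ((hf.shift hV hper).ext hV h2 (by simpa using h0) ?_) x
  simp only [deriv_shift]
  rw [((hf.hasDerivAt 0).const_mul lam).deriv, zero_add, h1]

lemma IsBlochSolution.data {lam : ℂ} (hf : IsBlochSolution V E lam f) :
    f 1 = lam * f 0 ∧ deriv f 1 = lam * deriv f 0 := by
  obtain ⟨hs, -, h⟩ := hf
  refine ⟨by simpa using h 0, ?_⟩
  have := congrFun (deriv_shift f) 0
  rw [show (fun x => f (x + 1)) = fun x => lam * f x from funext h,
    ((hs.hasDerivAt 0).const_mul lam).deriv] at this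
  simpa using this.symm

/-- The discriminant, the trace of the monodromy matrix
`(c(1) s(1); c'(1) s'(1))`. -/
def discr (V : ℝ → ℝ) (E : ℂ) : ℂ := cosSol V E 1 + deriv (sinSol V E) 1

lemma IsFloquetMultiplier.sq_add_one (hV : ∀ x y, IntervalIntegrable V volume x y) {lam : ℂ}
    (h : IsFloquetMultiplier V E lam) : lam ^ 2 + 1 = discr V E * lam := by
  obtain ⟨f, hf⟩ := h
  obtain ⟨h0, h1⟩ := hf.data
  have hc := hf.1.eq_comb hV
  set p := f 0
  set q := deriv f 0
  rw [hc, deriv_comb hV] at h1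
  rw [hc] at h0
  have hw := wronskian_cosSol_sinSol hV E 1
  have hpq : p ≠ 0 ∨ q ≠ 0 := by
    by_contra! hpq
    refine hf.2.1 ?_
    rw [hc, hpq.1, hpq.2]
    funext x
    simp
  rw [discr]
  set a := cosSol V E 1
  set b := sinSol V E 1
  set c := deriv (cosSol V E) 1
  set d := deriv (sinSol V E) 1
  have hp : p * (lam ^ 2 + 1 - (a + d) * lam) = 0 := by
    linear_combination (-p) * hw + (d - lam) * h0 - b * h1
  have hq : q * (lam ^ 2 + 1 - (a + d) * lam) = 0 := by
    linear_combination (-q) * hw + (a - lam) * h1 - c * h0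
  rcases hpq with h | h
  · linear_combination (mul_eq_zero.1 hp).resolve_left h
  · linear_combination (mul_eq_zero.1 hq).resolve_left h

end Basic

section Analytic

variable {V : ℝ → ℝ}

/-- The restriction of a function to the period cell (zero if the function is not continuous). -/
def cell (f : ℝ → ℂ) : Cell :=
  open Classical in if h : Continuous f then ⟨fun x => f x, h.comp continuous_subtype_val⟩ else 0

lemma cell_apply {f : ℝ → ℂ} (h : Continuous f) (x : Icc (0 : ℝ) 1) : cell f x = f x := by
  simp [cell, h]

lemma differentiable_cauchySol (hV : ∀ x y, IntervalIntegrable V volume x y) (a b : ℂ) :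
    Differentiable ℂ (fun E => cell (cauchySol V E a b)) ∧
    Differentiable ℂ (fun E => cell (deriv (cauchySol V E a b))) ∧
    ∀ u, Differentiable ℂ (fun E => cauchySol V E a b u) := by
  have key : ∀ E₀ : ℂ, DifferentiableAt ℂ (fun E => cell (cauchySol V E a b)) E₀ ∧
    DifferentiableAt ℂ (fun E => cell (deriv (cauchySol V E a b))) E₀ ∧
    ∀ u, DifferentiableAt ℂ (fun E => cauchySol V E a b u) E₀ := fun E₀ => by
    obtain ⟨f, f', F, F', h, hF, hF', hf⟩ := exists_analytic_solution hV (‖E₀‖ + 1) a b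
    have hm : Metric.ball (0 : ℂ) (‖E₀‖ + 1) ∈ 𝓝 E₀ := Metric.isOpen_ball.mem_nhds (by simp)
    have heq : ∀ E ∈ Metric.ball (0 : ℂ) (‖E₀‖ + 1), cauchySol V E a b = f E := fun E hE => by
      obtain ⟨h1, h2, h3, h4, -⟩ := h E hE
      obtain ⟨g1, g2, g3⟩ := cauchySol_spec hV E a b
      exact g1.ext hV h1 (g2.trans h3.symm) (by rw [g3, h2, h4])
    refine ⟨(hF.differentiableAt hm).congr_of_eventuallyEq ?_,
      (hF'.differentiableAt hm).congr_of_eventuallyEq ?_,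
      fun u => ((hf u).differentiableAt hm).congr_of_eventuallyEq ?_⟩
    · filter_upwards [hm] with E hE
      obtain ⟨h1, h2, h3, h4, h5, h6⟩ := h E hE
      ext x
      rw [heq E hE, h5, cell_apply h1.1.continuous]
    · filter_upwards [hm] with E hE
      obtain ⟨h1, h2, h3, h4, h5, h6⟩ := h E hE
      ext x
      rw [heq E hE, h6, cell_apply (h1.continuous_deriv hV), h2]
    · filter_upwards [hm] with E hE
      rw [heq E hE]
  exact ⟨fun E => (key E).1, fun E => (key E).2.1, fun u E => (key E).2.2 u⟩

/-- Evaluation at a point of the period cell. -/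
def cellEval (x : Icc (0 : ℝ) 1) : Cell →L[ℂ] ℂ := ContinuousMap.evalCLM ℂ x

lemma cellEval_apply (x : Icc (0 : ℝ) 1) (f : Cell) : cellEval x f = f x := rfl

lemma differentiable_deriv_cauchySol_one (hV : ∀ x y, IntervalIntegrable V volume x y) (a b : ℂ) :
    Differentiable ℂ (fun E => deriv (cauchySol V E a b) 1) := by
  have := (cellEval ⟨1, by simp⟩).differentiable.comp (differentiable_cauchySol hV a b).2.1
  refine Eq.mp (congrArg (Differentiable ℂ) (funext fun E => ?_)) this
  rw [Function.comp_apply, cellEval_apply,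
    cell_apply ((cauchySol_spec hV E a b).1.continuous_deriv hV)]

lemma differentiable_cosSol (hV : ∀ x y, IntervalIntegrable V volume x y) (u : ℝ) :
    Differentiable ℂ (fun E => cosSol V E u) := (differentiable_cauchySol hV 1 0).2.2 u

lemma differentiable_sinSol (hV : ∀ x y, IntervalIntegrable V volume x y) (u : ℝ) :
    Differentiable ℂ (fun E => sinSol V E u) := (differentiable_cauchySol hV 0 1).2.2 u

lemma differentiable_deriv_cosSol_one (hV : ∀ x y, IntervalIntegrable V volume x y) :
    Differentiable ℂ (fun E => deriv (cosSol V E) 1) := differentiable_deriv_cauchySol_one hV 1 0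

lemma differentiable_deriv_sinSol_one (hV : ∀ x y, IntervalIntegrable V volume x y) :
    Differentiable ℂ (fun E => deriv (sinSol V E) 1) := differentiable_deriv_cauchySol_one hV 0 1

lemma differentiable_discr (hV : ∀ x y, IntervalIntegrable V volume x y) :
    Differentiable ℂ (discr V) :=
  (differentiable_cosSol hV 1).add (differentiable_deriv_sinSol_one hV)

end Analytic

end

/-! ### Real energies: self-adjointness and growth -/

section

open MeasureTheory intervalIntegral Set BoundedContinuousFunction

section SelfAdjoint

open ComplexConjugate

variable {V : ℝ → ℝ} {E : ℂ} {f g : ℝ → ℂ}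

lemma IsSolution.conj (hf : IsSolution V E f) :
    IsSolution V (conj E) (fun x => conj (f x)) ∧
      deriv (fun x => conj (f x)) = fun x => conj (deriv f x) := by
  have hd : ∀ x, HasDerivAt (fun x => conj (f x)) (conj (deriv f x)) x := fun x =>
    (Complex.conjCLE.toContinuousLinearMap.hasFDerivAt.comp_hasDerivAt x (hf.hasDerivAt x))
  have hde : deriv (fun x => conj (f x)) = fun x => conj (deriv f x) :=
    funext fun x => (hd x).deriv
  refine ⟨⟨fun x => (hd x).differentiableAt, fun x => ?_⟩, hde⟩
  rw [hde]
  simp only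
  rw [hf.2 x, map_add, ← intervalIntegral_conj]
  simp

lemma IsSolution.eq_zero (hV : ∀ x y, IntervalIntegrable V volume x y) (hf : IsSolution V E f)
    {x : ℝ} (h0 : f x = 0) (h1 : deriv f x = 0) : f = 0 := by
  have e1 := hf.wronskian_eq hV (cosSol_isSolution hV E) x
  have e2 := hf.wronskian_eq hV (sinSol_isSolution hV E) x
  simp only [h0, h1, cosSol_zero hV, deriv_cosSol_zero hV, sinSol_zero hV, deriv_sinSol_zero hV,
    mul_zero, zero_mul, one_mul, sub_zero, zero_sub] at e1 e2
  rw [hf.eq_comb hV]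
  funext y
  rw [← e1, show f 0 = 0 by linear_combination e2]
  simp

lemma IsSolution.exists_ne_zero (hV : ∀ x y, IntervalIntegrable V volume x y)
    (hf : IsSolution V E f) (hne : f ≠ 0) : ∃ x ∈ Icc (0 : ℝ) 1, f x ≠ 0 := by
  by_contra! h
  refine hne (hf.eq_zero hV (x := 1 / 2) (h _ (by norm_num)) ?_)
  have : f =ᶠ[𝓝 (1 / 2)] fun _ => 0 := by
    filter_upwards [Ioo_mem_nhds (show (0 : ℝ) < 1 / 2 by norm_num)
      (show (1 / 2 : ℝ) < 1 by norm_num)] with x hx using h x ⟨hx.1.le, hx.2.le⟩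
  rw [this.deriv_eq, deriv_const]

lemma IsSolution.integral_normSq_pos (hV : ∀ x y, IntervalIntegrable V volume x y)
    (hf : IsSolution V E f) (hne : f ≠ 0) : 0 < ∫ x in (0 : ℝ)..1, Complex.normSq (f x) := by
  obtain ⟨x, hx, hfx⟩ := hf.exists_ne_zero hV hne
  exact integral_pos one_pos (Complex.continuous_normSq.comp hf.1.continuous).continuousOn
    (fun _ _ => Complex.normSq_nonneg _) ⟨x, hx, Complex.normSq_pos.2 hfx⟩

/-- A nontrivial solution satisfying self-adjoint boundary conditions has real energy. -/
lemma IsSolution.im_eq_zero (hV : ∀ x y, IntervalIntegrable V volume x y)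
    (hf : IsSolution V E f) (hne : f ≠ 0)
    (hbc : conj (f 1) * deriv f 1 - conj (deriv f 1) * f 1 =
      conj (f 0) * deriv f 0 - conj (deriv f 0) * f 0) : E.im = 0 := by
  obtain ⟨h1, h2⟩ := hf.conj
  have h3 := (hf.wronskian hV h1).2 1
  simp only [h2] at h3
  rw [hbc, intervalIntegral.integral_const_mul] at h3
  simp only [Complex.mul_conj] at h3
  rw [intervalIntegral.integral_ofReal] at h3
  have h4 := (hf.integral_normSq_pos hV hne).ne'
  have h5 : conj E - E = 0 := by
    have : (conj E - E) * ((∫ x in (0 : ℝ)..1, Complex.normSq (f x) : ℝ) : ℂ) = 0 := by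
      linear_combination -h3
    exact (mul_eq_zero.1 this).resolve_right (by exact_mod_cast h4)
  exact Complex.conj_eq_iff_im.1 (sub_eq_zero.1 h5)

lemma sinSol_ne_zero (hV : ∀ x y, IntervalIntegrable V volume x y) (E : ℂ) : sinSol V E ≠ 0 :=
  fun h => by simpa [h] using deriv_sinSol_zero hV E

/-- The Dirichlet eigenvalues are real. -/
lemma sinSol_one_ne_zero (hV : ∀ x y, IntervalIntegrable V volume x y) (hE : E.im ≠ 0) :
    sinSol V E 1 ≠ 0 := fun h =>
  hE ((sinSol_isSolution hV E).im_eq_zero hV (sinSol_ne_zero hV E) (by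
    simp [h, sinSol_zero hV]))

/-- The energies with a Floquet multiplier `±1` are real. -/
lemma IsFloquetMultiplier.im_eq_zero (hV : ∀ x y, IntervalIntegrable V volume x y) {lam : ℂ}
    (h : IsFloquetMultiplier V E lam) (hlam : lam ^ 2 = 1) : E.im = 0 := by
  obtain ⟨f, hf⟩ := h
  obtain ⟨h0, h1⟩ := hf.data
  refine hf.1.im_eq_zero hV hf.2.1 ?_
  rcases sq_eq_one_iff.1 hlam with rfl | rfl <;> simp [h0, h1]

lemma cauchySol_conj (hV : ∀ x y, IntervalIntegrable V volume x y) (hE : E.im = 0) (a b : ℝ) :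
    (∀ x, conj (cauchySol V E a b x) = cauchySol V E a b x) ∧
      ∀ x, conj (deriv (cauchySol V E a b) x) = deriv (cauchySol V E a b) x := by
  obtain ⟨h1, h2, h3⟩ := cauchySol_spec hV E a b
  obtain ⟨h4, h5⟩ := h1.conj
  rw [Complex.conj_eq_iff_im.2 hE] at h4
  have h6 := h4.ext hV h1 (by rw [h2, Complex.conj_ofReal]) (by
    rw [h5]; simp only; rw [h3, Complex.conj_ofReal])
  refine ⟨fun x => congrFun h6 x, fun x => ?_⟩
  have := congrFun h5 x
  rw [h6] at this
  exact this.symm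

end SelfAdjoint

section Unbounded

variable {V : ℝ → ℝ}

lemma norm_integral_le_of_bound (hV : ∀ x y, IntervalIntegrable V volume x y) {F : ℝ → ℂ} {C : ℝ}
    (hC : 0 ≤ C) {x : ℝ} (hx : x ∈ Icc (0 : ℝ) 1) (hF : ∀ t ∈ Icc (0 : ℝ) x, ‖F t‖ ≤ C) :
    ‖∫ t in (0 : ℝ)..x, F t * V t‖ ≤ C * ∫ t in (0 : ℝ)..1, |V t| := by
  have hi : ∀ x y, IntervalIntegrable (fun t => C * |V t|) volume x y := fun x y =>
    ((hV x y).abs).const_mul C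
  calc ‖∫ t in (0 : ℝ)..x, F t * V t‖ ≤ ∫ t in (0 : ℝ)..x, C * |V t| := by
        refine norm_integral_le_of_norm_le hx.1 (Eventually.of_forall fun t ht => ?_) (hi _ _)
        rw [norm_mul, Complex.norm_real, Real.norm_eq_abs]
        exact mul_le_mul_of_nonneg_right (hF t ⟨ht.1.le, ht.2⟩) (abs_nonneg _)
    _ ≤ ∫ t in (0 : ℝ)..1, C * |V t| :=
        integral_mono_interval le_rfl hx.1 hx.2
          (Eventually.of_forall fun t => by positivity) (hi _ _)
    _ = _ := by rw [intervalIntegral.integral_const_mul]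

/-- For `E = -κ²` with large `κ`, solutions are close to those of the free equation. The two
combinations `f' ± κ f` solve first order equations, and the perturbation terms are estimated by
the maximum of `e^{-κ x} |f x|` over the period cell, which they in turn control. -/
lemma IsSolution.large_kappa (hV : ∀ x y, IntervalIntegrable V volume x y) {κ : ℝ} (hκ : 0 < κ)
    (hκV : 2 * ∫ t in (0 : ℝ)..1, |V t| ≤ κ) {f : ℝ → ℂ} (hf : IsSolution V (-(κ : ℂ) ^ 2) f) :
    ‖(deriv f 1 + κ * f 1) * Complex.exp (-κ) - (deriv f 0 + κ * f 0)‖ ≤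
        (‖deriv f 0 + κ * f 0‖ + ‖deriv f 0 - κ * f 0‖) / κ * ∫ t in (0 : ℝ)..1, |V t| ∧
    ‖(deriv f 1 - κ * f 1) * Complex.exp (-κ)‖ ≤ ‖deriv f 0 - κ * f 0‖ * Real.exp (-(2 * κ)) +
        (‖deriv f 0 + κ * f 0‖ + ‖deriv f 0 - κ * f 0‖) / κ * ∫ t in (0 : ℝ)..1, |V t| := by
  set v := ∫ t in (0 : ℝ)..1, |V t|
  have hv : 0 ≤ v := integral_nonneg zero_le_one fun _ _ => abs_nonneg _
  set p₀ := deriv f 0 + κ * f 0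
  set m₀ := deriv f 0 - κ * f 0
  have hexp : ∀ s : ℝ, IsPrimitive (fun x : ℝ => Complex.exp (s * x))
      (fun x => s * Complex.exp (s * x)) := fun s =>
    .of_hasDerivAt (fun x => by
      have := (((hasDerivAt_id (x : ℂ)).const_mul (s : ℂ)).cexp).comp_ofReal
      simpa [mul_comm] using this) (by fun_prop)
  have hP := (hexp (-κ)).mul ((hf.isPrimitive_deriv hV).add ((hf.isPrimitive hV).const_mul κ))
  have hM := (hexp κ).mul ((hf.isPrimitive_deriv hV).sub ((hf.isPrimitive hV).const_mul κ))
  have hp : ∀ x : ℝ, Complex.exp (-κ * x) * (deriv f x + κ * f x) =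
      p₀ + ∫ t in (0 : ℝ)..x, (Complex.exp (-κ * t) * f t) * V t := fun x => by
    have := hP.2 x
    simp only [Complex.ofReal_neg, Complex.ofReal_zero, mul_zero, Complex.exp_zero, one_mul] at this
    rw [this]
    congr 1
    exact integral_congr fun t _ => by ring
  have hm : ∀ x : ℝ, Complex.exp (κ * x) * (deriv f x - κ * f x) =
      m₀ + ∫ t in (0 : ℝ)..x, (Complex.exp (κ * t) * f t) * V t := fun x => by
    have := hM.2 x
    simp only [Complex.ofReal_zero, mul_zero, Complex.exp_zero, one_mul] at this
    rw [this]
    congr 1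
    exact integral_congr fun t _ => by ring
  have hfc := hf.1.continuous
  obtain ⟨x₀, hx₀, hmax⟩ := isCompact_Icc.exists_isMaxOn (nonempty_Icc.2 (zero_le_one (α := ℝ)))
    (f := fun x : ℝ => Real.exp (-κ * x) * ‖f x‖) (by fun_prop)
  set S := Real.exp (-κ * x₀) * ‖f x₀‖
  have hS0 : 0 ≤ S := by positivity
  have hS : ∀ t ∈ Icc (0 : ℝ) 1, Real.exp (-κ * t) * ‖f t‖ ≤ S := fun t ht => hmax ht
  have hne : ∀ s x : ℝ, ‖Complex.exp (s * x)‖ = Real.exp (s * x) := fun s x => by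
    rw [← Complex.ofReal_mul, Complex.norm_exp_ofReal]
  have hpb : ∀ x ∈ Icc (0 : ℝ) 1,
      ‖∫ t in (0 : ℝ)..x, (Complex.exp (-κ * t) * f t) * V t‖ ≤ S * v := fun x hx =>
    norm_integral_le_of_bound hV hS0 hx fun t ht => by
      rw [norm_mul, ← Complex.ofReal_neg, hne]
      exact hS t ⟨ht.1, ht.2.trans hx.2⟩
  have hmb : ∀ x ∈ Icc (0 : ℝ) 1,
      ‖∫ t in (0 : ℝ)..x, (Complex.exp (κ * t) * f t) * V t‖ ≤ Real.exp (2 * κ * x) * S * v :=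
    fun x hx => norm_integral_le_of_bound hV (by positivity) hx fun t ht => by
      rw [norm_mul, hne]
      calc Real.exp (κ * t) * ‖f t‖ = Real.exp (2 * κ * t) * (Real.exp (-κ * t) * ‖f t‖) := by
            rw [← mul_assoc, ← Real.exp_add]; ring_nf
        _ ≤ Real.exp (2 * κ * x) * S := by
            gcongr
            · exact ht.2
            · exact hS t ⟨ht.1, ht.2.trans hx.2⟩
  have hm' : ∀ x ∈ Icc (0 : ℝ) 1, ‖Complex.exp (-κ * x) * (deriv f x - κ * f x)‖ ≤
      ‖m₀‖ * Real.exp (-(2 * κ * x)) + S * v := fun x hx => by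
    have e : Complex.exp (-κ * x) * (deriv f x - κ * f x) =
        Complex.exp ((-(2 * κ) : ℝ) * x) *
          (m₀ + ∫ t in (0 : ℝ)..x, (Complex.exp (κ * t) * f t) * V t) := by
      rw [← hm, ← mul_assoc, ← Complex.exp_add]
      congr 2
      push_cast; ring
    rw [e, norm_mul, hne]
    calc Real.exp (-(2 * κ) * x) * ‖m₀ + ∫ t in (0 : ℝ)..x, (Complex.exp (κ * t) * f t) * V t‖
        ≤ Real.exp (-(2 * κ) * x) * (‖m₀‖ + Real.exp (2 * κ * x) * S * v) := by
          gcongr; exact (norm_add_le _ _).trans (by gcongr; exact hmb x hx)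
      _ = ‖m₀‖ * Real.exp (-(2 * κ * x)) +
          (Real.exp (-(2 * κ) * x) * Real.exp (2 * κ * x)) * S * v := by ring_nf
      _ = _ := by rw [← Real.exp_add]; simp
  have hSb : S ≤ (‖p₀‖ + ‖m₀‖) / κ := by
    have h1 : 2 * κ * S ≤ ‖p₀‖ + ‖m₀‖ + 2 * S * v := by
      have e : (2 * κ : ℂ) * (Complex.exp (-κ * x₀) * f x₀) =
          Complex.exp (-κ * x₀) * (deriv f x₀ + κ * f x₀) -
            Complex.exp (-κ * x₀) * (deriv f x₀ - κ * f x₀) := by ring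
      have e2 : 2 * κ * S = ‖(2 * κ : ℂ) * (Complex.exp (-κ * x₀) * f x₀)‖ := by
        rw [norm_mul, norm_mul, norm_mul, ← Complex.ofReal_neg, hne, Complex.norm_real,
          Complex.norm_two, Real.norm_of_nonneg hκ.le]
      rw [e2, e]
      refine (norm_sub_le _ _).trans ?_
      have h2 := hm' x₀ hx₀
      have h3 : ‖Complex.exp (-κ * x₀) * (deriv f x₀ + κ * f x₀)‖ ≤ ‖p₀‖ + S * v := by
        rw [hp]; exact (norm_add_le _ _).trans (by gcongr; exact hpb x₀ hx₀)
      have h4 : ‖m₀‖ * Real.exp (-(2 * κ * x₀)) ≤ ‖m₀‖ :=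
        mul_le_of_le_one_right (norm_nonneg _) (Real.exp_le_one_iff.2 (by
          have := hx₀.1; have := mul_nonneg hκ.le this; linarith))
      linarith
    rw [le_div_iff₀ hκ]
    nlinarith [mul_le_mul_of_nonneg_left hκV hS0]
  have h1 : (1 : ℝ) ∈ Icc (0 : ℝ) 1 := by simp
  constructor
  · have := hp 1
    simp only [Complex.ofReal_one, mul_one] at this
    rw [mul_comm, this, add_sub_cancel_left]
    exact (hpb 1 h1).trans (by gcongr)
  · have := hm' 1 h1
    simp only [Complex.ofReal_one, mul_one] at this
    rw [mul_comm]
    exact this.trans (by gcongr)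

/-- The discriminant is not constant: it grows like `e^κ` at the energy `-κ²`. -/
theorem discr_not_const (hV : ∀ x y, IntervalIntegrable V volume x y) (C : ℂ) :
    ¬ ∀ E, discr V E = C := by
  intro hC
  set v := ∫ t in (0 : ℝ)..1, |V t|
  have hbound : ∀ᶠ κ : ℝ in atTop,
      (2 : ℝ) ≤ 2 * ‖C‖ * Real.exp (-κ) + 2 * Real.exp (-(2 * κ)) + 8 * v * κ⁻¹ := by
    filter_upwards [eventually_gt_atTop 0, eventually_ge_atTop (2 * v)] with κ hκ hκv
    obtain ⟨c1, c2⟩ := (cosSol_isSolution hV (-(κ : ℂ) ^ 2)).large_kappa hV hκ hκv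
    obtain ⟨s1, s2⟩ := (sinSol_isSolution hV (-(κ : ℂ) ^ 2)).large_kappa hV hκ hκv
    have hd := hC (-(κ : ℂ) ^ 2)
    rw [discr] at hd
    simp only [cosSol_zero hV, deriv_cosSol_zero hV, sinSol_zero hV, deriv_sinSol_zero hV, mul_one,
      mul_zero, zero_add, add_zero, zero_sub, sub_zero, norm_neg, Complex.norm_real, norm_one,
      Real.norm_of_nonneg hκ.le] at c1 c2 s1 s2
    set a := cosSol V (-(κ : ℂ) ^ 2) 1
    set b := sinSol V (-(κ : ℂ) ^ 2) 1
    set c := deriv (cosSol V (-(κ : ℂ) ^ 2)) 1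
    set d := deriv (sinSol V (-(κ : ℂ) ^ 2)) 1
    have e : (2 : ℂ) * κ = 2 * κ * C * Complex.exp (-κ)
        - ((c + κ * a) * Complex.exp (-κ) - κ) + (c - κ * a) * Complex.exp (-κ)
        - κ * ((d + κ * b) * Complex.exp (-κ) - 1) - κ * ((d - κ * b) * Complex.exp (-κ)) := by
      linear_combination (2 * κ * Complex.exp (-κ)) * hd
    have en : 2 * κ = ‖(2 : ℂ) * κ‖ := by
      rw [norm_mul, Complex.norm_two, Complex.norm_real, Real.norm_of_nonneg hκ.le]
    have eC : ‖2 * κ * C * Complex.exp (-κ)‖ = 2 * κ * ‖C‖ * Real.exp (-κ) := by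
      rw [norm_mul, norm_mul, norm_mul, Complex.norm_two, Complex.norm_real,
        Real.norm_of_nonneg hκ.le, ← Complex.ofReal_neg, Complex.norm_exp_ofReal]
    have ek : ∀ z : ℂ, ‖κ * z‖ = κ * ‖z‖ := fun z => by
      rw [norm_mul, Complex.norm_real, Real.norm_of_nonneg hκ.le]
    have hfin : 2 * κ ≤ 2 * κ * ‖C‖ * Real.exp (-κ) + (κ + κ) / κ * v
        + (κ * Real.exp (-(2 * κ)) + (κ + κ) / κ * v) + κ * ((1 + 1) / κ * v)
        + κ * (1 * Real.exp (-(2 * κ)) + (1 + 1) / κ * v) := by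
      rw [e] at en
      refine en.le.trans ((norm_sub_le _ _).trans (add_le_add ((norm_sub_le _ _).trans (add_le_add
        ((norm_add_le _ _).trans (add_le_add ((norm_sub_le _ _).trans (add_le_add eC.le c1)) c2))
        ?_)) ?_))
      · rw [ek]; gcongr
      · rw [ek]; gcongr
    have h2 : κ * 2 ≤ κ * (2 * ‖C‖ * Real.exp (-κ) + 2 * Real.exp (-(2 * κ)) + 8 * v * κ⁻¹) := by
      calc κ * 2 = 2 * κ := by ring
        _ ≤ _ := hfin
        _ = _ := by field_simp; ring
    exact le_of_mul_le_mul_left h2 hκ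
  have hlim : Tendsto (fun κ : ℝ => 2 * ‖C‖ * Real.exp (-κ) + 2 * Real.exp (-(2 * κ)) +
      8 * v * κ⁻¹) atTop (𝓝 (2 * ‖C‖ * 0 + 2 * 0 + 8 * v * 0)) := by
    have h1 := Real.tendsto_exp_neg_atTop_nhds_zero
    have h2 : Tendsto (fun κ : ℝ => Real.exp (-(2 * κ))) atTop (𝓝 0) :=
      h1.comp (tendsto_id.const_mul_atTop two_pos)
    exact ((h1.const_mul _).add (h2.const_mul _)).add (tendsto_inv_atTop_zero.const_mul _)
  have := ge_of_tendsto hlim hbound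
  norm_num at this

end Unbounded

end

/-! ### The monodromy matrix at a closed gap -/

section

open MeasureTheory intervalIntegral Set BoundedContinuousFunction

section CellIntegral

/-- Integration over the period cell. -/
def cellIntegral : Cell →L[ℂ] ℂ :=
  LinearMap.mkContinuous
    { toFun := fun f => ∫ x in (0 : ℝ)..1, f (projIcc 0 1 zero_le_one x)
      map_add' := fun f g => by
        have h : ∀ f : Cell, IntervalIntegrable (fun x => f (projIcc 0 1 zero_le_one x)) volume 0 1 :=
          fun f => (f.continuous.comp continuous_projIcc).intervalIntegrable _ _
        exact integral_add (h f) (h g)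
      map_smul' := fun c f => intervalIntegral.integral_smul c _ }
    1 fun f => by
      have := norm_integral_le_of_norm_le_const (a := (0 : ℝ)) (b := 1) (C := ‖f‖)
        (f := fun x => f (projIcc 0 1 zero_le_one x)) fun x _ => f.norm_coe_le_norm _
      simpa using this

lemma cellIntegral_eq {F : Cell} {f : ℝ → ℂ} (h : ∀ x : Icc (0 : ℝ) 1, F x = f x) :
    cellIntegral F = ∫ x in (0 : ℝ)..1, f x := by
  refine integral_congr fun x hx => ?_
  rw [uIcc_of_le zero_le_one] at hx
  rw [h, projIcc_of_mem _ hx]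

end CellIntegral

section EnergyDerivative

variable {V : ℝ → ℝ}

/-- The Lagrange identity differentiated in the energy: it determines the energy derivative of the
monodromy matrix. -/
lemma energy_deriv_wronskian (hV : ∀ x y, IntervalIntegrable V volume x y) (E₀ a b p q : ℂ) :
    cauchySol V E₀ p q 1 * deriv (fun E => deriv (cauchySol V E a b) 1) E₀ -
      deriv (cauchySol V E₀ p q) 1 * deriv (fun E => cauchySol V E a b 1) E₀ =
      -∫ x in (0 : ℝ)..1, cauchySol V E₀ a b x * cauchySol V E₀ p q x := by
  obtain ⟨g1, g2, g3⟩ := cauchySol_spec hV E₀ p q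
  set g := cauchySol V E₀ p q
  set h : ℂ → ℂ := fun E => cellIntegral (cell (cauchySol V E a b) * cell g)
  have hh : ∀ E, h E = ∫ x in (0 : ℝ)..1, cauchySol V E a b x * g x := fun E =>
    cellIntegral_eq fun x => by
      rw [ContinuousMap.mul_apply, cell_apply (cauchySol_spec hV E a b).1.1.continuous,
        cell_apply g1.1.continuous]
  have hhd : Differentiable ℂ h := cellIntegral.differentiable.comp
    ((differentiable_cauchySol hV a b).1.mul_const _)
  have hL : ∀ E, g 1 * deriv (cauchySol V E a b) 1 - deriv g 1 * cauchySol V E a b 1 =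
      p * b - q * a + (E₀ - E) * h E := fun E => by
    obtain ⟨f1, f2, f3⟩ := cauchySol_spec hV E a b
    have := (f1.wronskian hV g1).2 1
    rw [this, g2, g3, f2, f3, intervalIntegral.integral_const_mul, hh]
  have hd1 : HasDerivAt
      (fun E => g 1 * deriv (cauchySol V E a b) 1 - deriv g 1 * cauchySol V E a b 1)
      (g 1 * deriv (fun E => deriv (cauchySol V E a b) 1) E₀ -
      deriv g 1 * deriv (fun E => cauchySol V E a b 1) E₀) E₀ :=
    ((differentiable_deriv_cauchySol_one hV a b E₀).hasDerivAt.const_mul _).sub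
      (((differentiable_cauchySol hV a b).2.2 1 E₀).hasDerivAt.const_mul _)
  have hd2 : HasDerivAt (fun E => p * b - q * a + (E₀ - E) * h E) (-h E₀) E₀ := by
    have := ((((hasDerivAt_id E₀).const_sub E₀).mul (hhd E₀).hasDerivAt)).const_add (p * b - q * a)
    exact this.congr_deriv (by simp)
  rw [funext hL] at hd1
  rw [← hh, hd1.unique hd2]

end EnergyDerivative

section ClosedGap

open ComplexConjugate

/-- The algebra behind the structure of the monodromy matrix `(a b; c d)` at an energy where the
discriminant `±2` is critical: `x`, `y`, `z` stand for `∫ c²`, `∫ c s`, `∫ s²`. -/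
lemma closed_gap_algebra {a b c d x y z : ℝ}
    (hpos : ∀ p q : ℝ, (p ≠ 0 ∨ q ≠ 0) → 0 < p ^ 2 * x + 2 * p * q * y + q ^ 2 * z)
    (hcrit : (a - d) * y - b * x + c * z = 0) (hdisc : (a - d) ^ 2 + 4 * b * c = 0) :
    b = 0 ∧ c = 0 ∧ a = d := by
  have hb : b = 0 := by
    by_contra hb
    have := hpos b (-((a - d) / 2)) (Or.inl hb)
    have e : b ^ 2 * x + 2 * b * (-((a - d) / 2)) * y + (-((a - d) / 2)) ^ 2 * z = 0 := by
      linear_combination (-b) * hcrit + z / 4 * hdisc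
    linarith
  have hc : c = 0 := by
    by_contra hc
    have := hpos ((a - d) / 2) c (Or.inr hc)
    have e : ((a - d) / 2) ^ 2 * x + 2 * ((a - d) / 2) * c * y + c ^ 2 * z = 0 := by
      linear_combination c * hcrit + x / 4 * hdisc
    linarith
  refine ⟨hb, hc, ?_⟩
  rw [hb] at hdisc
  have : (a - d) ^ 2 = 0 := by linarith
  exact sub_eq_zero.1 (pow_eq_zero_iff two_ne_zero |>.1 this)

variable {V : ℝ → ℝ}

/-- The Gram matrix of `c` and `s` on the period cell at a real energy: it is real and positive
definite. -/
lemma gram_posDef (hV : ∀ x y, IntervalIntegrable V volume x y) {E : ℂ} (hE : E.im = 0) :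
    ∃ x y z : ℝ, (∫ t in (0 : ℝ)..1, cosSol V E t * cosSol V E t) = x ∧
      (∫ t in (0 : ℝ)..1, cosSol V E t * sinSol V E t) = y ∧
      (∫ t in (0 : ℝ)..1, sinSol V E t * sinSol V E t) = z ∧
      ∀ p q : ℝ, (p ≠ 0 ∨ q ≠ 0) → 0 < p ^ 2 * x + 2 * p * q * y + q ^ 2 * z := by
  have hc : ∀ t, ((cosSol V E t).re : ℂ) = cosSol V E t := fun t => by
    have := Complex.conj_eq_iff_re.1 ((cauchySol_conj hV hE 1 0).1 t)
    simp only [Complex.ofReal_one, Complex.ofReal_zero] at this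
    exact this
  have hs : ∀ t, ((sinSol V E t).re : ℂ) = sinSol V E t := fun t => by
    have := Complex.conj_eq_iff_re.1 ((cauchySol_conj hV hE 0 1).1 t)
    simp only [Complex.ofReal_one, Complex.ofReal_zero] at this
    exact this
  have cc : Continuous (fun t => (cosSol V E t).re) :=
    Complex.continuous_re.comp (cosSol_isSolution hV E).1.continuous
  have cs : Continuous (fun t => (sinSol V E t).re) :=
    Complex.continuous_re.comp (sinSol_isSolution hV E).1.continuous
  refine ⟨∫ t in (0 : ℝ)..1, (cosSol V E t).re * (cosSol V E t).re,
    ∫ t in (0 : ℝ)..1, (cosSol V E t).re * (sinSol V E t).re,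
    ∫ t in (0 : ℝ)..1, (sinSol V E t).re * (sinSol V E t).re, ?_, ?_, ?_, ?_⟩
  · rw [← intervalIntegral.integral_ofReal]; simp only [Complex.ofReal_mul, hc]
  · rw [← intervalIntegral.integral_ofReal]; simp only [Complex.ofReal_mul, hc, hs]
  · rw [← intervalIntegral.integral_ofReal]; simp only [Complex.ofReal_mul, hs]
  · intro p q hpq
    have hsol := comb_isSolution hV E (p : ℂ) q
    have hpos := hsol.integral_normSq_pos hV (fun h => by
      have h0 := congrFun h 0
      have h1 := deriv_comb hV E p q 0
      rw [h] at h1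
      simp [cosSol_zero hV, deriv_cosSol_zero hV, sinSol_zero hV, deriv_sinSol_zero hV] at h0 h1
      have hq : q = 0 := by exact_mod_cast h1.symm
      tauto)
    have e : ∀ t, Complex.normSq (p * cosSol V E t + q * sinSol V E t) =
        p ^ 2 * ((cosSol V E t).re * (cosSol V E t).re) +
          2 * p * q * ((cosSol V E t).re * (sinSol V E t).re) +
          q ^ 2 * ((sinSol V E t).re * (sinSol V E t).re) := fun t => by
      rw [← hc, ← hs, ← Complex.ofReal_mul, ← Complex.ofReal_mul, ← Complex.ofReal_add,
        Complex.normSq_ofReal]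
      simp only [Complex.ofReal_re]
      ring
    simp only [e] at hpos
    rw [intervalIntegral.integral_add, intervalIntegral.integral_add,
      intervalIntegral.integral_const_mul, intervalIntegral.integral_const_mul,
      intervalIntegral.integral_const_mul] at hpos
    · exact hpos
    all_goals
      apply Continuous.intervalIntegrable
      fun_prop

lemma sq_sub_one_sq_of_discr (hV : ∀ x y, IntervalIntegrable V volume x y) {E lam : ℂ}
    (h : lam ^ 2 + 1 = discr V E * lam) : (lam ^ 2 - 1) ^ 2 =
      lam ^ 2 * ((cosSol V E 1 - deriv (sinSol V E) 1) ^ 2 +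
        4 * sinSol V E 1 * deriv (cosSol V E) 1) := by
  have hw := wronskian_cosSol_sinSol hV E 1
  rw [discr] at h
  linear_combination (lam ^ 2 + 1 + (cosSol V E 1 + deriv (sinSol V E) 1) * lam) * h +
    4 * lam ^ 2 * hw

/-- At an energy that is not a branching point but has a Floquet multiplier `±1`, the monodromy
matrix is scalar (the gap is closed) and the multiplier has a nonzero derivative. -/
theorem closed_gap (hV : ∀ x y, IntervalIntegrable V volume x y) {E₀ : ℂ} {lam : ℂ → ℂ}
    (hlam : AnalyticAt ℂ lam E₀) (hmul : ∀ᶠ E in 𝓝 E₀, IsFloquetMultiplier V E (lam E))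
    (h1 : lam E₀ ^ 2 = 1) :
    sinSol V E₀ 1 = 0 ∧ deriv (cosSol V E₀) 1 = 0 ∧ cosSol V E₀ 1 = deriv (sinSol V E₀) 1 ∧
      deriv lam E₀ ≠ 0 := by
  have hE : E₀.im = 0 := hmul.self_of_nhds.im_eq_zero hV h1
  have hl0 : lam E₀ ≠ 0 := fun h => by simp [h] at h1
  have hev : ∀ᶠ E in 𝓝 E₀, lam E ^ 2 + 1 = discr V E * lam E :=
    hmul.mono fun E h => h.sq_add_one hV
  -- the discriminant is `±2` and critical
  have hD : discr V E₀ = 2 * lam E₀ := by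
    have := hev.self_of_nhds
    apply mul_right_cancel₀ hl0
    linear_combination -this - h1
  have hD' : deriv (discr V) E₀ = 0 := by
    have d1 : HasDerivAt (fun E => lam E ^ 2 + 1) (2 * lam E₀ * deriv lam E₀) E₀ := by
      simpa using (hlam.differentiableAt.hasDerivAt.pow 2).add_const 1
    have d2 := (differentiable_discr hV E₀).hasDerivAt.mul hlam.differentiableAt.hasDerivAt
    have := d1.unique (d2.congr_of_eventuallyEq hev)
    rw [hD] at this
    have : deriv (discr V) E₀ * lam E₀ = 0 := by linear_combination -this
    exact (mul_eq_zero.1 this).resolve_right hl0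
  -- the energy derivative of the monodromy matrix in terms of the Gram matrix of `c` and `s`
  have k1 := energy_deriv_wronskian hV E₀ 1 0 1 0
  have k2 := energy_deriv_wronskian hV E₀ 1 0 0 1
  have k3 := energy_deriv_wronskian hV E₀ 0 1 1 0
  have k4 := energy_deriv_wronskian hV E₀ 0 1 0 1
  change cosSol V E₀ 1 * deriv (fun E => deriv (cosSol V E) 1) E₀ -
    deriv (cosSol V E₀) 1 * deriv (fun E => cosSol V E 1) E₀ =
    -∫ x in (0 : ℝ)..1, cosSol V E₀ x * cosSol V E₀ x at k1
  change sinSol V E₀ 1 * deriv (fun E => deriv (cosSol V E) 1) E₀ -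
    deriv (sinSol V E₀) 1 * deriv (fun E => cosSol V E 1) E₀ =
    -∫ x in (0 : ℝ)..1, cosSol V E₀ x * sinSol V E₀ x at k2
  change cosSol V E₀ 1 * deriv (fun E => deriv (sinSol V E) 1) E₀ -
    deriv (cosSol V E₀) 1 * deriv (fun E => sinSol V E 1) E₀ =
    -∫ x in (0 : ℝ)..1, sinSol V E₀ x * cosSol V E₀ x at k3
  change sinSol V E₀ 1 * deriv (fun E => deriv (sinSol V E) 1) E₀ -
    deriv (sinSol V E₀) 1 * deriv (fun E => sinSol V E 1) E₀ =
    -∫ x in (0 : ℝ)..1, sinSol V E₀ x * sinSol V E₀ x at k4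
  simp only [mul_comm (sinSol V E₀ _) (cosSol V E₀ _)] at k3
  have hda := (differentiable_cosSol hV 1 E₀).hasDerivAt
  have hdb := (differentiable_sinSol hV 1 E₀).hasDerivAt
  have hdc := (differentiable_deriv_cosSol_one hV E₀).hasDerivAt
  have hdd := (differentiable_deriv_sinSol_one hV E₀).hasDerivAt
  have htr : deriv (fun E => cosSol V E 1) E₀ + deriv (fun E => deriv (sinSol V E) 1) E₀ = 0 := by
    rw [← hD']; exact (hda.add hdd).deriv.symm
  have hdet := wronskian_cosSol_sinSol hV E₀ 1
  obtain ⟨x, y, z, hx, hy, hz, hpos⟩ := gram_posDef hV hE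
  rw [hx] at k1
  rw [hy] at k2 k3
  rw [hz] at k4
  obtain ⟨ar, har⟩ := Complex.conj_eq_iff_real.1 ((cauchySol_conj hV hE 1 0).1 1)
  obtain ⟨br, hbr⟩ := Complex.conj_eq_iff_real.1 ((cauchySol_conj hV hE 0 1).1 1)
  obtain ⟨cr, hcr⟩ := Complex.conj_eq_iff_real.1 ((cauchySol_conj hV hE 1 0).2 1)
  obtain ⟨dr, hdr⟩ := Complex.conj_eq_iff_real.1 ((cauchySol_conj hV hE 0 1).2 1)
  simp only [Complex.ofReal_one, Complex.ofReal_zero] at har hbr hcr hdr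
  change cosSol V E₀ 1 = ar at har
  change sinSol V E₀ 1 = br at hbr
  change deriv (cosSol V E₀) 1 = cr at hcr
  change deriv (sinSol V E₀) 1 = dr at hdr
  have hdisc : (discr V E₀) ^ 2 = 4 := by rw [hD]; linear_combination 4 * h1
  rw [discr] at hD hdisc
  set a₁ := deriv (fun E => cosSol V E 1) E₀
  set b₁ := deriv (fun E => sinSol V E 1) E₀
  set c₁ := deriv (fun E => deriv (cosSol V E) 1) E₀
  set d₁ := deriv (fun E => deriv (sinSol V E) 1) E₀
  rw [har, hcr] at k1 k3
  rw [hbr, hdr] at k2 k4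
  rw [har, hbr, hcr, hdr] at hdet
  rw [har, hdr] at hdisc
  have hcrit : ((ar : ℂ) - dr) * y - br * x + cr * z = 0 := by
    linear_combination htr + (a₁ + d₁) * hdet + (-br) * k1 + (ar) * k2 - dr * k3 + cr * k4
  have hdisc' : ((ar : ℂ) - dr) ^ 2 + 4 * br * cr = 0 := by
    linear_combination hdisc - 4 * hdet
  obtain ⟨hb0, hc0, had⟩ := closed_gap_algebra (a := ar) (b := br) (c := cr) (d := dr) hpos
    (by exact_mod_cast hcrit) (by exact_mod_cast hdisc')
  refine ⟨by rw [hbr, hb0]; simp, by rw [hcr, hc0]; simp, by rw [har, hdr, had], fun hl' => ?_⟩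
  -- the leading term of `(λ² - 1)² = λ² ((a - d)² + 4 b c)` at `E₀`
  subst hb0 hc0 had
  simp only [Complex.ofReal_zero] at *
  have hev2 : ∀ᶠ E in 𝓝 E₀, (lam E ^ 2 - 1) ^ 2 =
      lam E ^ 2 * ((cosSol V E 1 - deriv (sinSol V E) 1) ^ 2 +
        4 * sinSol V E 1 * deriv (cosSol V E) 1) :=
    hev.mono fun E h => sq_sub_one_sq_of_discr hV h
  have hslope : ∀ᶠ E in 𝓝[≠] E₀, slope (fun E => lam E ^ 2) E₀ E ^ 2 =
      lam E ^ 2 * (slope (fun E => cosSol V E 1 - deriv (sinSol V E) 1) E₀ E ^ 2 +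
        4 * slope (fun E => sinSol V E 1) E₀ E * slope (fun E => deriv (cosSol V E) 1) E₀ E) := by
    filter_upwards [hev2.filter_mono nhdsWithin_le_nhds, self_mem_nhdsWithin] with E h hne
    have : E - E₀ ≠ 0 := sub_ne_zero.2 hne
    simp only [slope_def_field, h1, har, hbr, hcr, hdr, sub_self, sub_zero]
    field_simp
    linear_combination h
  have t1 := (hlam.differentiableAt.hasDerivAt.pow 2).tendsto_slope
  have t2 := (hda.sub hdd).tendsto_slope
  have t3 := hdb.tendsto_slope
  have t4 := hdc.tendsto_slope
  have t5 : Tendsto lam (𝓝[≠] E₀) (𝓝 (lam E₀)) :=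
    hlam.continuousAt.tendsto.mono_left nhdsWithin_le_nhds
  have hlim := tendsto_nhds_unique (t1.pow 2)
    (((t5.pow 2).mul ((t2.pow 2).add ((t3.const_mul 4).mul t4))).congr'
      (hslope.mono fun E h => h.symm))
  rw [hl', h1] at hlim
  have hpz := hpos 0 1 (Or.inr one_ne_zero)
  have hgram := hpos z (-y) (Or.inl (by nlinarith))
  have ha2 : (ar : ℂ) ^ 2 = 1 := by linear_combination hdet
  have ea : a₁ = ar * y := by linear_combination (-ar) * k2 - a₁ * ha2
  have ed : d₁ = -(ar * y) := by linear_combination ar * k3 - d₁ * ha2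
  have eb : b₁ = ar * z := by linear_combination (-ar) * k4 - b₁ * ha2
  have ec : c₁ = -(ar * x) := by linear_combination ar * k1 - c₁ * ha2
  -- if `λ` were critical, the leading term would contradict the definiteness of the Gram matrix
  have hyz : (y : ℂ) ^ 2 = x * z := by
    rw [ea, ed, eb, ec] at hlim
    linear_combination (-1 / 4) * hlim - ((y : ℂ) ^ 2 - x * z) * ha2
  have hyz' : y ^ 2 = x * z := by exact_mod_cast hyz
  nlinarith

end ClosedGap

end

/-! ### Germs of analytic functions and eigenvectors of the monodromy matrix -/

section

open MeasureTheory intervalIntegral Set BoundedContinuousFunction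

section OneVariable

variable {f g k : ℂ → ℂ} {z : ℂ}

lemma analyticAt_dslope (hf : AnalyticAt ℂ f z) : AnalyticAt ℂ (dslope f z) z := by
  obtain ⟨p, hp⟩ := hf
  exact ⟨_, hp.has_fpower_series_dslope_fslope⟩

lemma eq_add_dslope (f : ℂ → ℂ) (z e : ℂ) : f e = f z + (e - z) * dslope f z e := by
  have := sub_smul_dslope f z e
  rw [smul_eq_mul] at this
  rw [this]; ring

lemma exists_local_log (hf : AnalyticAt ℂ f z) (h0 : f z ≠ 0) :
    ∃ l : ℂ → ℂ, AnalyticAt ℂ l z ∧ ∀ᶠ e in 𝓝 z, Complex.exp (l e) = f e := by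
  refine ⟨fun e => Complex.log (f e / f z) + Complex.log (f z), ?_, ?_⟩
  · exact ((hf.div_const).clog (by rw [div_self h0]; exact Complex.one_mem_slitPlane)).add
      analyticAt_const
  · filter_upwards [hf.continuousAt.eventually_ne h0] with e he
    rw [Complex.exp_add, Complex.exp_log (div_ne_zero he h0), Complex.exp_log h0,
      div_mul_cancel₀ _ h0]

lemma exists_local_primitive (hf : AnalyticAt ℂ f z) :
    ∃ F : ℂ → ℂ, AnalyticAt ℂ F z ∧ ∀ᶠ e in 𝓝 z, HasDerivAt F (f e) e := by
  obtain ⟨r, hr, hball⟩ := Metric.eventually_nhds_iff_ball.1 hf.eventually_analyticAt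
  obtain ⟨F, hF⟩ := DifferentiableOn.isExactOn_ball (f := f) (c := z) (r := r)
    fun e he => (hball e he).differentiableAt.differentiableWithinAt
  have hmem : Metric.ball z r ∈ 𝓝 z := Metric.ball_mem_nhds z hr
  refine ⟨F, ?_, by filter_upwards [hmem] with e he using hF e he⟩
  exact DifferentiableOn.analyticAt
    (fun e he => (hF e he).differentiableAt.differentiableWithinAt) hmem

/-- Division by a function that either does not vanish at `z`, or has a simple zero there which is
also a zero of the numerator. -/
lemma exists_quotient (hf : AnalyticAt ℂ f z) (hg : AnalyticAt ℂ g z)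
    (h : g z ≠ 0 ∨ (f z = 0 ∧ g z = 0 ∧ deriv g z ≠ 0)) :
    ∃ q : ℂ → ℂ, AnalyticAt ℂ q z ∧ ∀ᶠ e in 𝓝 z, f e = g e * q e := by
  rcases h with h | ⟨hf0, hg0, hg1⟩
  · refine ⟨fun e => f e / g e, hf.div hg h, ?_⟩
    filter_upwards [hg.continuousAt.eventually_ne h] with e he
    field_simp
  · have hd := analyticAt_dslope hg
    have hdz : dslope g z z ≠ 0 := by rwa [dslope_same]
    refine ⟨fun e => dslope f z e / dslope g z e, (analyticAt_dslope hf).div hd hdz, ?_⟩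
    filter_upwards [hd.continuousAt.eventually_ne hdz] with e he
    rw [eq_add_dslope f z e, eq_add_dslope g z e, hf0, hg0]
    field_simp
    ring

lemma deriv_dslope_self (hk : AnalyticAt ℂ k z) :
    deriv (dslope k z) z = deriv (deriv k) z / 2 := by
  set d := dslope k z
  have hd : AnalyticAt ℂ d z := analyticAt_dslope hk
  have h1 : deriv k =ᶠ[𝓝 z] fun e => d e + (e - z) * deriv d e := by
    filter_upwards [hd.eventually_analyticAt] with e he
    have := (((hasDerivAt_id e).sub_const z).mul he.differentiableAt.hasDerivAt).const_add (k z)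
    rw [show k = fun e => k z + (e - z) * d e from funext fun e => eq_add_dslope k z e]
    simpa using this.deriv
  have h2 := hd.differentiableAt.hasDerivAt.add
    (((hasDerivAt_id z).sub_const z).mul hd.deriv.differentiableAt.hasDerivAt)
  have h3 := (h2.congr_of_eventuallyEq h1).deriv
  simp only [id, sub_self, zero_mul, add_zero, one_mul] at h3
  rw [h3]; ring

/-- The first order expansion at `z` of a relation `(e - z) α = -i (k - k(z)) β`. -/
lemma deriv_of_dslope_relation {α β : ℂ → ℂ} (hα : AnalyticAt ℂ α z) (hβ : AnalyticAt ℂ β z)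
    (hk : AnalyticAt ℂ k z)
    (h : ∀ᶠ e in 𝓝 z, (z - e) * α e = Complex.I * (k e - k z) * β e) :
    α z = -Complex.I * deriv k z * β z ∧
      deriv α z = -Complex.I * (deriv (deriv k) z / 2 * β z + deriv k z * deriv β z) := by
  have hd := analyticAt_dslope hk
  have hγ : AnalyticAt ℂ (fun e => -Complex.I * (dslope k z e * β e)) z :=
    analyticAt_const.mul (hd.mul hβ)
  have heq : ∀ᶠ e in 𝓝[≠] z, α e = -Complex.I * (dslope k z e * β e) := by
    filter_upwards [h.filter_mono nhdsWithin_le_nhds, self_mem_nhdsWithin] with e he hne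
    rw [eq_add_dslope k z e] at he
    have h0 : e - z ≠ 0 := sub_ne_zero.2 hne
    apply mul_left_cancel₀ h0
    linear_combination -he
  have heq' := (hα.frequently_eq_iff_eventually_eq hγ).1 heq.frequently
  constructor
  · rw [heq'.self_of_nhds, dslope_same]; ring
  · have := ((hd.differentiableAt.hasDerivAt.mul hβ.differentiableAt.hasDerivAt).const_mul
      (-Complex.I))
    rw [(this.congr_of_eventuallyEq heq').deriv, deriv_dslope_self hk, dslope_same]

end OneVariable

section Eigenvectors

variable {V : ℝ → ℝ}

/-- `(p, q)` are the Cauchy data at `0` of a Floquet solution with multiplier `lam`, i.e. an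
eigenvector of the monodromy matrix. -/
def IsEigenvector (V : ℝ → ℝ) (E lam p q : ℂ) : Prop :=
  cosSol V E 1 * p + sinSol V E 1 * q = lam * p ∧
    deriv (cosSol V E) 1 * p + deriv (sinSol V E) 1 * q = lam * q

/-- Away from branching points the monodromy matrix `M` has analytic eigenvectors for `λ` and `1/λ`
that are linearly independent, also where `λ = 1/λ`: there the gap is closed, so that
`(2 M - tr M) / (λ - 1/λ)` has a removable singularity. Its value `(α 2β; 2γ -α)` is an
involution and the eigenvectors are columns of its spectral projections. -/
theorem exists_eigenvectors (hV : ∀ x y, IntervalIntegrable V volume x y) {E₀ : ℂ} {lam : ℂ → ℂ}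
    (hlam : AnalyticAt ℂ lam E₀) (hmul : ∀ᶠ E in 𝓝 E₀, IsFloquetMultiplier V E (lam E)) :
    ∃ p q p' q' : ℂ → ℂ, AnalyticAt ℂ p E₀ ∧ AnalyticAt ℂ q E₀ ∧ AnalyticAt ℂ p' E₀ ∧
      AnalyticAt ℂ q' E₀ ∧ (∀ᶠ E in 𝓝 E₀, IsEigenvector V E (lam E) (p E) (q E)) ∧
      (∀ᶠ E in 𝓝 E₀, IsEigenvector V E (lam E)⁻¹ (p' E) (q' E)) ∧
      p' E₀ * q E₀ - q' E₀ * p E₀ ≠ 0 := by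
  have hev : ∀ᶠ E in 𝓝 E₀, lam E ^ 2 + 1 = discr V E * lam E :=
    hmul.mono fun E h => h.sq_add_one hV
  have hl0 : lam E₀ ≠ 0 := fun h => by simpa [h] using hev.self_of_nhds
  have hlne := hlam.continuousAt.eventually_ne hl0
  have hν : AnalyticAt ℂ (fun E => lam E ^ 2 - 1) E₀ := (hlam.pow 2).sub analyticAt_const
  have hνd : deriv (fun E => lam E ^ 2 - 1) E₀ = 2 * lam E₀ * deriv lam E₀ := by
    simpa using ((hlam.differentiableAt.hasDerivAt.pow 2).sub_const 1).deriv
  have ha := (differentiable_cosSol hV 1).analyticAt E₀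
  have hb := (differentiable_sinSol hV 1).analyticAt E₀
  have hc := (differentiable_deriv_cosSol_one hV).analyticAt E₀
  have hd := (differentiable_deriv_sinSol_one hV).analyticAt E₀
  have hcase : lam E₀ ^ 2 - 1 ≠ 0 ∨ (sinSol V E₀ 1 = 0 ∧ deriv (cosSol V E₀) 1 = 0 ∧
      cosSol V E₀ 1 - deriv (sinSol V E₀) 1 = 0 ∧ lam E₀ ^ 2 - 1 = 0 ∧
      deriv (fun E => lam E ^ 2 - 1) E₀ ≠ 0) := by
    by_cases h1 : lam E₀ ^ 2 = 1
    · obtain ⟨h2, h3, h4, h5⟩ := closed_gap hV hlam hmul h1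
      exact Or.inr ⟨h2, h3, sub_eq_zero.2 h4, sub_eq_zero.2 h1, by
        rw [hνd]; exact mul_ne_zero (mul_ne_zero two_ne_zero hl0) h5⟩
    · exact Or.inl (sub_ne_zero.2 h1)
  obtain ⟨α, hα, hαe⟩ := exists_quotient
    (f := fun E => (cosSol V E 1 - deriv (sinSol V E) 1) * lam E) ((ha.sub hd).mul hlam) hν
    (hcase.imp_right fun h => ⟨by rw [h.2.2.1, zero_mul], h.2.2.2.1, h.2.2.2.2⟩)
  obtain ⟨β, hβ, hβe⟩ := exists_quotient (f := fun E => sinSol V E 1 * lam E) (hb.mul hlam) hν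
    (hcase.imp_right fun h => ⟨by rw [h.1, zero_mul], h.2.2.2.1, h.2.2.2.2⟩)
  obtain ⟨γ, hγ, hγe⟩ := exists_quotient (f := fun E => deriv (cosSol V E) 1 * lam E)
    (hc.mul hlam) hν
    (hcase.imp_right fun h => ⟨by rw [h.2.1, zero_mul], h.2.2.2.1, h.2.2.2.2⟩)
  have hνne : ∀ᶠ E in 𝓝[≠] E₀, lam E ^ 2 - 1 ≠ 0 := by
    rcases hcase with h | h
    · exact (hν.continuousAt.eventually_ne h).filter_mono nhdsWithin_le_nhds
    · have := hν.differentiableAt.hasDerivAt.eventually_ne (c := 0) h.2.2.2.2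
      exact this
  have hone : ∀ᶠ E in 𝓝 E₀, α E ^ 2 + 4 * β E * γ E = 1 := by
    have h1 : AnalyticAt ℂ (fun E => α E ^ 2 + 4 * β E * γ E) E₀ :=
      (hα.pow 2).add ((analyticAt_const.mul hβ).mul hγ)
    refine (h1.frequently_eq_iff_eventually_eq analyticAt_const).1 (Eventually.frequently ?_)
    filter_upwards [hνne, hαe.filter_mono nhdsWithin_le_nhds, hβe.filter_mono nhdsWithin_le_nhds,
      hγe.filter_mono nhdsWithin_le_nhds, hev.filter_mono nhdsWithin_le_nhds] with E h0 h1 h2 h3 h4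
    have h5 := sq_sub_one_sq_of_discr hV h4
    apply mul_left_cancel₀ (pow_ne_zero 2 h0)
    linear_combination -h5 - ((cosSol V E 1 - deriv (sinSol V E) 1) * lam E +
      (lam E ^ 2 - 1) * α E) * h1 - 4 * deriv (cosSol V E) 1 * lam E * h2 -
      4 * (lam E ^ 2 - 1) * β E * h3
  have hrel : ∀ᶠ E in 𝓝 E₀, lam E ≠ 0 ∧ α E ^ 2 + 4 * β E * γ E = 1 ∧
      cosSol V E 1 * lam E = (lam E ^ 2 + 1 + (lam E ^ 2 - 1) * α E) / 2 ∧
      sinSol V E 1 * lam E = (lam E ^ 2 - 1) * β E ∧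
      deriv (cosSol V E) 1 * lam E = (lam E ^ 2 - 1) * γ E ∧
      deriv (sinSol V E) 1 * lam E = (lam E ^ 2 + 1 - (lam E ^ 2 - 1) * α E) / 2 := by
    filter_upwards [hlne, hone, hαe, hβe, hγe, hev] with E h0 h1 h2 h3 h4 h5
    rw [discr] at h5
    exact ⟨h0, h1, by linear_combination (h2 - h5) / 2, h3, h4,
      by linear_combination (-h2 - h5) / 2⟩
  have key : ∀ {E x : ℂ}, lam E ≠ 0 → ∀ {y : ℂ}, x * lam E = y * lam E → x = y :=
    fun h _ e => mul_right_cancel₀ h e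
  by_cases h : α E₀ = -1
  · refine ⟨fun E => 2 * β E, fun E => 1 - α E, fun E => 1 - α E, fun E => -2 * γ E,
      by fun_prop, by fun_prop, by fun_prop, by fun_prop, ?_, ?_, ?_⟩
    · filter_upwards [hrel] with E ⟨h0, h1, h2, h3, h4, h5⟩
      constructor
      · refine key h0 ?_
        linear_combination 2 * β E * h2 + (1 - α E) * h3
      · refine key h0 ?_
        linear_combination 2 * β E * h4 + (1 - α E) * h5 + (lam E ^ 2 - 1) / 2 * h1
    · filter_upwards [hrel] with E ⟨h0, h1, h2, h3, h4, h5⟩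
      constructor
      · refine key h0 ?_
        field_simp
        linear_combination (1 - α E) * h2 - 2 * γ E * h3 - (lam E ^ 2 - 1) / 2 * h1
      · refine key h0 ?_
        field_simp
        linear_combination (1 - α E) * h4 - 2 * γ E * h5
    · have h1 := hone.self_of_nhds
      have : (1 - α E₀) * (1 - α E₀) - -2 * γ E₀ * (2 * β E₀) = 2 * (1 - α E₀) := by
        linear_combination h1
      rw [this, h]; norm_num
  · refine ⟨fun E => 1 + α E, fun E => 2 * γ E, fun E => -2 * β E, fun E => 1 + α E,
      by fun_prop, by fun_prop, by fun_prop, by fun_prop, ?_, ?_, ?_⟩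
    · filter_upwards [hrel] with E ⟨h0, h1, h2, h3, h4, h5⟩
      constructor
      · refine key h0 ?_
        linear_combination (1 + α E) * h2 + 2 * γ E * h3 + (lam E ^ 2 - 1) / 2 * h1
      · refine key h0 ?_
        linear_combination (1 + α E) * h4 + 2 * γ E * h5
    · filter_upwards [hrel] with E ⟨h0, h1, h2, h3, h4, h5⟩
      constructor
      · refine key h0 ?_
        field_simp
        linear_combination (-2 * β E) * h2 + (1 + α E) * h3
      · refine key h0 ?_
        field_simp
        linear_combination (-2 * β E) * h4 + (1 + α E) * h5 - (lam E ^ 2 - 1) / 2 * h1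
    · have h1 := hone.self_of_nhds
      have : -2 * β E₀ * (2 * γ E₀) - (1 + α E₀) * (1 + α E₀) = -(2 * (1 + α E₀)) := by
        linear_combination -h1
      rw [this]
      exact neg_ne_zero.2 (mul_ne_zero two_ne_zero fun h' => h (by linear_combination h'))

end Eigenvectors

end

/-! ### The Lagrange identity on a period -/

section

open MeasureTheory intervalIntegral Set BoundedContinuousFunction

section TwoEnergies

variable {V : ℝ → ℝ}

/-- The Lagrange identity over a period for two Bloch solutions `f`, `g` with energies `E₁`, `E₂`
and multipliers `e^{i κ₁}`, `e^{-i κ₂}`, after passing to their periodic components. -/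
lemma lagrange_periodic (hV : ∀ x y, IntervalIntegrable V volume x y) {E₁ E₂ κ₁ κ₂ : ℂ}
    {f g : ℝ → ℂ} (hf : IsSolution V E₁ f) (hg : IsSolution V E₂ g)
    (hf0 : f 1 = Complex.exp (Complex.I * κ₁) * f 0)
    (hf1 : deriv f 1 = Complex.exp (Complex.I * κ₁) * deriv f 0)
    (hg0 : g 1 = Complex.exp (-(Complex.I * κ₂)) * g 0)
    (hg1 : deriv g 1 = Complex.exp (-(Complex.I * κ₂)) * deriv g 0) :
    (E₂ - E₁) * ∫ x in (0 : ℝ)..1, Complex.exp (-(Complex.I * (κ₁ - κ₂) * x)) * (f x * g x) =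
      Complex.I * (κ₁ - κ₂) * ∫ x in (0 : ℝ)..1, Complex.exp (-(Complex.I * (κ₁ - κ₂) * x)) *
        (g x * deriv f x - deriv g x * f x) := by
  set δ := κ₁ - κ₂
  have hexp : IsPrimitive (fun x : ℝ => Complex.exp (-(Complex.I * δ * x)))
      (fun x : ℝ => -(Complex.I * δ) * Complex.exp (-(Complex.I * δ * x))) :=
    .of_hasDerivAt (fun x => by
      have := (((hasDerivAt_id (x : ℂ)).const_mul (Complex.I * δ)).neg.cexp).comp_ofReal
      simpa [mul_comm] using this) (by fun_prop)
  have h := (hexp.mul (hf.wronskian hV hg)).2 1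
  have hend : Complex.exp (-(Complex.I * δ * ((1 : ℝ) : ℂ))) *
      (g 1 * deriv f 1 - deriv g 1 * f 1) = g 0 * deriv f 0 - deriv g 0 * f 0 := by
    rw [hf0, hf1, hg0, hg1]
    have e : Complex.exp (-(Complex.I * δ * ((1 : ℝ) : ℂ))) * (Complex.exp (Complex.I * κ₁) *
        Complex.exp (-(Complex.I * κ₂))) = 1 := by
      rw [← Complex.exp_add, ← Complex.exp_add, ← Complex.exp_zero]
      congr 1
      simp only [δ]; push_cast; ring
    linear_combination (g 0 * deriv f 0 - deriv g 0 * f 0) * e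
  rw [hend] at h
  simp only [Complex.ofReal_zero, mul_zero, neg_zero, Complex.exp_zero, one_mul] at h
  have hfc := hf.1.continuous
  have hgc := hg.1.continuous
  have hfc' := hf.continuous_deriv hV
  have hgc' := hg.continuous_deriv hV
  rw [intervalIntegral.integral_add (by apply Continuous.intervalIntegrable; fun_prop)
    (by apply Continuous.intervalIntegrable; fun_prop)] at h
  rw [← intervalIntegral.integral_const_mul, ← intervalIntegral.integral_const_mul]
  have e1 : ∀ x : ℝ, -(Complex.I * δ) * Complex.exp (-(Complex.I * δ * x)) *
      (g x * deriv f x - deriv g x * f x) = -(Complex.I * δ * (Complex.exp (-(Complex.I * δ * x)) *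
        (g x * deriv f x - deriv g x * f x))) := fun x => by ring
  have e2 : ∀ x : ℝ, Complex.exp (-(Complex.I * δ * x)) * ((E₂ - E₁) * (f x * g x)) =
      (E₂ - E₁) * (Complex.exp (-(Complex.I * δ * x)) * (f x * g x)) := fun x => by ring
  simp only [e1, e2, intervalIntegral.integral_neg] at h
  linear_combination -h

/-- The function `e^{c x}` on the period cell. -/
def cellExp (c : ℂ) : Cell := NormedSpace.exp (c • (⟨fun x => ((x : ℝ) : ℂ), by fun_prop⟩ : Cell))

lemma cellExp_apply (c : ℂ) (x : Icc (0 : ℝ) 1) : cellExp c x = Complex.exp (c * (x : ℝ)) := by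
  have := NormedSpace.map_exp (ContinuousMap.evalAlgHom ℂ ℂ x) (by
    exact (cellEval x).continuous) (c • (⟨fun x => ((x : ℝ) : ℂ), by fun_prop⟩ : Cell))
  rw [Complex.exp_eq_exp_ℂ]
  exact this

lemma analyticAt_cellExp {k : ℂ → ℂ} {z : ℂ} (hk : AnalyticAt ℂ k z) :
    AnalyticAt ℂ (fun e => cellExp (k e)) z := by
  have h1 : AnalyticAt ℂ (fun e => k e • (⟨fun x => ((x : ℝ) : ℂ), by fun_prop⟩ : Cell)) z :=
    hk.smul analyticAt_const
  exact (NormedSpace.exp_analytic (𝕂 := ℂ) _).comp h1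

end TwoEnergies

end

/-! ### Bloch frames and the function `g` -/

section

open MeasureTheory intervalIntegral Set BoundedContinuousFunction

section Frame

variable {V : ℝ → ℝ}

/-- The solution with Cauchy data `(p, q)` at `0`, on the period cell. -/
def cellSol (V : ℝ → ℝ) (p q E : ℂ) : Cell := p • cell (cosSol V E) + q • cell (sinSol V E)

/-- The derivative of the solution with Cauchy data `(p, q)` at `0`, on the period cell. -/
def cellSolDeriv (V : ℝ → ℝ) (p q E : ℂ) : Cell :=
  p • cell (deriv (cosSol V E)) + q • cell (deriv (sinSol V E))

lemma cellSol_apply (hV : ∀ x y, IntervalIntegrable V volume x y) (p q E : ℂ) (x : Icc (0 : ℝ) 1) :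
    cellSol V p q E x = p * cosSol V E x + q * sinSol V E x := by
  simp [cellSol, cell_apply (cosSol_isSolution hV E).1.continuous,
    cell_apply (sinSol_isSolution hV E).1.continuous]

lemma cellSolDeriv_apply (hV : ∀ x y, IntervalIntegrable V volume x y) (p q E : ℂ)
    (x : Icc (0 : ℝ) 1) : cellSolDeriv V p q E x =
      deriv (fun x => p * cosSol V E x + q * sinSol V E x) x := by
  rw [deriv_comb hV]
  simp [cellSolDeriv, cell_apply ((cosSol_isSolution hV E).continuous_deriv hV),
    cell_apply ((sinSol_isSolution hV E).continuous_deriv hV)]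

lemma analyticAt_cellSol (hV : ∀ x y, IntervalIntegrable V volume x y) {p q : ℂ → ℂ} {E : ℂ}
    (hp : AnalyticAt ℂ p E) (hq : AnalyticAt ℂ q E) :
    AnalyticAt ℂ (fun e => cellSol V (p e) (q e) e) E :=
  (hp.smul ((differentiable_cauchySol hV 1 0).1.analyticAt E)).add
    (hq.smul ((differentiable_cauchySol hV 0 1).1.analyticAt E))

lemma analyticAt_cellSolDeriv (hV : ∀ x y, IntervalIntegrable V volume x y) {p q : ℂ → ℂ} {E : ℂ}
    (hp : AnalyticAt ℂ p E) (hq : AnalyticAt ℂ q E) :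
    AnalyticAt ℂ (fun e => cellSolDeriv V (p e) (q e) e) E :=
  (hp.smul ((differentiable_cauchySol hV 1 0).2.1.analyticAt E)).add
    (hq.smul ((differentiable_cauchySol hV 0 1).2.1.analyticAt E))

/-- Analytic Cauchy data `(p, q)` and `(p', q')` near `E` of two linearly independent Bloch
solutions, with the multipliers `e^{ik}` and `e^{-ik}`. -/
structure BlochFrame (V : ℝ → ℝ) (k p q p' q' : ℂ → ℂ) (E : ℂ) : Prop where
  k_an : AnalyticAt ℂ k E
  p_an : AnalyticAt ℂ p E
  q_an : AnalyticAt ℂ q E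
  p'_an : AnalyticAt ℂ p' E
  q'_an : AnalyticAt ℂ q' E
  eig : ∀ᶠ e in 𝓝 E, IsEigenvector V e (Complex.exp (Complex.I * k e)) (p e) (q e)
  eig' : ∀ᶠ e in 𝓝 E, IsEigenvector V e (Complex.exp (-(Complex.I * k e))) (p' e) (q' e)
  indep : p' E * q E - q' E * p E ≠ 0

theorem exists_blochFrame (hV : ∀ x y, IntervalIntegrable V volume x y) {E : ℂ} {k : ℂ → ℂ}
    (hk : AnalyticAt ℂ k E)
    (hmul : ∀ᶠ e in 𝓝 E, IsFloquetMultiplier V e (Complex.exp (Complex.I * k e))) :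
    ∃ p q p' q' : ℂ → ℂ, BlochFrame V k p q p' q' E := by
  have hlam : AnalyticAt ℂ (fun e => Complex.exp (Complex.I * k e)) E :=
    (analyticAt_const.mul hk).cexp
  obtain ⟨p, q, p', q', h1, h2, h3, h4, h5, h6, h7⟩ := exists_eigenvectors hV hlam hmul
  refine ⟨p, q, p', q', hk, h1, h2, h3, h4, h5, ?_, h7⟩
  simpa only [Complex.exp_neg] using h6

namespace BlochFrame

variable {k p q p' q' : ℂ → ℂ} {E : ℂ}

lemma eventually (h : BlochFrame V k p q p' q' E) :
    ∀ᶠ e in 𝓝 E, BlochFrame V k p q p' q' e := by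
  have hi : AnalyticAt ℂ (fun E => p' E * q E - q' E * p E) E :=
    (h.p'_an.mul h.q_an).sub (h.q'_an.mul h.p_an)
  filter_upwards [h.k_an.eventually_analyticAt, h.p_an.eventually_analyticAt,
    h.q_an.eventually_analyticAt, h.p'_an.eventually_analyticAt, h.q'_an.eventually_analyticAt,
    h.eig.eventually_nhds, h.eig'.eventually_nhds, hi.continuousAt.eventually_ne h.indep]
    with e h1 h2 h3 h4 h5 h6 h7 h8
  exact ⟨h1, h2, h3, h4, h5, h6, h7, h8⟩

lemma p_ne_zero (h : BlochFrame V k p q p' q' E) (hs : sinSol V E 1 ≠ 0) : p E ≠ 0 := fun h0 => by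
  have h1 := h.eig.self_of_nhds.1
  rw [h0, mul_zero, mul_zero, zero_add] at h1
  exact h.indep (by rw [(mul_eq_zero.1 h1).resolve_left hs, h0]; ring)

lemma p'_ne_zero (h : BlochFrame V k p q p' q' E) (hs : sinSol V E 1 ≠ 0) : p' E ≠ 0 := fun h0 => by
  have h1 := h.eig'.self_of_nhds.1
  rw [h0, mul_zero, mul_zero, zero_add] at h1
  exact h.indep (by rw [(mul_eq_zero.1 h1).resolve_left hs, h0]; ring)

lemma blochPsi_one (h : BlochFrame V k p q p' q' E) (hs : sinSol V E 1 ≠ 0) (u : ℝ) :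
    blochPsi V k 1 u E = (p E)⁻¹ * (p E * cosSol V E u + q E * sinSol V E u) := by
  have hp := h.p_ne_zero hs
  have h1 := h.eig.self_of_nhds.1
  simp only [blochPsi, Units.val_one, Int.cast_one, one_mul]
  field_simp
  linear_combination (-sinSol V E u) * h1

lemma blochPsi_neg_one (h : BlochFrame V k p q p' q' E) (hs : sinSol V E 1 ≠ 0) (u : ℝ) :
    blochPsi V k (-1) u E = (p' E)⁻¹ * (p' E * cosSol V E u + q' E * sinSol V E u) := by
  have hp := h.p'_ne_zero hs
  have h1 := h.eig'.self_of_nhds.1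
  simp only [blochPsi, Units.val_neg, Units.val_one, Int.cast_neg, Int.cast_one, neg_mul, one_mul]
  field_simp
  linear_combination (-sinSol V E u) * h1

end BlochFrame

/-- The periodic component of the solution with data `(p, q)`, on the period cell, where `c = ∓ik`.
-/
def cellP (V : ℝ → ℝ) (c p q : ℂ → ℂ) (e : ℂ) : Cell :=
  cellExp (c e) * cellSol V (p e) (q e) e

/-- The derivative of the solution with data `(p, q)`, times `e^{c x}`, on the period cell. -/
def cellP' (V : ℝ → ℝ) (c p q : ℂ → ℂ) (e : ℂ) : Cell :=
  cellExp (c e) * cellSolDeriv V (p e) (q e) e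

lemma analyticAt_cellP (hV : ∀ x y, IntervalIntegrable V volume x y) {c p q : ℂ → ℂ} {E : ℂ}
    (hc : AnalyticAt ℂ c E) (hp : AnalyticAt ℂ p E) (hq : AnalyticAt ℂ q E) :
    AnalyticAt ℂ (cellP V c p q) E :=
  (analyticAt_cellExp hc).mul (analyticAt_cellSol hV hp hq)

lemma analyticAt_cellP' (hV : ∀ x y, IntervalIntegrable V volume x y) {c p q : ℂ → ℂ} {E : ℂ}
    (hc : AnalyticAt ℂ c E) (hp : AnalyticAt ℂ p E) (hq : AnalyticAt ℂ q E) :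
    AnalyticAt ℂ (cellP' V c p q) E :=
  (analyticAt_cellExp hc).mul (analyticAt_cellSolDeriv hV hp hq)

/-- The pairing `B(E', E) = ∫ e^{-i (k(E) - k(E')) x} w(x) dx`, where `w` is the Wronskian of the
Bloch solution with data `(p, q)` at `E` and the one with data `(p', q')` at `E'`. -/
def pairB (V : ℝ → ℝ) (k p q p' q' : ℂ → ℂ) (E' E : ℂ) : ℂ :=
  cellIntegral (cellP V (fun e => Complex.I * k e) p' q' E' *
      cellP' V (fun e => -(Complex.I * k e)) p q E -
    cellP' V (fun e => Complex.I * k e) p' q' E' * cellP V (fun e => -(Complex.I * k e)) p q E)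

/-- The derivative of `pairB` in its second energy, on the diagonal. -/
def diagB (V : ℝ → ℝ) (k p q p' q' : ℂ → ℂ) (E : ℂ) : ℂ :=
  cellIntegral (cellP V (fun e => Complex.I * k e) p' q' E *
      deriv (cellP' V (fun e => -(Complex.I * k e)) p q) E -
    cellP' V (fun e => Complex.I * k e) p' q' E *
      deriv (cellP V (fun e => -(Complex.I * k e)) p q) E)

namespace BlochFrame

variable {k p q p' q' : ℂ → ℂ} {E : ℂ}

lemma analyticAt_diagB (hV : ∀ x y, IntervalIntegrable V volume x y)
    (h : BlochFrame V k p q p' q' E) : AnalyticAt ℂ (diagB V k p q p' q') E := by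
  have hc : AnalyticAt ℂ (fun e => Complex.I * k e) E := analyticAt_const.mul h.k_an
  exact (cellIntegral.analyticAt _).comp
    (((analyticAt_cellP hV hc h.p'_an h.q'_an).mul
      (analyticAt_cellP' hV hc.neg h.p_an h.q_an).deriv).sub
      ((analyticAt_cellP' hV hc h.p'_an h.q'_an).mul
        (analyticAt_cellP hV hc.neg h.p_an h.q_an).deriv))

lemma hasDerivAt_pairB (hV : ∀ x y, IntervalIntegrable V volume x y)
    (h : BlochFrame V k p q p' q' E) :
    AnalyticAt ℂ (pairB V k p q p' q' E) E ∧
      HasDerivAt (pairB V k p q p' q' E) (diagB V k p q p' q' E) E := by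
  have hc : AnalyticAt ℂ (fun e => -(Complex.I * k e)) E := (analyticAt_const.mul h.k_an).neg
  have h1 := analyticAt_cellP' hV hc h.p_an h.q_an
  have h2 := analyticAt_cellP hV hc h.p_an h.q_an
  refine ⟨(cellIntegral.analyticAt _).comp ((analyticAt_const.mul h1).sub (analyticAt_const.mul h2)),
    ?_⟩
  exact cellIntegral.hasFDerivAt.comp_hasDerivAt E
    ((h1.differentiableAt.hasDerivAt.const_mul _).sub (h2.differentiableAt.hasDerivAt.const_mul _))

lemma pairB_eq (hV : ∀ x y, IntervalIntegrable V volume x y) (k p q p' q' : ℂ → ℂ) (E' E : ℂ) :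
    pairB V k p q p' q' E' E = ∫ x in (0 : ℝ)..1, Complex.exp (-(Complex.I * (k E - k E') * x)) *
      ((p' E' * cosSol V E' x + q' E' * sinSol V E' x) *
          deriv (fun x => p E * cosSol V E x + q E * sinSol V E x) x -
        deriv (fun x => p' E' * cosSol V E' x + q' E' * sinSol V E' x) x *
          (p E * cosSol V E x + q E * sinSol V E x)) := by
  refine cellIntegral_eq fun x => ?_
  have e : Complex.exp (-(Complex.I * (k E - k E') * ((x : ℝ) : ℂ))) =
      Complex.exp (Complex.I * k E' * (x : ℝ)) * Complex.exp (-(Complex.I * k E) * (x : ℝ)) := by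
    rw [← Complex.exp_add]; congr 1; ring
  simp only [ContinuousMap.sub_apply, ContinuousMap.mul_apply, cellP, cellP', cellExp_apply,
    cellSol_apply hV, cellSolDeriv_apply hV, e]
  ring

lemma pairB_self (hV : ∀ x y, IntervalIntegrable V volume x y) (k p q p' q' : ℂ → ℂ) (E : ℂ) :
    pairB V k p q p' q' E E = p' E * q E - q' E * p E := by
  rw [pairB_eq hV]
  have : ∀ x : ℝ, (p' E * cosSol V E x + q' E * sinSol V E x) *
          deriv (fun x => p E * cosSol V E x + q E * sinSol V E x) x -
        deriv (fun x => p' E * cosSol V E x + q' E * sinSol V E x) x *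
          (p E * cosSol V E x + q E * sinSol V E x) = p' E * q E - q' E * p E := fun x => by
    rw [deriv_comb hV, deriv_comb hV]
    linear_combination (p' E * q E - q' E * p E) * wronskian_cosSol_sinSol hV E x
  simp only [this]
  simp

lemma data {E lam p q : ℂ} (hV : ∀ x y, IntervalIntegrable V volume x y)
    (h : IsEigenvector V E lam p q) :
    (p * cosSol V E 1 + q * sinSol V E 1 = lam * (p * cosSol V E 0 + q * sinSol V E 0)) ∧
    deriv (fun x => p * cosSol V E x + q * sinSol V E x) 1 =
      lam * deriv (fun x => p * cosSol V E x + q * sinSol V E x) 0 := by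
  rw [deriv_comb hV, deriv_comb hV, cosSol_zero hV, sinSol_zero hV, deriv_cosSol_zero hV,
    deriv_sinSol_zero hV]
  obtain ⟨h1, h2⟩ := h
  constructor
  · linear_combination h1
  · linear_combination h2

lemma pairing_relation (hV : ∀ x y, IntervalIntegrable V volume x y)
    (h : BlochFrame V k p q p' q' E) :
    ∀ᶠ e in 𝓝 E, (E - e) * cellIntegral (cellP V (fun e => Complex.I * k e) p' q' E *
      cellP V (fun e => -(Complex.I * k e)) p q e) =
      Complex.I * (k e - k E) * pairB V k p q p' q' E e := by
  filter_upwards [h.eig] with e he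
  have he' := h.eig'.self_of_nhds
  rw [pairB_eq hV, ← lagrange_periodic hV (comb_isSolution hV e (p e) (q e))
    (comb_isSolution hV E (p' E) (q' E)) (data hV he).1 (data hV he).2 (data hV he').1
    (data hV he').2]
  congr 1
  refine cellIntegral_eq fun x => ?_
  have e : Complex.exp (-(Complex.I * (k e - k E) * ((x : ℝ) : ℂ))) =
      Complex.exp (Complex.I * k E * (x : ℝ)) * Complex.exp (-(Complex.I * k e) * (x : ℝ)) := by
    rw [← Complex.exp_add]; congr 1; ring
  simp only [ContinuousMap.mul_apply, cellP, cellExp_apply, cellSol_apply hV, e]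
  ring

/-- The function `g_+` in terms of a frame: up to terms that are analytic wherever the frame is, it
is `-k''/(2k')` plus the logarithmic derivative of the normalizing factor `p`. -/
theorem blochG_eq (hV : ∀ x y, IntervalIntegrable V volume x y) (h : BlochFrame V k p q p' q' E)
    (hs : sinSol V E 1 ≠ 0) (hk' : deriv k E ≠ 0) :
    blochG V k 1 E = deriv p E / p E - deriv (deriv k) E / (2 * deriv k E) -
      diagB V k p q p' q' E / (p' E * q E - q' E * p E) := by
  have hc : AnalyticAt ℂ (fun e => -(Complex.I * k e)) E := (analyticAt_const.mul h.k_an).neg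
  set φ := cellP V (fun e => -(Complex.I * k e)) p q
  set φ' := cellP V (fun e => Complex.I * k e) p' q'
  have hφ : AnalyticAt ℂ φ E := analyticAt_cellP hV hc h.p_an h.q_an
  set α : ℂ → ℂ := fun e => cellIntegral (φ' E * φ e)
  have hα : AnalyticAt ℂ α E := (cellIntegral.analyticAt _).comp (analyticAt_const.mul hφ)
  have hα' : HasDerivAt α (cellIntegral (φ' E * deriv φ E)) E :=
    cellIntegral.hasFDerivAt.comp_hasDerivAt E (hφ.differentiableAt.hasDerivAt.const_mul _)
  obtain ⟨hB, hB'⟩ := h.hasDerivAt_pairB hV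
  obtain ⟨r1, r2⟩ := deriv_of_dslope_relation hα hB h.k_an (h.pairing_relation hV)
  rw [pairB_self hV, hα'.deriv, hB'.deriv] at r2
  rw [pairB_self hV] at r1
  have hp := h.p_ne_zero hs
  have hp' := h.p'_ne_zero hs
  have hsc : ∀ᶠ e in 𝓝 E, sinSol V e 1 ≠ 0 :=
    (differentiable_sinSol hV 1).continuous.continuousAt.eventually_ne hs
  have hP : ∀ᶠ e in 𝓝 E, ∀ x : Icc (0 : ℝ) 1, blochP V k 1 x e = (p e)⁻¹ * φ e x := by
    filter_upwards [hsc, h.eventually] with e h1 h2 x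
    simp only [blochP, h2.blochPsi_one h1, φ, cellP, ContinuousMap.mul_apply, cellExp_apply,
      cellSol_apply hV, Units.val_one, Int.cast_one, one_mul, neg_mul]
    ring
  have hP' : ∀ x : Icc (0 : ℝ) 1, blochP V k (-1) x E = (p' E)⁻¹ * φ' E x := fun x => by
    simp only [blochP, h.blochPsi_neg_one hs, φ', cellP, ContinuousMap.mul_apply, cellExp_apply,
      cellSol_apply hV, Units.val_one, Units.val_neg, Int.cast_neg, Int.cast_one, one_mul, neg_mul,
      neg_neg]
    ring
  have hdP : ∀ x : Icc (0 : ℝ) 1, deriv (fun e => blochP V k 1 x e) E =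
      (p E)⁻¹ * deriv φ E x - deriv p E / p E ^ 2 * φ E x := fun x => by
    have h1 : HasDerivAt (fun e => φ e x) (deriv φ E x) E :=
      (cellEval x).hasFDerivAt.comp_hasDerivAt E hφ.differentiableAt.hasDerivAt
    have h2 := (h.p_an.differentiableAt.hasDerivAt.inv hp).mul h1
    rw [(h2.congr_of_eventuallyEq (hP.mono fun e he => he x)).deriv]
    simp only [Pi.inv_apply]
    ring
  have hnum : (∫ x in (0 : ℝ)..1, blochP V k (-1) x E * deriv (fun e : ℂ => blochP V k 1 x e) E) =
      (p' E)⁻¹ * ((p E)⁻¹ * cellIntegral (φ' E * deriv φ E) - deriv p E / p E ^ 2 * α E) := by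
    rw [← cellIntegral_eq (F := (p' E)⁻¹ • ((p E)⁻¹ • (φ' E * deriv φ E) -
      (deriv p E / p E ^ 2) • (φ' E * φ E)))]
    · simp only [map_smul, map_sub, smul_eq_mul, α]
    · intro x
      rw [hP', hdP]
      simp only [ContinuousMap.smul_apply, ContinuousMap.sub_apply, ContinuousMap.mul_apply,
        smul_eq_mul]
      ring
  have hden : (∫ x in (0 : ℝ)..1, blochP V k 1 x E * blochP V k (-1) x E) =
      (p' E)⁻¹ * (p E)⁻¹ * α E := by
    rw [← cellIntegral_eq (F := ((p' E)⁻¹ * (p E)⁻¹) • (φ' E * φ E))]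
    · simp only [map_smul, smul_eq_mul, α]
    · intro x
      rw [hP', hP.self_of_nhds]
      simp only [ContinuousMap.smul_apply, ContinuousMap.mul_apply, smul_eq_mul]
      ring
  have hI := Complex.I_ne_zero
  have hw := h.indep
  rw [blochG, hnum, hden, r1, r2]
  generalize p' E * q E - q' E * p E = w at hw
  field_simp
  ring

end BlochFrame

end Frame

end

/-! ### Local canonical families -/

section

open MeasureTheory intervalIntegral Set

section LocalSection

variable {V : ℝ → ℝ}

/-- A function `h` with `h'/h = k''/(2k') + g` has the form `√(ε k') exp (∫ g)`. -/
lemma exists_sqrt_mul_exp {h κ g : ℂ → ℂ} {z ε : ℂ} (hε : ε ≠ 0) (hh : AnalyticAt ℂ h z)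
    (hh0 : h z ≠ 0) (hκ : AnalyticAt ℂ κ z) (hκ0 : κ z ≠ 0)
    (hg : ∀ᶠ e in 𝓝 z, g e = deriv h e / h e - deriv κ e / (2 * κ e)) :
    ∃ q G : ℂ → ℂ, AnalyticAt ℂ q z ∧ (∀ᶠ e in 𝓝 z, q e ^ 2 = ε * κ e) ∧
      (∀ᶠ e in 𝓝 z, HasDerivAt G (g e) e) ∧ ∀ᶠ e in 𝓝 z, h e = q e * Complex.exp (G e) := by
  obtain ⟨l, hl, hle⟩ := exists_local_log (f := fun e => ε * κ e) (analyticAt_const.mul hκ)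
    (mul_ne_zero hε hκ0)
  obtain ⟨m, hm, hme⟩ := exists_local_log hh hh0
  refine ⟨fun e => Complex.exp (l e / 2), fun e => m e - l e / 2, (hl.div_const).cexp, ?_, ?_, ?_⟩
  · filter_upwards [hle] with e he
    rw [← he, ← Complex.exp_nat_mul]
    congr 1
    push_cast; ring
  · filter_upwards [hg, hl.eventually_analyticAt, hm.eventually_analyticAt,
      hh.eventually_analyticAt, hκ.eventually_analyticAt, hle.eventually_nhds,
      hme.eventually_nhds, hκ.continuousAt.eventually_ne hκ0] with e h1 h2 h3 h4 h5 h6 h7 h8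
    have d1 := (h2.differentiableAt.hasDerivAt.cexp).unique
      (((h5.differentiableAt.hasDerivAt).const_mul ε).congr_of_eventuallyEq h6)
    have d2 := (h3.differentiableAt.hasDerivAt.cexp).unique
      ((h4.differentiableAt.hasDerivAt).congr_of_eventuallyEq h7)
    refine (h3.differentiableAt.hasDerivAt.sub
      (h2.differentiableAt.hasDerivAt.div_const 2)).congr_deriv ?_
    rw [h1, ← d2, h7.self_of_nhds.symm]
    rw [h6.self_of_nhds] at d1
    have h9 : deriv l e = deriv κ e / κ e := by
      rw [eq_div_iff h8]
      apply mul_left_cancel₀ hε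
      linear_combination d1
    rw [h9, mul_div_cancel_left₀ _ (Complex.exp_ne_zero _)]
    field_simp
  · filter_upwards [hme] with e he
    rw [← he, ← Complex.exp_add]
    congr 1
    ring

lemma IsEigenvector.isBlochSolution (hV : ∀ x y, IntervalIntegrable V volume x y)
    (hper : Function.Periodic V 1) {E lam p q : ℂ} (h : IsEigenvector V E lam p q)
    (hpq : p ≠ 0 ∨ q ≠ 0) :
    IsBlochSolution V E lam (fun x => p * cosSol V E x + q * sinSol V E x) := by
  have hsol := comb_isSolution hV E p q
  have hd := BlochFrame.data hV h
  refine ⟨hsol, fun h0 => ?_, fun x => hsol.floquet hV hper hd.1 hd.2 x⟩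
  have g0 := congrFun h0 0
  have g1 := deriv_comb hV E p q 0
  rw [h0] at g1
  simp [cosSol_zero hV, deriv_cosSol_zero hV, sinSol_zero hV, deriv_sinSol_zero hV] at g0 g1
  exact hpq.elim (fun h => h g0) fun h => h g1.symm

/-- With `e^{ik}` also `e^{-ik}` is a Floquet multiplier. -/
lemma eventually_isFloquetMultiplier_neg (hV : ∀ x y, IntervalIntegrable V volume x y)
    (hper : Function.Periodic V 1) {E₀ : ℂ} {k : ℂ → ℂ} (hk : AnalyticAt ℂ k E₀)
    (hmul : ∀ᶠ e in 𝓝 E₀, IsFloquetMultiplier V e (Complex.exp (Complex.I * k e))) :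
    ∀ᶠ e in 𝓝 E₀, IsFloquetMultiplier V e (Complex.exp (Complex.I * -k e)) := by
  obtain ⟨p, q, p', q', hfr⟩ := exists_blochFrame hV hk hmul
  filter_upwards [hfr.eventually] with e he
  rw [mul_neg]
  refine ⟨_, he.eig'.self_of_nhds.isBlochSolution hV hper ?_⟩
  by_contra! h
  exact he.indep (by rw [h.1, h.2]; ring)

/-- Near every energy that is not a branching point there is an analytic family of Bloch solutions
which has the canonical form wherever that form has a direct meaning. It is
`exp (-∫ diagB / w)` times the first solution of a frame with Wronskian `w`. The constant `ε` gives
the choice of the square root for either sign of the quasi-momentum. -/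
theorem exists_local_section (hV : ∀ x y, IntervalIntegrable V volume x y)
    (hper : Function.Periodic V 1) {E₀ ε : ℂ} (hε : ε ≠ 0) {k : ℂ → ℂ} (hk : AnalyticAt ℂ k E₀)
    (hmul : ∀ᶠ e in 𝓝 E₀, IsFloquetMultiplier V e (Complex.exp (Complex.I * k e))) :
    ∃ F : ℝ → ℂ → ℂ, ∀ᶠ E in 𝓝 E₀, (∀ u, AnalyticAt ℂ (F u) E) ∧
      IsBlochSolution V E (Complex.exp (Complex.I * k E)) (fun u => F u E) ∧
      (sinSol V E 1 ≠ 0 → deriv k E ≠ 0 → ∃ q G : ℂ → ℂ, AnalyticAt ℂ q E ∧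
        (∀ᶠ e in 𝓝 E, q e ^ 2 = ε * deriv k e) ∧
        (∀ᶠ e in 𝓝 E, HasDerivAt G (blochG V k 1 e) e) ∧
        ∀ᶠ e in 𝓝 E, ∀ u, F u e = q e * Complex.exp (G e) * blochPsi V k 1 u e) := by
  obtain ⟨p, q, p', q', hfr⟩ := exists_blochFrame hV hk hmul
  set w : ℂ → ℂ := fun E => p' E * q E - q' E * p E
  have hw : AnalyticAt ℂ w E₀ := (hfr.p'_an.mul hfr.q_an).sub (hfr.q'_an.mul hfr.p_an)
  obtain ⟨L, hL, hLd⟩ := exists_local_primitive ((hfr.analyticAt_diagB hV).div hw hfr.indep)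
  refine ⟨fun u e => Complex.exp (-L e) * (p e * cosSol V e u + q e * sinSol V e u), ?_⟩
  filter_upwards [hfr.eventually, hL.eventually_analyticAt, hLd.eventually_nhds] with E h1 h2 h3
  refine ⟨fun u => ?_, ?_, fun hs hk' => ?_⟩
  · exact (h2.neg.cexp).mul ((h1.p_an.mul ((differentiable_cosSol hV u).analyticAt E)).add
      (h1.q_an.mul ((differentiable_sinSol hV u).analyticAt E)))
  · have he : (fun x => Complex.exp (-L E) * p E * cosSol V E x +
        Complex.exp (-L E) * q E * sinSol V E x) =
        fun u => Complex.exp (-L E) * (p E * cosSol V E u + q E * sinSol V E u) := by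
      funext u; ring
    have hv : IsEigenvector V E (Complex.exp (Complex.I * k E)) (Complex.exp (-L E) * p E)
        (Complex.exp (-L E) * q E) := by
      obtain ⟨e1, e2⟩ := h1.eig.self_of_nhds
      exact ⟨by linear_combination Complex.exp (-L E) * e1,
        by linear_combination Complex.exp (-L E) * e2⟩
    rw [← he]
    refine hv.isBlochSolution hV hper ?_
    by_contra! h
    have hexp := Complex.exp_ne_zero (-L E)
    exact h1.indep (by
      rw [(mul_eq_zero.1 h.1).resolve_left hexp, (mul_eq_zero.1 h.2).resolve_left hexp]; ring)
  · have hp0 := h1.p_ne_zero hs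
    have hh : AnalyticAt ℂ (fun e => Complex.exp (-L e) * p e) E := h2.neg.cexp.mul h1.p_an
    have hsc : ∀ᶠ e in 𝓝 E, sinSol V e 1 ≠ 0 :=
      (differentiable_sinSol hV 1).continuous.continuousAt.eventually_ne hs
    obtain ⟨s, G, hs1, hs2, hs3, hs4⟩ := exists_sqrt_mul_exp (κ := deriv k) (g := blochG V k 1) hε hh
      (mul_ne_zero (Complex.exp_ne_zero _) hp0) h1.k_an.deriv hk' (by
        filter_upwards [h1.eventually, hsc, h1.k_an.deriv.continuousAt.eventually_ne hk', h3]
          with e g1 g2 g3 g4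
        have g5 := g1.p_ne_zero g2
        have hd : deriv (fun e => Complex.exp (-L e) * p e) e =
            Complex.exp (-L e) * -(diagB V k p q p' q' e / (p' e * q e - q' e * p e)) * p e +
              Complex.exp (-L e) * deriv p e :=
          (g4.neg.cexp.mul g1.p_an.differentiableAt.hasDerivAt).deriv
        have hexp := Complex.exp_ne_zero (-L e)
        have hw := g1.indep
        rw [g1.blochG_eq hV g2 g3, hd]
        generalize p' e * q e - q' e * p e = w at hw
        field_simp
        ring)
    refine ⟨s, G, hs1, hs2, hs3, ?_⟩
    filter_upwards [hs4, h1.eventually, hsc] with e g1 g2 g3 u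
    have g5 := g2.p_ne_zero g3
    rw [g2.blochPsi_one g3, ← g1]
    field_simp

end LocalSection

end

/-! ### Connectedness and gluing -/

section

open Set

section Connectedness

lemma isPreconnected_punctured_ball (c : ℂ) (r : ℝ) :
    IsPreconnected (Metric.ball c r \ {c}) := by
  rcases le_or_gt r 0 with hr | hr
  · rw [Metric.ball_eq_empty.2 hr, empty_sdiff]; exact isPreconnected_empty
  have h1 : IsPreconnected {z : ℂ | z.re < Real.log r} :=
    (convex_halfSpace_re_lt (Real.log r)).isPreconnected
  have h2 := h1.image (fun z => c + Complex.exp z) (by fun_prop)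
  convert h2 using 1
  ext z
  simp only [Set.mem_sdiff, Metric.mem_ball, mem_singleton_iff, mem_image, mem_ofPred_eq]
  constructor
  · rintro ⟨hz, hne⟩
    have hne' : z - c ≠ 0 := sub_ne_zero.2 hne
    refine ⟨Complex.log (z - c), ?_, by rw [Complex.exp_log hne']; ring⟩
    rw [Complex.log_re]
    exact Real.log_lt_log (norm_pos_iff.2 hne') (by rwa [← dist_eq_norm])
  · rintro ⟨w, hw, rfl⟩
    refine ⟨?_, by simp [Complex.exp_ne_zero]⟩
    rw [dist_eq_norm, add_sub_cancel_left, Complex.norm_exp]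
    exact (Real.lt_log_iff_exp_lt hr).1 hw

lemma eq_of_locally_const {T : Set ℂ} (hT : IsPreconnected T) {f : ℂ → ℂ}
    (hf : ∀ x ∈ T, ∀ᶠ z in 𝓝 x, f z = f x) {x y : ℂ} (hx : x ∈ T) (hy : y ∈ T) : f x = f y := by
  have ha : AnalyticOnNhd ℂ f T := fun z hz => analyticAt_const.congr (EventuallyEq.symm (hf z hz))
  exact (ha.eqOn_of_preconnected_of_eventuallyEq (g := fun _ => f x)
    (fun _ _ => analyticAt_const) hT hx (hf x hx) hy).symm

/-- A function that is locally constant off a set of isolated points is constant there: its values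
on a punctured disc are all equal, hence it extends to a locally constant function. -/
lemma eq_of_locally_const_off_isolated {D S : Set ℂ} (hD : IsPreconnected D) (hSD : S ⊆ D)
    (hS : ∀ z ∈ D, ∀ᶠ w in 𝓝[≠] z, w ∈ S) {f : ℂ → ℂ}
    (hf : ∀ x ∈ S, ∀ᶠ z in 𝓝 x, f z = f x) {x y : ℂ} (hx : x ∈ S) (hy : y ∈ S) : f x = f y := by
  have h1 : ∀ z ∈ D, ∃ a, ∀ᶠ w in 𝓝[≠] z, f w = a := fun z hz => by
    obtain ⟨r, hr, hball⟩ := Metric.mem_nhdsWithin_iff.1 (hS z hz)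
    have hne : ∃ w, w ∈ Metric.ball z r \ {z} := by
      refine ⟨z + (r / 2 : ℝ), ?_, ?_⟩
      · rw [Metric.mem_ball, dist_eq_norm, add_sub_cancel_left, Complex.norm_real,
          Real.norm_of_nonneg (by positivity)]
        linarith
      · simp [hr.ne']
    obtain ⟨w₀, hw₀⟩ := hne
    refine ⟨f w₀, ?_⟩
    filter_upwards [sdiff_mem_nhdsWithin_compl (Metric.ball_mem_nhds z hr) {z}] with w hw
    exact eq_of_locally_const (isPreconnected_punctured_ball z r)
      (fun u hu => hf u (hball ⟨hu.1, hu.2⟩)) hw hw₀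
  choose! a ha using h1
  have hSa : ∀ z ∈ S, f z = a z := fun z hz => by
    have h2 := ha z (hSD hz)
    have h3 : ∀ᶠ w in 𝓝[≠] z, f w = f z := (hf z hz).filter_mono nhdsWithin_le_nhds
    obtain ⟨w, h4, h5⟩ := (h2.and h3).exists
    rw [← h4, h5]
  rw [hSa x hx, hSa y hy]
  refine eq_of_locally_const (T := D) hD (fun z hz => ?_) (hSD hx) (hSD hy)
  have h6 : ∀ᶠ w in 𝓝[≠] z, a w = a z := by
    filter_upwards [ha z hz, hS z hz] with w h7 h8
    rw [← h7, hSa w h8]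
  rw [eventually_nhdsWithin_iff] at h6
  filter_upwards [h6] with w hw
  by_cases h : w = z
  · rw [h]
  · exact hw h

end Connectedness

section Gluing

/-- Local sections over discs that differ by the action of constants glue to a global section over a
simply connected domain. The transition constants define a principal bundle with discrete fibre
over `D`, that is, a covering, and a lift of the identity of `D` is a global section of it. -/
theorem exists_global_section {G M : Type*} [Group G] [MulAction G M] {D : Set ℂ} (hDo : IsOpen D)
    (hDs : IsSimplyConnected D) (r : ℂ → ℝ) (s : ℂ → ℂ → M)
    (hr : ∀ i ∈ D, 0 < r i)
    (hfree : ∀ i ∈ D, ∀ z ∈ Metric.ball i (r i), ∀ g : G, g • s i z = s i z → g = 1)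
    (hcomp : ∀ i ∈ D, ∀ j ∈ D, ∃ g : G, ∀ z ∈ Metric.ball i (r i) ∩ Metric.ball j (r j) ∩ D,
      s i z = g • s j z) :
    ∃ S : ℂ → M, ∀ i ∈ D, ∃ g : G, ∀ᶠ z in 𝓝 i, S z = g • s i z := by
  classical
  let : TopologicalSpace G := ⊥
  have : DiscreteTopology G := ⟨rfl⟩
  have hcomp' : ∀ i j : D, ∃ g : G, ∀ z ∈ Metric.ball i.1 (r i) ∩ Metric.ball j.1 (r j) ∩ D,
      s i z = g • s j z := fun i j => hcomp i i.2 j j.2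
  choose g hg using hcomp'
  -- coordinates are `s i = g i j • s j`, so a fibre element `v` over `z` stands for `v • s i z`
  let Z : FiberBundleCore D D G :=
    { baseSet := fun i => {x | x.1 ∈ Metric.ball i.1 (r i)}
      isOpen_baseSet := fun i => Metric.isOpen_ball.preimage continuous_subtype_val
      indexAt := id
      mem_baseSet_at := fun x => Metric.mem_ball_self (hr x x.2)
      coordChange := fun i j _ v => v * g i j
      coordChange_self := fun i x hx v => by
        have := hg i i x.1 ⟨⟨hx, hx⟩, x.2⟩
        rw [hfree i i.2 x hx _ this.symm, mul_one]
      continuousOn_coordChange := fun i j =>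
        ((continuous_of_discreteTopology (f := fun v : G => v * g i j)).comp
          continuous_snd).continuousOn
      coordChange_comp := fun i j k x hx v => by
        obtain ⟨⟨hi, hj⟩, hk⟩ := hx
        have h1 := hg i j x.1 ⟨⟨hi, hj⟩, x.2⟩
        have h2 := hg j k x.1 ⟨⟨hj, hk⟩, x.2⟩
        have h3 := hg i k x.1 ⟨⟨hi, hk⟩, x.2⟩
        have h4 : ((g i k)⁻¹ * (g i j * g j k)) • s k x = s k x := by
          rw [mul_smul, mul_smul, ← h2, ← h1, h3, inv_smul_smul]
        have h5 := hfree k k.2 x hk _ h4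
        rw [mul_assoc, inv_mul_eq_one.1 h5] }
  have := hDs.simplyConnectedSpace
  have : LocallyPathConnectedSpace D := hDo.locallyPathConnectedSpace
  have hcov : IsCoveringMap (Bundle.TotalSpace.proj : Bundle.TotalSpace G Z.Fiber → D) :=
    FiberBundle.isCoveringMap
  obtain ⟨z₀, hz₀⟩ := hDs.nonempty
  obtain ⟨σ, ⟨-, hσ⟩, -⟩ := hcov.existsUnique_continuousMap_lifts (ContinuousMap.id D) ⟨z₀, hz₀⟩
    (⟨⟨z₀, hz₀⟩, (1 : G)⟩ : Bundle.TotalSpace G Z.Fiber) rfl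
  have hσ' : ∀ y : D, (σ y).1 = y := fun y => congrFun hσ y
  let c : D → G := fun y => (σ y).2
  refine ⟨fun z => if h : z ∈ D then c ⟨z, h⟩ • s z z else s z₀ z₀, fun i hi => ?_⟩
  let i' : D := ⟨i, hi⟩
  have hmem : i' ∈ Z.baseSet i' := Z.mem_baseSet_at i'
  have hcont : ContinuousAt (fun y => (Z.localTriv i' (σ y)).2) i' := by
    have h1 : ContinuousAt (Z.localTriv i') (σ i') :=
      (Z.localTriv i').continuousAt (by
        rw [(Z.localTriv i').mem_source]
        change (σ i').1 ∈ Z.baseSet i'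
        rw [hσ']; exact hmem)
    exact (h1.comp σ.continuous.continuousAt).snd
  have hconst : ∀ᶠ y in 𝓝 i', c y * g y i' = c i' * g i' i' := by
    have h1 := (hcont (mem_nhds_discrete.2 (mem_singleton _)) :
      ∀ᶠ y in 𝓝 i', (Z.localTriv i' (σ y)).2 ∈ ({(Z.localTriv i' (σ i')).2} : Set G))
    filter_upwards [h1] with y hy
    have h2 : ∀ y, (Z.localTriv i' (σ y)).2 = c y * g (σ y).1 i' := fun y => rfl
    have hy : (Z.localTriv i' (σ y)).2 = (Z.localTriv i' (σ i')).2 := hy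
    rw [h2, h2, hσ', hσ'] at hy
    exact hy
  refine ⟨c i' * g i' i', ?_⟩
  rw [nhds_subtype_eq_comap] at hconst
  obtain ⟨t, ht, hts⟩ := hconst
  filter_upwards [ht, hDo.mem_nhds hi, Metric.ball_mem_nhds i (hr i hi)] with z h1 h2 h3
  rw [dif_pos h2, ← hts (show (⟨z, h2⟩ : D) ∈ _ from h1), mul_smul,
    ← hg ⟨z, h2⟩ i' z ⟨⟨Metric.mem_ball_self (hr z h2), h3⟩, h2⟩]

end Gluing

end

/-! ### Branches of the complex momentum -/

section

open MeasureTheory intervalIntegral Set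

section Momentum

variable {V : ℝ → ℝ} {W κ : ℂ → ℂ} {E φ₀ : ℂ} {D : Set ℂ}

lemma not_eventually_eq_const (hD : IsPreconnected D) (hW : AnalyticOnNhd ℂ W D)
    (hWc : ¬ ∃ c : ℂ, ∀ φ ∈ D, W φ = c) (E : ℂ) (hφ : φ₀ ∈ D) :
    ¬ ∀ᶠ z in 𝓝 φ₀, E - W z = E - W φ₀ := fun h =>
  hWc ⟨W φ₀, fun _ hz => hW.eqOn_of_preconnected_of_eventuallyEq (g := fun _ => W φ₀)
    (fun _ _ => analyticAt_const) hD hφ (h.mono fun _ h => sub_right_injective h) hz⟩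

/-- The energy `E - W` is an open map. -/
lemma nhds_le_map_energy (hD : IsPreconnected D) (hW : AnalyticOnNhd ℂ W D)
    (hWc : ¬ ∃ c : ℂ, ∀ φ ∈ D, W φ = c) (E : ℂ) (hφ : φ₀ ∈ D) :
    𝓝 (E - W φ₀) ≤ map (fun z => E - W z) (𝓝 φ₀) :=
  ((analyticAt_const.sub (hW φ₀ hφ)).eventually_constant_or_nhds_le_map_nhds).resolve_left
    (not_eventually_eq_const hD hW hWc E hφ)

lemma tendsto_energy_punctured (hD : IsPreconnected D) (hW : AnalyticOnNhd ℂ W D)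
    (hWc : ¬ ∃ c : ℂ, ∀ φ ∈ D, W φ = c) (E : ℂ) (hφ : φ₀ ∈ D) :
    Tendsto (fun z => E - W z) (𝓝[≠] φ₀) (𝓝[≠] (E - W φ₀)) := by
  have ha : AnalyticAt ℂ (fun z => E - W z) φ₀ := analyticAt_const.sub (hW φ₀ hφ)
  refine tendsto_nhdsWithin_iff.2 ⟨ha.continuousAt.tendsto.mono_left nhdsWithin_le_nhds, ?_⟩
  exact (ha.eventually_eq_or_eventually_ne analyticAt_const).resolve_left
    (not_eventually_eq_const hD hW hWc E hφ)

lemma eventually_ne_of_entire {f : ℂ → ℂ} (hf : Differentiable ℂ f) {c : ℂ} {z : ℂ}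
    (hz : f z ≠ c) (E₀ : ℂ) : ∀ᶠ e in 𝓝[≠] E₀, f e ≠ c := by
  refine ((hf.analyticAt E₀).eventually_eq_or_eventually_ne analyticAt_const).resolve_left
    fun h => hz ?_
  exact congrFun (AnalyticOnNhd.eq_of_eventuallyEq (f := f) (g := fun _ => c)
    (fun x _ => hf.analyticAt x) (fun _ _ => analyticAt_const) h) z

lemma eventually_const_of_hasDerivAt_zero {f : ℂ → ℂ} {z : ℂ}
    (h : ∀ᶠ e in 𝓝 z, HasDerivAt f 0 e) : ∀ᶠ e in 𝓝 z, f e = f z := by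
  obtain ⟨r, hr, hball⟩ := Metric.mem_nhds_iff.1 h
  filter_upwards [Metric.ball_mem_nhds z hr] with e he
  refine Metric.isOpen_ball.is_const_of_deriv_eq_zero (convex_ball z r).isPreconnected
    (fun x hx => (hball hx).differentiableAt.differentiableWithinAt)
    (fun x hx => (hball hx).deriv) he (Metric.mem_ball_self hr)

lemma eventually_discr_ne (hV : ∀ x y, IntervalIntegrable V volume x y) (c E₀ : ℂ) :
    ∀ᶠ e in 𝓝[≠] E₀, discr V e ≠ c := by
  obtain ⟨z, hz⟩ := not_forall.1 (discr_not_const hV c)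
  exact eventually_ne_of_entire (differentiable_discr hV) hz E₀

lemma eventually_eq_zero_of_exp_eq_one {f : ℂ → ℂ} (hf : ContinuousAt f φ₀) (h0 : f φ₀ = 0)
    (h1 : ∀ᶠ z in 𝓝 φ₀, Complex.exp (Complex.I * f z) = 1) : ∀ᶠ z in 𝓝 φ₀, f z = 0 := by
  have h2 : ∀ᶠ z in 𝓝 φ₀, ‖f z‖ < 1 := hf.norm.eventually_lt_const (by simp [h0])
  filter_upwards [h1, h2] with z h3 h4
  have h5 : |(Complex.I * f z).im| < 1 := by
    refine (Complex.abs_im_le_norm _).trans_lt ?_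
    rwa [norm_mul, Complex.norm_I, one_mul]
  have h6 := abs_lt.1 h5
  have h7 := Complex.log_exp (x := Complex.I * f z) (by linarith [Real.pi_gt_three])
    (by linarith [Real.pi_gt_three])
  rw [h3, Complex.log_one] at h7
  exact (mul_eq_zero.1 h7.symm).resolve_left Complex.I_ne_zero

/-- Near a point whose energy is not a branching point, a continuous branch of the complex momentum
comes from an analytic branch of the quasi-momentum. The two Floquet multipliers are the roots of a
quadratic equation and are distinct on a punctured disc, which is connected. -/
theorem exists_isLocalBranch (hV : ∀ x y, IntervalIntegrable V volume x y)
    (hW : AnalyticAt ℂ W φ₀)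
    (hne : Tendsto (fun z => E - W z) (𝓝[≠] φ₀) (𝓝[≠] (E - W φ₀)))
    (hbr : ¬ IsBranchPoint V (E - W φ₀)) (hκ : ∀ᶠ φ in 𝓝 φ₀, ContinuousAt κ φ)
    (hmul : ∀ᶠ φ in 𝓝 φ₀, IsFloquetMultiplier V (E - W φ) (Complex.exp (Complex.I * κ φ))) :
    ∃ k, IsLocalBranch W E κ k φ₀ := by
  obtain ⟨k, hk, hkm⟩ := not_not.1 hbr
  have hω : ContinuousAt (fun z => E - W z) φ₀ := continuousAt_const.sub hW.continuousAt
  -- the branch agrees with `k` or `-k` up to a period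
  obtain ⟨k₁, hk₁, hexp⟩ : ∃ k₁ : ℂ → ℂ, AnalyticAt ℂ k₁ (E - W φ₀) ∧
      ∀ᶠ z in 𝓝[≠] φ₀, Complex.exp (Complex.I * κ z) = Complex.exp (Complex.I * k₁ (E - W z)) := by
    have hd : ∀ᶠ z in 𝓝[≠] φ₀, discr V (E - W z) ≠ 2 ∧ discr V (E - W z) ≠ -2 :=
      hne.eventually ((eventually_discr_ne hV 2 _).and (eventually_discr_ne hV (-2) _))
    obtain ⟨r, hr, hball⟩ := Metric.mem_nhds_iff.1 ((eventually_nhdsWithin_iff.1 hd).and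
      (hκ.and (hmul.and ((hω.eventually hkm).and ((hω.eventually hk.eventually_analyticAt).and
        hW.eventually_analyticAt)))))
    have hdc : Continuous (discr V) := (differentiable_discr hV).continuous
    have hωc : ContinuousOn (fun z => E - W z) (Metric.ball φ₀ r \ {φ₀}) := fun z hz => by
      obtain ⟨-, -, -, -, -, h6⟩ := hball hz.1
      exact (continuousAt_const.sub h6.continuousAt).continuousWithinAt
    have hsq : ∀ {e lam : ℂ}, IsFloquetMultiplier V e lam →
        (lam - discr V e / 2) ^ 2 = (discr V e / 2) ^ 2 - 1 := fun h => by
      linear_combination h.sq_add_one hV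
    have hdisj := (isPreconnected_punctured_ball φ₀ r).eq_or_eq_neg_of_sq_eq
      (f := fun z => Complex.exp (Complex.I * κ z) - discr V (E - W z) / 2)
      (g := fun z => Complex.exp (Complex.I * k (E - W z)) - discr V (E - W z) / 2)
      (by
        refine ContinuousOn.sub (fun z hz => ?_) ((hdc.comp_continuousOn hωc).div_const 2)
        obtain ⟨-, h2, -⟩ := hball hz.1
        exact (continuousAt_const.mul h2).cexp.continuousWithinAt)
      (by
        refine ContinuousOn.sub (fun z hz => ?_) ((hdc.comp_continuousOn hωc).div_const 2)
        obtain ⟨-, -, -, -, h5, h6⟩ := hball hz.1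
        exact (continuousAt_const.mul (ContinuousAt.comp (f := fun z => E - W z)
          h5.continuousAt (continuousAt_const.sub h6.continuousAt))).cexp.continuousWithinAt)
      (fun z hz => by
        obtain ⟨-, -, h3, h4, -⟩ := hball hz.1
        exact (hsq h3).trans (hsq h4).symm)
      (fun {z} hz h0 => by
        obtain ⟨h1, -, -, h4, -⟩ := hball hz.1
        have h5 := hsq h4
        rw [h0] at h5
        have h6 : (discr V (E - W z) - 2) * (discr V (E - W z) + 2) = 0 := by
          linear_combination -4 * h5
        rcases mul_eq_zero.1 h6 with h | h
        · exact (h1 hz.2).1 (by linear_combination h)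
        · exact (h1 hz.2).2 (by linear_combination h))
    have hmem : Metric.ball φ₀ r \ {φ₀} ∈ 𝓝[≠] φ₀ :=
      sdiff_mem_nhdsWithin_compl (Metric.ball_mem_nhds φ₀ hr) {φ₀}
    rcases hdisj with h | h
    · refine ⟨k, hk, ?_⟩
      filter_upwards [hmem] with z hz
      exact sub_left_injective (h hz)
    · refine ⟨fun e => -k e, hk.neg, ?_⟩
      filter_upwards [hmem] with z hz
      obtain ⟨-, -, -, h4, -⟩ := hball hz.1
      have h5 := h4.sq_add_one hV
      have h6 : Complex.exp (Complex.I * κ z) - discr V (E - W z) / 2 =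
        -(Complex.exp (Complex.I * k (E - W z)) - discr V (E - W z) / 2) := h hz
      rw [mul_neg, Complex.exp_neg]
      refine eq_inv_of_mul_eq_one_left ?_
      linear_combination Complex.exp (Complex.I * k (E - W z)) * h6 - h5
  have hκ₀ : ContinuousAt κ φ₀ := hκ.self_of_nhds
  have hk₁ω : ContinuousAt (fun z => k₁ (E - W z)) φ₀ :=
    ContinuousAt.comp (f := fun z => E - W z) hk₁.continuousAt hω
  have hexp₀ : Complex.exp (Complex.I * κ φ₀) = Complex.exp (Complex.I * k₁ (E - W φ₀)) := by
    refine tendsto_nhds_unique_of_eventuallyEq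
      ((continuousAt_const.mul hκ₀).cexp.tendsto.mono_left nhdsWithin_le_nhds)
      ((continuousAt_const.mul hk₁ω).cexp.tendsto.mono_left nhdsWithin_le_nhds) hexp
  refine ⟨fun e => k₁ e + (κ φ₀ - k₁ (E - W φ₀)), hk₁.add analyticAt_const, ?_⟩
  have h0 := eventually_eq_zero_of_exp_eq_one
    (f := fun z => κ z - (k₁ (E - W z) + (κ φ₀ - k₁ (E - W φ₀))))
    (hκ₀.sub (hk₁ω.add continuousAt_const)) (by ring) (by
      rw [eventually_nhdsWithin_iff] at hexp
      filter_upwards [hexp] with z hz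
      have hz' : Complex.exp (Complex.I * κ z) = Complex.exp (Complex.I * k₁ (E - W z)) := by
        by_cases h : z = φ₀
        · rw [h, hexp₀]
        · exact hz h
      rw [show Complex.I * (κ z - (k₁ (E - W z) + (κ φ₀ - k₁ (E - W φ₀)))) =
        Complex.I * κ z - Complex.I * k₁ (E - W z) -
          (Complex.I * κ φ₀ - Complex.I * k₁ (E - W φ₀)) by ring, Complex.exp_sub, Complex.exp_sub,
        Complex.exp_sub, hz', hexp₀, div_self (Complex.exp_ne_zero _),
        div_self (Complex.exp_ne_zero _), div_one])
  exact h0.mono fun z hz => sub_eq_zero.1 hz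

lemma IsLocalBranch.eventually {k : ℂ → ℂ} (hW : AnalyticAt ℂ W φ₀)
    (h : IsLocalBranch W E κ k φ₀) : ∀ᶠ φ in 𝓝 φ₀, IsLocalBranch W E κ k φ := by
  have hω : ContinuousAt (fun z => E - W z) φ₀ := continuousAt_const.sub hW.continuousAt
  filter_upwards [hω.eventually h.1.eventually_analyticAt, h.2.eventually_nhds] with φ h1 h2
  exact ⟨h1, h2⟩

lemma IsLocalBranch.eventuallyEq {k k' : ℂ → ℂ}
    (hω : 𝓝 (E - W φ₀) ≤ map (fun z => E - W z) (𝓝 φ₀)) (h : IsLocalBranch W E κ k φ₀)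
    (h' : IsLocalBranch W E κ k' φ₀) : k =ᶠ[𝓝 (E - W φ₀)] k' := by
  refine Eventually.filter_mono hω (eventually_map.2 ?_)
  filter_upwards [h.2, h'.2] with z h1 h2
  exact h1.symm.trans h2

lemma IsLocalBranch.eventually_isFloquetMultiplier {k : ℂ → ℂ}
    (hω : 𝓝 (E - W φ₀) ≤ map (fun z => E - W z) (𝓝 φ₀))
    (hmul : ∀ᶠ φ in 𝓝 φ₀, IsFloquetMultiplier V (E - W φ) (Complex.exp (Complex.I * κ φ)))
    (h : IsLocalBranch W E κ k φ₀) :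
    ∀ᶠ e in 𝓝 (E - W φ₀), IsFloquetMultiplier V e (Complex.exp (Complex.I * k e)) := by
  refine Eventually.filter_mono hω (eventually_map.2 ?_)
  filter_upwards [h.2, hmul] with z h1 h2
  rwa [h1] at h2

/-- An analytic branch of the quasi-momentum is not locally constant, because the discriminant is
not. -/
lemma eventually_deriv_ne_zero (hV : ∀ x y, IntervalIntegrable V volume x y) {E₀ : ℂ} {k : ℂ → ℂ}
    (hk : AnalyticAt ℂ k E₀)
    (hmul : ∀ᶠ e in 𝓝 E₀, IsFloquetMultiplier V e (Complex.exp (Complex.I * k e))) :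
    ∀ᶠ e in 𝓝[≠] E₀, deriv k e ≠ 0 := by
  refine (hk.deriv.eventually_eq_zero_or_eventually_ne_zero).resolve_left fun h0 => ?_
  have hconst : ∀ᶠ e in 𝓝 E₀, k e = k E₀ := by
    refine eventually_const_of_hasDerivAt_zero ?_
    filter_upwards [h0, hk.eventually_analyticAt] with e h1 h2
    exact h1 ▸ h2.differentiableAt.hasDerivAt
  have hd : ∀ᶠ e in 𝓝 E₀, discr V e = discr V E₀ := by
    filter_upwards [hconst, hmul] with e h1 h2
    have h3 := h2.sq_add_one hV
    have h4 := hmul.self_of_nhds.sq_add_one hV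
    rw [h1] at h3
    exact mul_right_cancel₀ (Complex.exp_ne_zero _) (h3.symm.trans h4)
  obtain ⟨e, h1, h2⟩ := ((eventually_discr_ne hV (discr V E₀) E₀).and
    (hd.filter_mono nhdsWithin_le_nhds)).exists
  exact h1 h2

/-- The non-regular points are isolated. -/
lemma eventually_mem_regularSet (hV : ∀ x y, IntervalIntegrable V volume x y) (hD : IsOpen D)
    (hφ : φ₀ ∈ D) (hW : AnalyticAt ℂ W φ₀)
    (hne : Tendsto (fun z => E - W z) (𝓝[≠] φ₀) (𝓝[≠] (E - W φ₀))) {k : ℂ → ℂ}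
    (hk : IsLocalBranch W E κ k φ₀)
    (hmul : ∀ᶠ e in 𝓝 (E - W φ₀), IsFloquetMultiplier V e (Complex.exp (Complex.I * k e))) :
    ∀ᶠ z in 𝓝[≠] φ₀, z ∈ regularSet V W E D κ := by
  have h1 := eventually_ne_of_entire (differentiable_sinSol hV 1)
    (sinSol_one_ne_zero hV (E := Complex.I) (by simp)) (E - W φ₀)
  filter_upwards [hne.eventually h1, hne.eventually (eventually_deriv_ne_zero hV hk.1 hmul),
    (hk.eventually hW).filter_mono nhdsWithin_le_nhds,
    mem_nhdsWithin_of_mem_nhds (hD.mem_nhds hφ)] with z g1 g2 g3 g4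
  exact ⟨g4, g1, k, g3, g2⟩

end Momentum

end

/-! ### Canonical Bloch solutions -/

section

open MeasureTheory intervalIntegral Set

section Sign

lemma blochPsi_mul (V : ℝ → ℝ) (k : ℂ → ℂ) (σ τ : ℤˣ) (u : ℝ) (e : ℂ) :
    blochPsi V k (σ * τ) u e = blochPsi V (fun e => ((σ : ℤ) : ℂ) * k e) τ u e := by
  have h : (((σ * τ : ℤˣ) : ℤ) : ℂ) * Complex.I * k e =
      ((τ : ℤ) : ℂ) * Complex.I * (((σ : ℤ) : ℂ) * k e) := by push_cast; ring
  simp only [blochPsi, h]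

lemma blochP_mul (V : ℝ → ℝ) (k : ℂ → ℂ) (σ τ : ℤˣ) (u : ℝ) (e : ℂ) :
    blochP V k (σ * τ) u e = blochP V (fun e => ((σ : ℤ) : ℂ) * k e) τ u e := by
  have h : (((σ * τ : ℤˣ) : ℤ) : ℂ) * Complex.I * k e =
      ((τ : ℤ) : ℂ) * Complex.I * (((σ : ℤ) : ℂ) * k e) := by push_cast; ring
  simp only [blochP, blochPsi_mul, h]

/-- The sign of a Bloch solution may be absorbed into the quasi-momentum. -/
lemma blochG_eq_one (V : ℝ → ℝ) (k : ℂ → ℂ) (σ : ℤˣ) (e : ℂ) :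
    blochG V k σ e = blochG V (fun e => ((σ : ℤ) : ℂ) * k e) 1 e := by
  have h1 : ∀ x e, blochP V (fun e => ((σ : ℤ) : ℂ) * k e) 1 x e = blochP V k σ x e :=
    fun x e => by rw [← blochP_mul, mul_one]
  have h2 : ∀ x e, blochP V (fun e => ((σ : ℤ) : ℂ) * k e) (-1) x e = blochP V k (-σ) x e :=
    fun x e => by rw [← blochP_mul, mul_neg_one]
  simp only [blochG, h1, h2]
  congr 1
  rcases Int.units_eq_one_or σ with rfl | rfl
  · rfl
  · simp only [neg_neg]
    congr 1
    funext x
    ring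

lemma blochPsi_zero {V : ℝ → ℝ} (hV : ∀ x y, IntervalIntegrable V volume x y) (k : ℂ → ℂ)
    (σ : ℤˣ) (e : ℂ) : blochPsi V k σ 0 e = 1 := by
  simp [blochPsi, cosSol_zero hV, sinSol_zero hV]

lemma blochG_congr {V : ℝ → ℝ} {k k' : ℂ → ℂ} {e : ℂ} (h : k =ᶠ[𝓝 e] k') (σ : ℤˣ) :
    blochG V k σ e = blochG V k' σ e := by
  have h1 : ∀ τ x, (fun e => blochP V k τ x e) =ᶠ[𝓝 e] fun e => blochP V k' τ x e := fun τ x => by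
    filter_upwards [h] with z hz
    simp only [blochP, blochPsi, hz]
  have h2 : ∀ τ x, blochP V k τ x e = blochP V k' τ x e := fun τ x => (h1 τ x).eq_of_nhds
  simp only [blochG, h2, fun τ x => (h1 τ x).deriv_eq]

end Sign

section Canonical

variable {V : ℝ → ℝ} {W κ : ℂ → ℂ} {E φ₀ : ℂ} {D : Set ℂ} {σ : ℤˣ} {Ψ Ψ' : ℝ → ℂ → ℂ}

/-- `Ψ` has the canonical form `√(k') exp (∫ g) ψ` near `φ₀`. -/
def CanonicalAt (V : ℝ → ℝ) (W : ℂ → ℂ) (E : ℂ) (κ : ℂ → ℂ) (σ : ℤˣ) (Ψ : ℝ → ℂ → ℂ)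
    (φ₀ : ℂ) : Prop :=
  ∃ k q G : ℂ → ℂ,
    IsLocalBranch W E κ k φ₀ ∧
    AnalyticAt ℂ q (E - W φ₀) ∧ (∀ᶠ 𝓔 in 𝓝 (E - W φ₀), q 𝓔 ^ 2 = deriv k 𝓔) ∧
    (∀ᶠ 𝓔 in 𝓝 (E - W φ₀), HasDerivAt G (blochG V k σ 𝓔) 𝓔) ∧
    ∀ᶠ φ in 𝓝 φ₀, ∀ u : ℝ,
      Ψ u φ = q (E - W φ) * Complex.exp (G (E - W φ)) * blochPsi V k σ u (E - W φ)

lemma CanonicalAt.smul (h : CanonicalAt V W E κ σ Ψ φ₀) {c : ℂ} (hc : c ≠ 0)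
    (hΨ : ∀ᶠ φ in 𝓝 φ₀, ∀ u, Ψ' u φ = c * Ψ u φ) : CanonicalAt V W E κ σ Ψ' φ₀ := by
  obtain ⟨k, q, G, hk, hq, hqk, hG, hf⟩ := h
  -- the constant is absorbed into the primitive of `g`
  refine ⟨k, q, fun e => G e + Complex.log c, hk, hq, hqk, hG.mono fun e he => he.add_const _, ?_⟩
  filter_upwards [hf, hΨ] with φ h1 h2 u
  rw [h2, h1, Complex.exp_add, Complex.exp_log hc]
  ring

lemma IsLocalBranch.deriv_ne_zero
    (hω : 𝓝 (E - W φ₀) ≤ map (fun z => E - W z) (𝓝 φ₀)) (hreg : φ₀ ∈ regularSet V W E D κ)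
    {k : ℂ → ℂ} (hk : IsLocalBranch W E κ k φ₀) : deriv k (E - W φ₀) ≠ 0 := by
  obtain ⟨-, -, k', hk', hd⟩ := hreg
  rwa [(hk.eventuallyEq hω hk').deriv_eq]

lemma CanonicalAt.apply_zero_ne_zero (hV : ∀ x y, IntervalIntegrable V volume x y)
    (hω : 𝓝 (E - W φ₀) ≤ map (fun z => E - W z) (𝓝 φ₀)) (hreg : φ₀ ∈ regularSet V W E D κ)
    (h : CanonicalAt V W E κ σ Ψ φ₀) : Ψ 0 φ₀ ≠ 0 := by
  obtain ⟨k, q, G, hk, -, hqk, -, hf⟩ := h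
  have hd := hk.deriv_ne_zero hω hreg
  rw [← hqk.self_of_nhds] at hd
  rw [hf.self_of_nhds, blochPsi_zero hV, mul_one]
  exact mul_ne_zero (fun h => hd (by rw [h]; ring)) (Complex.exp_ne_zero _)

/-- Two canonical forms differ by the choice of the square root and of the primitive. -/
lemma CanonicalAt.exists_const (hW : ContinuousAt W φ₀)
    (hω : 𝓝 (E - W φ₀) ≤ map (fun z => E - W z) (𝓝 φ₀)) (hreg : φ₀ ∈ regularSet V W E D κ)
    (h : CanonicalAt V W E κ σ Ψ φ₀) (h' : CanonicalAt V W E κ σ Ψ' φ₀) :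
    ∃ c : ℂ, ∀ᶠ φ in 𝓝 φ₀, ∀ u, Ψ' u φ = c * Ψ u φ := by
  obtain ⟨k, q, G, hk, hq, hqk, hG, hf⟩ := h
  obtain ⟨k', q', G', hk', hq', hqk', hG', hf'⟩ := h'
  have hd := hk.deriv_ne_zero hω hreg
  have hkk := hk.eventuallyEq hω hk'
  have hq0 : q (E - W φ₀) ≠ 0 := fun h => hd (by rw [← hqk.self_of_nhds, h]; ring)
  obtain ⟨ε, hε⟩ : ∃ ε : ℂ, ∀ᶠ e in 𝓝 (E - W φ₀), q' e = ε * q e := by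
    have hsq : ∀ᶠ e in 𝓝 (E - W φ₀), q' e ^ 2 = q e ^ 2 := by
      filter_upwards [hqk, hqk', hkk.eventuallyEq_nhds] with e h1 h2 h3
      rw [h1, h2, h3.deriv_eq]
    -- the sign with which the roots agree at the base point
    obtain ⟨ε, hε2, hε⟩ : ∃ ε : ℂ, ε ^ 2 = 1 ∧ q' (E - W φ₀) = ε * q (E - W φ₀) := by
      rcases sq_eq_sq_iff_eq_or_eq_neg.1 hsq.self_of_nhds with h | h
      · exact ⟨1, by norm_num, by rw [h, one_mul]⟩
      · exact ⟨-1, by norm_num, by rw [h, neg_one_mul]⟩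
    refine ⟨ε, ?_⟩
    have hne : ∀ᶠ e in 𝓝 (E - W φ₀), q' e + ε * q e ≠ 0 := by
      refine (hq'.continuousAt.add (continuousAt_const.mul hq.continuousAt)).eventually_ne ?_
      have hε0 : ε ≠ 0 := by rintro rfl; norm_num at hε2
      rw [Pi.add_apply, Pi.mul_apply, hε, ← two_mul]
      exact mul_ne_zero two_ne_zero (mul_ne_zero hε0 hq0)
    filter_upwards [hsq, hne] with e h1 h2
    refine sub_eq_zero.1 ((mul_eq_zero.1 ?_).resolve_left h2)
    linear_combination h1 - q e ^ 2 * hε2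
  have hGG : ∀ᶠ e in 𝓝 (E - W φ₀), G' e - G e = G' (E - W φ₀) - G (E - W φ₀) := by
    refine eventually_const_of_hasDerivAt_zero (f := fun e => G' e - G e) ?_
    filter_upwards [hG, hG', hkk.eventuallyEq_nhds] with e h1 h2 h3
    have h4 := h2.sub h1
    rwa [blochG_congr h3, sub_self] at h4
  have hωc : ContinuousAt (fun z => E - W z) φ₀ := continuousAt_const.sub hW
  refine ⟨ε * Complex.exp (G' (E - W φ₀) - G (E - W φ₀)), ?_⟩
  filter_upwards [hf, hf', hωc.eventually hε, hωc.eventually hGG, hωc.eventually hkk]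
    with φ h1 h2 h3 h4 h5 u
  have h6 : G' (E - W φ) = G' (E - W φ₀) - G (E - W φ₀) + G (E - W φ) := by rw [← h4]; ring
  rw [h1, h2, h3, h6, Complex.exp_add, blochPsi, blochPsi, h5]
  ring

/-- Two functions which have the canonical form at the regular points of a connected open set differ
by a constant there: their quotient is locally constant off a set of isolated points. -/
lemma exists_const_of_canonicalAt (hV : ∀ x y, IntervalIntegrable V volume x y)
    (hW : AnalyticOnNhd ℂ W D)
    (hω : ∀ φ ∈ D, 𝓝 (E - W φ) ≤ map (fun z => E - W z) (𝓝 φ))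
    (hreg : ∀ φ ∈ D, ∀ᶠ z in 𝓝[≠] φ, z ∈ regularSet V W E D κ) {U : Set ℂ} (hUo : IsOpen U)
    (hU : IsPreconnected U) (hUD : U ⊆ D)
    (h : ∀ φ ∈ U, φ ∈ regularSet V W E D κ → CanonicalAt V W E κ σ Ψ φ)
    (h' : ∀ φ ∈ U, φ ∈ regularSet V W E D κ → CanonicalAt V W E κ σ Ψ' φ) :
    ∃ c : ℂ, c ≠ 0 ∧ ∀ φ ∈ U, φ ∈ regularSet V W E D κ → ∀ u, Ψ' u φ = c * Ψ u φ := by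
  set S := U ∩ regularSet V W E D κ
  have hS : ∀ z ∈ U, ∀ᶠ w in 𝓝[≠] z, w ∈ S := fun z hz =>
    inter_mem (mem_nhdsWithin_of_mem_nhds (hUo.mem_nhds hz)) (hreg z (hUD hz))
  have hne : ∀ z ∈ S, Ψ 0 z ≠ 0 := fun z hz =>
    (h z hz.1 hz.2).apply_zero_ne_zero hV (hω z (hUD hz.1)) hz.2
  have hne' : ∀ z ∈ S, Ψ' 0 z ≠ 0 := fun z hz =>
    (h' z hz.1 hz.2).apply_zero_ne_zero hV (hω z (hUD hz.1)) hz.2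
  have hloc : ∀ x ∈ S, ∃ c : ℂ, ∀ᶠ φ in 𝓝 x, ∀ u, Ψ' u φ = c * Ψ u φ := fun x hx =>
    (h x hx.1 hx.2).exists_const (hW x (hUD hx.1)).continuousAt (hω x (hUD hx.1)) hx.2
      (h' x hx.1 hx.2)
  have hconst : ∀ x ∈ S, ∀ y ∈ S, Ψ' 0 x / Ψ 0 x = Ψ' 0 y / Ψ 0 y := fun x hx y hy => by
    refine eq_of_locally_const_off_isolated hU inter_subset_left hS
      (f := fun z => Ψ' 0 z / Ψ 0 z) (fun z hz => ?_) hx hy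
    obtain ⟨c, hc⟩ := hloc z hz
    have hzS : ∀ᶠ w in 𝓝 z, w ∈ S := by
      filter_upwards [eventually_nhdsWithin_iff.1 (hS z hz.1)] with w hw
      by_cases hwz : w = z
      · rwa [hwz]
      · exact hw hwz
    filter_upwards [hc, hzS] with w h1 h2
    rw [h1, hc.self_of_nhds, mul_div_cancel_right₀ _ (hne w h2), mul_div_cancel_right₀ _ (hne z hz)]
  rcases S.eq_empty_or_nonempty with hemp | ⟨x₀, hx₀⟩
  · exact ⟨1, one_ne_zero, fun φ h1 h2 => absurd (hemp ▸ ⟨h1, h2⟩ : φ ∈ (∅ : Set ℂ)) (by simp)⟩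
  · refine ⟨Ψ' 0 x₀ / Ψ 0 x₀, div_ne_zero (hne' x₀ hx₀) (hne x₀ hx₀), fun φ h1 h2 u => ?_⟩
    obtain ⟨c, hc⟩ := hloc φ ⟨h1, h2⟩
    rw [hconst x₀ hx₀ φ ⟨h1, h2⟩, hc.self_of_nhds 0,
      mul_div_cancel_right₀ _ (hne φ ⟨h1, h2⟩), hc.self_of_nhds]

lemma IsBlochSolution.const_mul {e lam c : ℂ} {ψ ψ' : ℝ → ℂ}
    (hV : ∀ x y, IntervalIntegrable V volume x y) (h : IsBlochSolution V e lam ψ) (hc : c ≠ 0)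
    (hψ : ∀ u, ψ' u = c * ψ u) : IsBlochSolution V e lam ψ' := by
  have he : ψ' = fun u => c * ψ u + 0 * ψ u := funext fun u => by rw [hψ]; ring
  refine ⟨he ▸ h.1.linear_comb hV h.1 c 0, fun h0 => h.2.1 (funext fun u => ?_), fun x => ?_⟩
  · exact (mul_eq_zero.1 ((hψ u).symm.trans (congrFun h0 u))).resolve_left hc
  · rw [hψ, hψ, h.2.2]
    ring

/-- Near every point of `D` there is a canonical Bloch solution with all the required properties. -/
theorem exists_canonical_near (hV : ∀ x y, IntervalIntegrable V volume x y)
    (hper : Function.Periodic V 1) (hD : IsOpen D) (hW : AnalyticOnNhd ℂ W D)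
    (hω : ∀ φ ∈ D, 𝓝 (E - W φ) ≤ map (fun z => E - W z) (𝓝 φ)) (hφ₀ : φ₀ ∈ D) {k : ℂ → ℂ}
    (hk : IsLocalBranch W E κ k φ₀)
    (hmul : ∀ᶠ e in 𝓝 (E - W φ₀), IsFloquetMultiplier V e (Complex.exp (Complex.I * k e)))
    (σ : ℤˣ) :
    ∃ s : ℝ → ℂ → ℂ, ∀ᶠ φ in 𝓝 φ₀, (∀ u, AnalyticAt ℂ (s u) φ) ∧
      IsBlochSolution V (E - W φ) (Complex.exp (((σ : ℤ) : ℂ) * Complex.I * κ φ))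
        (fun u => s u φ) ∧
      (φ ∈ regularSet V W E D κ → CanonicalAt V W E κ σ s φ) := by
  have hσ2 : ((σ : ℤ) : ℂ) * ((σ : ℤ) : ℂ) = 1 := by
    rcases Int.units_eq_one_or σ with rfl | rfl <;> simp
  have hσ : ((σ : ℤ) : ℂ) ≠ 0 := fun h => by simp [h] at hσ2
  have hmulσ : ∀ᶠ e in 𝓝 (E - W φ₀),
      IsFloquetMultiplier V e (Complex.exp (Complex.I * (((σ : ℤ) : ℂ) * k e))) := by
    rcases Int.units_eq_one_or σ with rfl | rfl
    · simpa using hmul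
    · simpa using eventually_isFloquetMultiplier_neg hV hper hk.1 hmul
  obtain ⟨F, hF⟩ := exists_local_section hV hper hσ (k := fun e => ((σ : ℤ) : ℂ) * k e)
    (analyticAt_const.mul hk.1) hmulσ
  have hωc : ∀ φ ∈ D, ContinuousAt (fun z => E - W z) φ := fun φ hφ =>
    continuousAt_const.sub (hW φ hφ).continuousAt
  refine ⟨fun u φ => F u (E - W φ), ?_⟩
  filter_upwards [(hωc φ₀ hφ₀).eventually hF, hk.eventually (hW φ₀ hφ₀), hD.mem_nhds hφ₀]
    with φ ⟨h1, h2, h3⟩ h4 h5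
  refine ⟨fun u => ?_, ?_, fun hreg => ?_⟩
  · exact AnalyticAt.fun_comp (h1 u) (analyticAt_const.sub (hW φ h5))
  · have he : ((σ : ℤ) : ℂ) * Complex.I * κ φ = Complex.I * (((σ : ℤ) : ℂ) * k (E - W φ)) := by
      rw [h4.2.self_of_nhds]; ring
    rw [he]
    exact h2
  · have hd := h4.deriv_ne_zero (hω φ h5) hreg
    have hdσ : ∀ e, AnalyticAt ℂ k e →
        deriv (fun e => ((σ : ℤ) : ℂ) * k e) e = ((σ : ℤ) : ℂ) * deriv k e := fun e he =>
      deriv_const_mul _ he.differentiableAt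
    obtain ⟨q, G, hq, hqk, hG, hf⟩ := h3 hreg.2.1 (by
      rw [hdσ _ h4.1]
      exact mul_ne_zero hσ hd)
    refine ⟨k, q, G, h4, hq, ?_, ?_, ?_⟩
    · filter_upwards [hqk, h4.1.eventually_analyticAt] with e g1 g2
      rw [g1, hdσ e g2, ← mul_assoc, hσ2, one_mul]
    · filter_upwards [hG] with e g1
      rwa [blochG_eq_one]
    · filter_upwards [(hωc φ h5).eventually hf] with z g1 u
      rw [g1, ← blochPsi_mul, mul_one]

end Canonical

end

end PeriodicSchrodinger

end

open PeriodicSchrodinger in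
theorem lemma3p1 (V : ℝ → ℝ) (hVper : Function.Periodic V 1)
    (hV : MeasureTheory.MemLp V 2 (MeasureTheory.volume.restrict (Set.Ioc (0 : ℝ) 1)))
    (W : ℂ → ℂ) (E : ℂ) (D : Set ℂ) (hDo : IsOpen D) (hDs : IsSimplyConnected D)
    (hW : AnalyticOnNhd ℂ W D) (hWc : ¬ ∃ c : ℂ, ∀ φ ∈ D, W φ = c)
    (hbr : ∀ φ ∈ D, ¬ PeriodicSchrodinger.IsBranchPoint V (E - W φ))
    (κ : ℂ → ℂ) (hκ : PeriodicSchrodinger.IsMomentumBranch V W E D κ) (σ : ℤˣ) :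
    (∀ φ ∈ D, ∀ᶠ z in 𝓝[≠] φ, z ∈ PeriodicSchrodinger.regularSet V W E D κ) ∧
    ∃ Ψ : ℝ → ℂ → ℂ,
      PeriodicSchrodinger.IsCanonicalBloch V W E D κ σ Ψ ∧
      (∀ u : ℝ, AnalyticOnNhd ℂ (Ψ u) D) ∧
      (∀ φ ∈ D, PeriodicSchrodinger.IsBlochSolution V (E - W φ)
        (Complex.exp (((σ : ℤ) : ℂ) * Complex.I * κ φ)) (fun u => Ψ u φ)) ∧
      ∀ Ψ' : ℝ → ℂ → ℂ, PeriodicSchrodinger.IsCanonicalBloch V W E D κ σ Ψ' →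
        ∃ c : ℂ, c ≠ 0 ∧ ∀ φ ∈ PeriodicSchrodinger.regularSet V W E D κ, ∀ u : ℝ,
          Ψ' u φ = c * Ψ u φ := by
  have hI := intervalIntegrable_of_periodic_of_memLp hVper hV
  have hDp : IsPreconnected D := hDs.isPathConnected.isConnected.isPreconnected
  have hω : ∀ φ ∈ D, 𝓝 (E - W φ) ≤ map (fun z => E - W z) (𝓝 φ) := fun φ hφ =>
    nhds_le_map_energy hDp hW hWc E hφ
  have hne : ∀ φ ∈ D, Tendsto (fun z => E - W z) (𝓝[≠] φ) (𝓝[≠] (E - W φ)) := fun φ hφ =>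
    tendsto_energy_punctured hDp hW hWc E hφ
  have hκm : ∀ φ ∈ D, ∀ᶠ z in 𝓝 φ,
      IsFloquetMultiplier V (E - W z) (Complex.exp (Complex.I * κ z)) := fun φ hφ => by
    filter_upwards [hDo.mem_nhds hφ] with z hz using hκ.2 z hz
  have hbranch : ∀ φ ∈ D, ∃ k, IsLocalBranch W E κ k φ := fun φ hφ => by
    refine exists_isLocalBranch hI (hW φ hφ) (hne φ hφ) (hbr φ hφ) ?_ (hκm φ hφ)
    filter_upwards [hDo.mem_nhds hφ] with z hz using hκ.1.continuousAt (hDo.mem_nhds hz)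
  choose! k hk using hbranch
  have hkm := fun φ hφ => (hk φ hφ).eventually_isFloquetMultiplier (hω φ hφ) (hκm φ hφ)
  have hreg : ∀ φ ∈ D, ∀ᶠ z in 𝓝[≠] φ, z ∈ regularSet V W E D κ := fun φ hφ =>
    eventually_mem_regularSet hI hDo hφ (hW φ hφ) (hne φ hφ) (hk φ hφ) (hkm φ hφ)
  refine ⟨hreg, ?_⟩
  have hloc : ∀ φ ∈ D, ∃ (s : ℝ → ℂ → ℂ) (r : ℝ), 0 < r ∧ Metric.ball φ r ⊆ D ∧
      ∀ z ∈ Metric.ball φ r, (∀ u, AnalyticAt ℂ (s u) z) ∧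
        IsBlochSolution V (E - W z) (Complex.exp (((σ : ℤ) : ℂ) * Complex.I * κ z))
          (fun u => s u z) ∧
        (z ∈ regularSet V W E D κ → CanonicalAt V W E κ σ s z) := fun φ hφ => by
    obtain ⟨s, hs⟩ := exists_canonical_near hI hVper hDo hW hω hφ (hk φ hφ) (hkm φ hφ) σ
    obtain ⟨r, hr, hball⟩ := Metric.mem_nhds_iff.1 ((hDo.eventually_mem hφ).and hs)
    exact ⟨s, r, hr, fun z hz => (hball hz).1, fun z hz => (hball hz).2⟩
  choose! s r hr hrD hs using hloc
  obtain ⟨S, hS⟩ := exists_global_section (G := ℂˣ) (M := ℝ → ℂ) hDo hDs r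
    (fun i z u => s i u z) hr
    (fun i hi z hz g hg => by
      obtain ⟨u, hu⟩ := Function.ne_iff.1 (hs i hi z hz).2.1.2.1
      have h1 : (g : ℂ) * s i u z = s i u z := congrFun hg u
      exact Units.ext (mul_right_cancel₀ hu (by rw [h1, Units.val_one, one_mul])))
    (fun i hi j hj => by
      have hconv : Convex ℝ (Metric.ball i (r i) ∩ Metric.ball j (r j)) :=
        (convex_ball i (r i)).inter (convex_ball j (r j))
      have hopen : IsOpen (Metric.ball i (r i) ∩ Metric.ball j (r j)) :=
        Metric.isOpen_ball.inter Metric.isOpen_ball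
      obtain ⟨c, hc0, hc⟩ := exists_const_of_canonicalAt hI hW hω hreg hopen hconv.isPreconnected
        (Set.inter_subset_left.trans (hrD i hi)) (fun φ hφ => (hs j hj φ hφ.2).2.2)
        (fun φ hφ => (hs i hi φ hφ.1).2.2)
      refine ⟨Units.mk0 c hc0, fun z hz => funext fun u => ?_⟩
      -- the relation extends to the non-regular points by analyticity
      have h1 : ∀ᶠ w in 𝓝[≠] z, s i u w = c * s j u w := by
        filter_upwards [hreg z hz.2, mem_nhdsWithin_of_mem_nhds (hopen.mem_nhds hz.1)]
          with w g1 g2 using hc w g2 g1 u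
      exact (((hs i hi z hz.1.1).1 u).frequently_eq_iff_eventually_eq
        (analyticAt_const.mul ((hs j hj z hz.1.2).1 u))).1 h1.frequently |>.self_of_nhds)
  have hS' : ∀ φ ∈ D, ∃ c : ℂ, c ≠ 0 ∧ ∀ᶠ z in 𝓝 φ, ∀ u, S z u = c * s φ u z := fun φ hφ => by
    obtain ⟨g, hg⟩ := hS φ hφ
    exact ⟨g, g.ne_zero, hg.mono fun z hz u => congrFun hz u⟩
  have hcan : ∀ φ ∈ D, φ ∈ regularSet V W E D κ →
      CanonicalAt V W E κ σ (fun u z => S z u) φ := fun φ hφ hφr => by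
    obtain ⟨c, hc0, hc⟩ := hS' φ hφ
    exact ((hs φ hφ φ (Metric.mem_ball_self (hr φ hφ))).2.2 hφr).smul hc0 hc
  refine ⟨fun u z => S z u, fun φ hφ => hcan φ hφ.1 hφ, fun u φ hφ => ?_, fun φ hφ => ?_,
    fun Ψ' hΨ' => ?_⟩
  · obtain ⟨c, -, hc⟩ := hS' φ hφ
    exact (analyticAt_const.mul ((hs φ hφ φ (Metric.mem_ball_self (hr φ hφ))).1 u)).congr
      (hc.mono fun z hz => (hz u).symm)
  · obtain ⟨c, hc0, hc⟩ := hS' φ hφ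
    exact IsBlochSolution.const_mul hI (hs φ hφ φ (Metric.mem_ball_self (hr φ hφ))).2.1 hc0
      hc.self_of_nhds
  · obtain ⟨c, hc0, hc⟩ := exists_const_of_canonicalAt hI hW hω hreg hDo hDp Set.Subset.rfl hcan
      (fun φ _ hφ => hΨ' φ hφ)
    exact ⟨c, hc0, fun φ hφ => hc φ hφ.1 hφ⟩
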